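/- A function $\Phi:[0,\infty)\to[0,\infty)$ is called a nice Young function (N-function) if it is convex and continuous, $\Phi(u)=0$ if and only if $u=0$, $\lim_{u\to0^+}\Phi(u)/u=0$ and $\lim_{u\to\infty}\Phi(u)/u=\infty$. Write $\Phi\in\Delta_2$ if there are $K_1>0$, $u_1\ge0$ with $\Phi(2u)\le K_1\Phi(u)$ for all $u\ge u_1$, and $\Phi\in\nabla_2$ if there are $K_2>2$, $u_2\ge0$ with $\Phi(2u)\ge K_2\Phi(u)$ for all $u\ge u_2$. For a measurable function $F$ on $\mathbb T=\mathbb R/\mathbb Z$ (with Lebesgue measure) put $$\|F\|_\Phi=\inf\Big\{k>0:\int_{\mathbb T}\Phi(|F|/k)\,dx\le1\Big\}\in[0,\infty],$$ with the conventions $\Phi(\infty)=\infty$ and $\inf\emptyset=\infty$. Let $\psi:\mathbb R\to\mathbb C$ be a compactly supported smooth function which is equal to $1$ in a neighbourhood of $0$, and let $$\psi_0(\xi)=\psi(\xi),\qquad \psi_{j+1}(\xi)=\psi\Big(\frac{\xi}{2^{j+1}}\Big)-\psi\Big(\frac{\xi}{2^{j}}\Big)\quad(j=0,1,2,\dots).$$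 For $f\in L^1(\mathbb T)$ with Fourier coefficients $a_n=\int_{\mathbb T}f(x)e^{-2\pi inx}\,dx$ put $$\tilde P_jf(x)=\sum_{n\in\mathbb Z}\psi_j(n)\,a_n\,e^{2\pi inx}\qquad(j=0,1,2,\dots).$$ **Lemma (Littlewood–Paley estimate in Orlicz spaces).** Assume that $\Phi$ is a nice Young function with $\Phi\in\Delta_2\cap\nabla_2$. Then there are constants $0<c\le C<\infty$, depending only on $\Phi$ and $\psi$, such that for every complex-valued $f\in L^1(\mathbb T)$ (in particular for every $f\in L^\Phi(\mathbb T)$) $$c\,\|f\|_\Phi\;\le\;\Big\|\Big(\sum_{j=0}^\infty|\tilde P_jf|^2\Big)^{1/2}\Big\|_\Phi\;\le\;C\,\|f\|_\Phi .$$ Here both sides may be infinite; in particular, for $f\in L^1(\mathbb T)$, the square function lies in $L^\Phi(\mathbb T)$ if and only if $f$ does. -/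

import Mathlib

open MeasureTheory Filter Topology
open scoped NNReal ENNReal ContDiff

namespace OrliczLP

/-- A Young function `Φ : [0,∞) → [0,∞]`: convex, `Φ 0 = 0`, and `Φ u → +∞` as `u → ∞`. -/
structure IsYoung (Φ : ℝ≥0 → ℝ≥0∞) : Prop where
  convex : ConvexOn ℝ≥0 Set.univ Φ
  map_zero : Φ 0 = 0
  tendsto_top : Tendsto Φ atTop (𝓝 ⊤)

/-- A nice Young function (N-function): a finite-valued continuous Young function, vanishing only
at `0`, with `Φ u / u → 0` as `u → 0` and `Φ u / u → ∞` as `u → ∞`. -/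
structure IsNiceYoung (Φ : ℝ≥0 → ℝ≥0∞) : Prop extends IsYoung Φ where
  finite : ∀ u, Φ u ≠ ⊤
  continuous : Continuous Φ
  eq_zero_iff : ∀ u, Φ u = 0 ↔ u = 0
  tendsto_div_zero : Tendsto (fun u : ℝ≥0 => Φ u / (u : ℝ≥0∞)) (𝓝[>] 0) (𝓝 0)
  tendsto_div_top : Tendsto (fun u : ℝ≥0 => Φ u / (u : ℝ≥0∞)) atTop (𝓝 ⊤)

/-- The condition `Φ ∈ Δ₂` (for large arguments). -/
def DeltaTwo (Φ : ℝ≥0 → ℝ≥0∞) : Prop :=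
  ∃ K : ℝ≥0, 0 < K ∧ ∃ u₁ : ℝ≥0, ∀ u, u₁ ≤ u → Φ (2 * u) ≤ K * Φ u

/-- The condition `Φ ∈ ∇₂` (for large arguments). -/
def NablaTwo (Φ : ℝ≥0 → ℝ≥0∞) : Prop :=
  ∃ K : ℝ≥0, 2 < K ∧ ∃ u₂ : ℝ≥0, ∀ u, u₂ ≤ u → K * Φ u ≤ Φ (2 * u)

/-- The extension of `Φ` to `[0,∞]` by `Φ ∞ = ∞`. -/
noncomputable def extend (Φ : ℝ≥0 → ℝ≥0∞) (t : ℝ≥0∞) : ℝ≥0∞ :=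
  if t = ⊤ then ⊤ else Φ t.toNNReal

/-- The Orlicz (Luxemburg) norm `inf {k > 0 : ∫ Φ(F / k) dμ ≤ 1}` of a function with values in
`[0,∞]`; the infimum of the empty set is `∞`. -/
noncomputable def luxemburgNorm {Ω : Type*} [MeasurableSpace Ω] (μ : Measure Ω)
    (Φ : ℝ≥0 → ℝ≥0∞) (F : Ω → ℝ≥0∞) : ℝ≥0∞ :=
  ⨅ (k : ℝ≥0) (_ : 0 < k ∧ ∫⁻ x, extend Φ (F x / (k : ℝ≥0∞)) ∂μ ≤ 1), (k : ℝ≥0∞)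

/-- The dyadic symbols generated by `ψ`:
`ψ₀ = ψ` and `ψ_{j+1}(ξ) = ψ(ξ / 2^{j+1}) - ψ(ξ / 2^j)`. -/
noncomputable def symbol (ψ : ℝ → ℂ) : ℕ → ℝ → ℂ
  | 0, ξ => ψ ξ
  | j + 1, ξ => ψ (ξ / 2 ^ (j + 1)) - ψ (ξ / 2 ^ j)

/-- The smooth dyadic frequency projection
`P̃_j f (x) = ∑ n, ψ_j(n) a_n e^{2πinx}`, where `a_n` are the Fourier coefficients of `f` on
`𝕋 = ℝ/ℤ`. For compactly supported `ψ` only finitely many terms are nonzero. -/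
noncomputable def proj (ψ : ℝ → ℂ) (j : ℕ) (f : UnitAddCircle → ℂ) (x : UnitAddCircle) : ℂ :=
  ∑' n : ℤ, symbol ψ j (n : ℝ) * fourierCoeff f n * fourier n x

/-- The square function `(∑_{j ≥ 0} |P̃_j f|²)^{1/2}`, with values in `[0,∞]`. -/
noncomputable def squareFunction (ψ : ℝ → ℂ) (f : UnitAddCircle → ℂ) (x : UnitAddCircle) :
    ℝ≥0∞ :=
  (∑' j : ℕ, ‖proj ψ j f x‖ₑ ^ 2) ^ (1 / 2 : ℝ)

end OrliczLP

/-! The square function is the limit of the norms of the vectors `(P̃_j f)_{j < N}`, which arise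
from `f` by convolution with a kernel taking values in `EuclideanSpace ℂ (Fin N)`. These kernels
satisfy Hörmander's condition and an `L²` bound with constants independent of `N`. Everything is
therefore reduced to a Calderón–Zygmund theorem in Orlicz spaces, with constants that do not see the
target Hilbert space.

That theorem (`exists_modular_bound`) goes as follows. The Calderón–Zygmund decomposition gives weak
type `(1, 1)`. Interpolation with `L²` gives `L^q` for `1 < q < 2`, and duality gives `L^r` for
every large `r`. A Marcinkiewicz argument for the modular `∫ Φ(|·|)` (`lintegral_conv_le`) then
interpolates between weak type `(1, 1)` and `L^r`: `∇₂` sums the levels below `|f|`, while `Δ₂` with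
`K₁ < 2^r` sums those above. Convexity turns the modular bound into a norm bound, and Fatou's lemma
lets `N → ∞`. This is the upper estimate.

For the lower estimate, real multipliers `θ_j` of the same type with `θ_j ψ_j = ψ_j` are chosen. The
adjoint of the vector operator of `θ` maps `(P̃_j f)_{j ≤ N}` to `∑_{j ≤ N} P̃_j f`, which
telescopes to the smooth truncation with symbol `ψ(n / 2^N)`. The adjoint is again a
Calderón–Zygmund operator, so the truncations are controlled by the square function. They converge
to `f` in `L¹`, hence a.e. along a subsequence, and Fatou's lemma concludes. Only `f ∈ L¹` is
needed, so infinite norms are covered. -/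

namespace OrliczLP

/-! ### Dyadic arcs of the circle. -/

/-- The representative in `(0, 1]` of a point of the circle. -/
noncomputable def circleRep (x : UnitAddCircle) : ℝ :=
  (AddCircle.measurableEquivIoc 1 0 x : ℝ)

lemma circleRep_mem (x : UnitAddCircle) : circleRep x ∈ Set.Ioc (0 : ℝ) 1 := by
  have h := (AddCircle.measurableEquivIoc 1 0 x).2
  simpa [circleRep] using h

lemma coe_circleRep (x : UnitAddCircle) : ((circleRep x : ℝ) : UnitAddCircle) = x :=
  (AddCircle.measurableEquivIoc 1 0).symm_apply_apply x

lemma circleRep_coe {t : ℝ} (ht : t ∈ Set.Ioc (0 : ℝ) 1) :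
    circleRep (t : UnitAddCircle) = t := by
  have ht' : t ∈ Set.Ioc (0 : ℝ) (0 + 1) := by simpa using ht
  exact congrArg Subtype.val ((AddCircle.measurableEquivIoc 1 0).apply_symm_apply ⟨t, ht'⟩)

lemma measurable_circleRep : Measurable circleRep :=
  measurable_subtype_coe.comp (AddCircle.measurableEquivIoc 1 0).measurable

/-- The index of the dyadic arc of generation `m` containing `x`. -/
noncomputable def arcIndex (m : ℕ) (x : UnitAddCircle) : ℤ := ⌈2 ^ m * circleRep x⌉

/-- The midpoint of the dyadic arc of generation `m` and index `k`. -/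
noncomputable def arcCenter (m : ℕ) (k : ℤ) : UnitAddCircle :=
  (((k - 1 / 2) / 2 ^ m : ℝ) : UnitAddCircle)

lemma measurable_arcIndex (m : ℕ) : Measurable (arcIndex m) :=
  Int.measurable_ceil.comp (measurable_circleRep.const_mul _)

lemma arcIndex_zero (x : UnitAddCircle) : arcIndex 0 x = 1 := by
  have h := circleRep_mem x
  rw [arcIndex, Int.ceil_eq_iff]
  simpa using h

/-- Nestedness of the arcs: if `k` is the index at generation `m + 1`, the parent has index `⌈k /
2⌉`. The two negations express this ceiling through integer division, which rounds down. -/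
lemma arcIndex_eq_of_succ {m : ℕ} {x y : UnitAddCircle}
    (h : arcIndex (m + 1) x = arcIndex (m + 1) y) : arcIndex m x = arcIndex m y := by
  have key : ∀ t : ℝ, ⌈2 ^ m * t⌉ = -((-⌈2 ^ (m + 1) * t⌉) / 2) := by
    intro t
    have h := Int.floor_div_natCast (-(2 ^ (m + 1) * t)) 2
    rw [Int.floor_neg] at h
    have h3 : (-⌈2 ^ (m + 1) * t⌉) / 2 = ⌊-(2 ^ (m + 1) * t) / (2 : ℕ)⌋ := h.symm
    rw [h3, ← Int.ceil_neg]
    congr 1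
    push_cast
    ring
  rw [arcIndex, arcIndex, key, key]
  exact congrArg (fun k : ℤ => -((-k) / 2)) h

lemma arcIndex_eq_of_le {m n : ℕ} (hmn : m ≤ n) {x y : UnitAddCircle}
    (h : arcIndex n x = arcIndex n y) : arcIndex m x = arcIndex m y := by
  induction n, hmn using Nat.le_induction with
  | base => exact h
  | succ n _ ih => exact ih (arcIndex_eq_of_succ h)

lemma arcIndex_eq_iff {m : ℕ} {k : ℤ} {x : UnitAddCircle} :
    arcIndex m x = k ↔ circleRep x ∈ Set.Ioc ((k - 1) / 2 ^ m : ℝ) (k / 2 ^ m) := by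
  have h2 : (0 : ℝ) < 2 ^ m := by positivity
  rw [arcIndex, Int.ceil_eq_iff, Set.mem_Ioc, div_lt_iff₀ h2, le_div_iff₀ h2,
    mul_comm (circleRep x)]

lemma mem_closedBall_arcCenter {m : ℕ} {k : ℤ} {x : UnitAddCircle} (h : arcIndex m x = k) :
    x ∈ Metric.closedBall (arcCenter m k) ((2 : ℝ)⁻¹ ^ (m + 1)) := by
  obtain ⟨h1, h2⟩ := arcIndex_eq_iff.1 h
  have e1 : ((k : ℝ) - 1 / 2) / 2 ^ m = (k - 1) / 2 ^ m + 2⁻¹ ^ (m + 1) := by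
    rw [pow_succ, inv_pow]; field_simp; ring
  have e2 : ((k : ℝ) - 1 / 2) / 2 ^ m = k / 2 ^ m - 2⁻¹ ^ (m + 1) := by
    rw [pow_succ, inv_pow]; field_simp
  rw [Metric.mem_closedBall, dist_eq_norm, arcCenter]
  nth_rewrite 1 [← coe_circleRep x]
  rw [← AddCircle.coe_sub]
  refine (QuotientAddGroup.norm_mk_le_norm).trans ?_
  rw [Real.norm_eq_abs, abs_le]
  constructor <;> linarith

lemma volume_arc (m : ℕ) (x : UnitAddCircle) :
    volume {y | arcIndex m y = arcIndex m x} = 2⁻¹ ^ m := by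
  set k := arcIndex m x with hk
  have h2 : (0 : ℝ) < 2 ^ m := by positivity
  have hx := arcIndex_eq_iff.1 hk.symm
  have hx' := circleRep_mem x
  have k1 : (1 : ℤ) ≤ k := by
    have : (0 : ℝ) < k / 2 ^ m := hx'.1.trans_le hx.2
    have : (0 : ℝ) < k := by simpa [h2] using this
    exact_mod_cast this
  have k2 : k ≤ 2 ^ m := by
    have : ((k : ℝ) - 1) / 2 ^ m < 1 := hx.1.trans_le hx'.2
    rw [div_lt_one h2] at this
    have h3 : k - 1 < 2 ^ m := by exact_mod_cast this
    omega
  have hms : MeasurableSet {y | arcIndex m y = k} := measurable_arcIndex m (measurableSet_singleton k)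
  rw [AddCircle.add_projection_respects_measure 1 0 hms]
  have : (QuotientAddGroup.mk ⁻¹' {y | arcIndex m y = k} ∩ Set.Ioc (0 : ℝ) (0 + 1))
      = Set.Ioc ((k - 1) / 2 ^ m : ℝ) (k / 2 ^ m) := by
    ext t
    simp only [zero_add, Set.mem_inter_iff, Set.mem_preimage, Set.mem_ofPred_eq]
    constructor
    · rintro ⟨h, ht⟩
      have := arcIndex_eq_iff.1 h
      rwa [circleRep_coe ht] at this
    · intro h
      have ht : t ∈ Set.Ioc (0 : ℝ) 1 := by
        have k1' : (1 : ℝ) ≤ k := by exact_mod_cast k1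
        have k2' : (k : ℝ) ≤ 2 ^ m := by exact_mod_cast k2
        constructor
        · exact lt_of_le_of_lt (div_nonneg (by linarith) h2.le) h.1
        · exact h.2.trans ((div_le_one h2).2 k2')
      refine ⟨arcIndex_eq_iff.2 ?_, ht⟩
      rwa [circleRep_coe ht]
  rw [this, Real.volume_Ioc]
  have : (k / 2 ^ m - (k - 1) / 2 ^ m : ℝ) = 2⁻¹ ^ m := by rw [inv_pow]; field_simp; ring
  rw [this, ENNReal.ofReal_pow (by norm_num), ENNReal.ofReal_inv_of_pos (by norm_num)]
  simp

/-! ### Calderón–Zygmund decomposition on dyadic arcs. -/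

section Decomposition

variable {E : Type*} [NormedAddCommGroup E]

/-- The mean of `‖f‖` over the dyadic arc of generation `m` containing `x`. -/
noncomputable def arcMean (f : UnitAddCircle → E) (m : ℕ) (x : UnitAddCircle) : ℝ≥0∞ :=
  2 ^ m * ∫⁻ y in {y | arcIndex m y = arcIndex m x}, ‖f y‖ₑ

lemma arcMean_congr {f : UnitAddCircle → E} {m : ℕ} {x y : UnitAddCircle}
    (h : arcIndex m x = arcIndex m y) : arcMean f m x = arcMean f m y := by
  rw [arcMean, arcMean, h]

lemma measurableSet_arc (m : ℕ) (k : ℤ) : MeasurableSet {y | arcIndex m y = k} :=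
  measurable_arcIndex m (measurableSet_singleton k)

lemma measurable_arcMean (f : UnitAddCircle → E) (m : ℕ) : Measurable (arcMean f m) :=
  (measurable_of_countable fun k : ℤ =>
    (2 : ℝ≥0∞) ^ m * ∫⁻ y in {y | arcIndex m y = k}, ‖f y‖ₑ).comp (measurable_arcIndex m)

lemma arcMean_succ_le (f : UnitAddCircle → E) (m : ℕ) (x : UnitAddCircle) :
    arcMean f (m + 1) x ≤ 2 * arcMean f m x := by
  rw [arcMean, arcMean, pow_succ', mul_assoc]
  refine mul_le_mul_right (mul_le_mul_right (lintegral_mono_set fun y hy => ?_) _) _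
  exact arcIndex_eq_of_succ hy

lemma arcMean_zero (f : UnitAddCircle → E) (x : UnitAddCircle) :
    arcMean f 0 x = ∫⁻ y, ‖f y‖ₑ := by
  simp [arcMean, arcIndex_zero]

/-- The half-open arc lies in the closed ball about its midpoint, and both have measure `2⁻ᵐ`.
Averages over arcs thus become averages over balls, to which Lebesgue differentiation applies. -/
lemma arc_ae_eq_closedBall (m : ℕ) (x : UnitAddCircle) :
    ({y | arcIndex m y = arcIndex m x} : Set UnitAddCircle) =ᵐ[volume]
      Metric.closedBall (arcCenter m (arcIndex m x)) ((2 : ℝ)⁻¹ ^ (m + 1)) := by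
  refine ae_eq_of_subset_of_measure_ge (fun y hy => mem_closedBall_arcCenter hy) ?_
    (measurableSet_arc _ _).nullMeasurableSet (measure_ne_top _ _)
  rw [volume_arc, AddCircle.volume_closedBall]
  refine (ENNReal.ofReal_le_ofReal (min_le_right _ _)).trans ?_
  have : (2 * 2⁻¹ ^ (m + 1) : ℝ) = 2⁻¹ ^ m := by rw [pow_succ]; ring
  rw [this, ENNReal.ofReal_pow (by norm_num), ENNReal.ofReal_inv_of_pos (by norm_num)]
  simp

/-- Lebesgue differentiation along the arcs shrinking to `x`. The balls contain `x` without being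
centred there, hence the differentiation theorem for doubling measures with moving centres. -/
lemma ae_enorm_le_of_arcMean_le {f : UnitAddCircle → E} (hf : Integrable f) (l : ℝ≥0) :
    ∀ᵐ x, (∀ m, arcMean f m x ≤ l) → ‖f x‖ₑ ≤ l := by
  filter_upwards [IsUnifLocDoublingMeasure.ae_tendsto_average (μ := volume)
    hf.norm.locallyIntegrable 1] with x hx hm
  have hlim := hx (fun m : ℕ => arcCenter m (arcIndex m x)) (fun m : ℕ => (2 : ℝ)⁻¹ ^ (m + 1))
    (l := atTop) ?_ ?_
  · have hle : ‖f x‖ ≤ l := by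
      refine le_of_tendsto hlim (Eventually.of_forall fun m => ?_)
      rw [← setAverage_congr (arc_ae_eq_closedBall m x), setAverage_eq, measureReal_def,
        volume_arc, integral_norm_eq_lintegral_enorm hf.aestronglyMeasurable.restrict]
      have h1 := ENNReal.toReal_mono ENNReal.coe_ne_top (hm m)
      rw [arcMean, ENNReal.toReal_mul] at h1
      simpa using h1
    rw [← ofReal_norm, ← ENNReal.ofReal_coe_nnreal]
    exact ENNReal.ofReal_le_ofReal hle
  · rw [tendsto_nhdsWithin_iff]
    refine ⟨((tendsto_pow_atTop_nhds_zero_of_lt_one (by norm_num) (by norm_num)).comp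
      (tendsto_add_atTop_nat 1)), Eventually.of_forall fun m => ?_⟩
    simp only [Set.mem_Ioi]; positivity
  · exact Eventually.of_forall fun m => by
      rw [one_mul]; exact mem_closedBall_arcCenter rfl

/-- The arc of generation `p.1` and index `p.2`, if it is a maximal arc on which the mean of
`‖f‖` exceeds `l`; empty otherwise. -/
def maximalArc (f : UnitAddCircle → E) (l : ℝ≥0) (p : ℕ × ℤ) : Set UnitAddCircle :=
  {x | arcIndex p.1 x = p.2 ∧ l < arcMean f p.1 x ∧ ∀ m < p.1, arcMean f m x ≤ l}

lemma measurableSet_maximalArc (f : UnitAddCircle → E) (l : ℝ≥0) (p : ℕ × ℤ) :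
    MeasurableSet (maximalArc f l p) := by
  have : maximalArc f l p = {x | arcIndex p.1 x = p.2} ∩ ((arcMean f p.1) ⁻¹' Set.Ioi (l : ℝ≥0∞) ∩
      ⋂ m, ⋂ (_ : m < p.1), (arcMean f m) ⁻¹' Set.Iic (l : ℝ≥0∞)) := by
    ext x; simp [maximalArc]
  rw [this]
  exact (measurableSet_arc _ _).inter ((measurable_arcMean f _ measurableSet_Ioi).inter
    (MeasurableSet.iInter fun m => MeasurableSet.iInter fun _ =>
      measurable_arcMean f _ measurableSet_Iic))

lemma maximalArc_eq {f : UnitAddCircle → E} {l : ℝ≥0} {p : ℕ × ℤ} {x : UnitAddCircle}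
    (hx : x ∈ maximalArc f l p) :
    maximalArc f l p = {y | arcIndex p.1 y = arcIndex p.1 x} := by
  obtain ⟨h1, h2, h3⟩ := hx
  ext y
  constructor
  · rintro ⟨h4, -, -⟩
    exact h4.trans h1.symm
  · intro h4
    refine ⟨h4.trans h1, by rwa [arcMean_congr h4], fun m hm => ?_⟩
    rw [arcMean_congr (arcIndex_eq_of_le hm.le h4)]
    exact h3 m hm

lemma pairwise_disjoint_maximalArc (f : UnitAddCircle → E) (l : ℝ≥0) :
    Pairwise (Function.onFun Disjoint (maximalArc f l)) := by
  rintro ⟨m, k⟩ ⟨n, j⟩ hne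
  refine Set.disjoint_left.2 ?_
  rintro x ⟨h1, h2, h3⟩ ⟨h4, h5, h6⟩
  simp only at h1 h2 h3 h4 h5 h6
  rcases lt_trichotomy m n with h | rfl | h
  · exact absurd (h6 m h) (not_le.2 h2)
  · exact hne (by rw [← h1, ← h4])
  · exact absurd (h3 n h) (not_le.2 h5)

/-- The first generation at which the mean exceeded `l` would give a maximal arc through `x`. -/
lemma arcMean_le_of_not_mem_maximalArc {f : UnitAddCircle → E} {l : ℝ≥0} {x : UnitAddCircle}
    (hx : x ∉ ⋃ p, maximalArc f l p) (m : ℕ) : arcMean f m x ≤ l := by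
  induction m using Nat.strong_induction_on with
  | _ m ih =>
    by_contra! h
    exact hx (Set.mem_iUnion.2 ⟨(m, arcIndex m x), rfl, h, ih⟩)

/-- By maximality the parent arc has mean at most `l`, and halving an arc at most doubles the mean.
Generation `0` is excluded because the mean over the whole circle is at most `l`. -/
lemma lintegral_maximalArc_le {f : UnitAddCircle → E} {l : ℝ≥0} (hl : ∫⁻ y, ‖f y‖ₑ ≤ l)
    {p : ℕ × ℤ} {x : UnitAddCircle} (hx : x ∈ maximalArc f l p) :
    2 ^ p.1 * ∫⁻ y in maximalArc f l p, ‖f y‖ₑ ≤ 2 * l := by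
  rw [maximalArc_eq hx]
  change arcMean f p.1 x ≤ 2 * l
  obtain ⟨h1, h2, h3⟩ := hx
  rcases h : p.1 with _ | m
  · rw [h, arcMean_zero] at h2
    exact absurd hl (not_le.2 h2)
  · refine (arcMean_succ_le f m x).trans ?_
    gcongr
    exact h3 m (by omega)

lemma lt_lintegral_maximalArc {f : UnitAddCircle → E} {l : ℝ≥0}
    {p : ℕ × ℤ} {x : UnitAddCircle} (hx : x ∈ maximalArc f l p) :
    l < 2 ^ p.1 * ∫⁻ y in maximalArc f l p, ‖f y‖ₑ := by
  rw [maximalArc_eq hx]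
  exact hx.2.1

lemma volume_maximalArc {f : UnitAddCircle → E} {l : ℝ≥0} {p : ℕ × ℤ} {x : UnitAddCircle}
    (hx : x ∈ maximalArc f l p) : volume (maximalArc f l p) = 2⁻¹ ^ p.1 := by
  rw [maximalArc_eq hx, volume_arc]

lemma lintegral_eq_tsum_maximalArc (f : UnitAddCircle → E) (l : ℝ≥0) (h : UnitAddCircle → ℝ≥0∞) :
    ∫⁻ x, h x = (∑' p, ∫⁻ x in maximalArc f l p, h x) +
      ∫⁻ x in (⋃ p, maximalArc f l p)ᶜ, h x := by
  rw [← lintegral_iUnion (measurableSet_maximalArc f l) (pairwise_disjoint_maximalArc f l),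
    lintegral_add_compl _ (MeasurableSet.iUnion (measurableSet_maximalArc f l))]

variable [NormedSpace ℝ E]

open Classical in
/-- The good part of the Calderón–Zygmund decomposition at height `l`. -/
noncomputable def goodPart (f : UnitAddCircle → E) (l : ℝ≥0) (x : UnitAddCircle) : E :=
  if h : ∃ p, x ∈ maximalArc f l p then ⨍ y in maximalArc f l h.choose, f y else f x

lemma goodPart_of_mem {f : UnitAddCircle → E} {l : ℝ≥0} {p : ℕ × ℤ} {x : UnitAddCircle}
    (hx : x ∈ maximalArc f l p) : goodPart f l x = ⨍ y in maximalArc f l p, f y := by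
  have h : ∃ p, x ∈ maximalArc f l p := ⟨p, hx⟩
  have : h.choose = p := by
    by_contra hne
    exact Set.disjoint_left.1 (pairwise_disjoint_maximalArc f l hne) h.choose_spec hx
  rw [goodPart, dif_pos h, this]

lemma goodPart_of_not_mem {f : UnitAddCircle → E} {l : ℝ≥0} {x : UnitAddCircle}
    (hx : x ∉ ⋃ p, maximalArc f l p) : goodPart f l x = f x := by
  rw [goodPart, dif_neg (by simpa using hx)]

lemma aestronglyMeasurable_goodPart {f : UnitAddCircle → E} (hf : Integrable f) (l : ℝ≥0) :
    AEStronglyMeasurable (goodPart f l) := by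
  have hU : MeasurableSet (⋃ p, maximalArc f l p) :=
    MeasurableSet.iUnion (measurableSet_maximalArc f l)
  rw [← Measure.restrict_univ (μ := volume), ← Set.union_compl_self (⋃ p, maximalArc f l p),
    aestronglyMeasurable_union_iff, aestronglyMeasurable_iUnion_iff]
  constructor
  · intro p
    refine (aestronglyMeasurable_const (b := ⨍ y in maximalArc f l p, f y)).congr ?_
    filter_upwards [ae_restrict_mem (measurableSet_maximalArc f l p)] with x hx
    exact (goodPart_of_mem hx).symm
  · refine hf.aestronglyMeasurable.restrict.congr ?_
    filter_upwards [ae_restrict_mem hU.compl] with x hx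
    exact (goodPart_of_not_mem hx).symm

lemma enorm_goodPart_le {f : UnitAddCircle → E} (hf : Integrable f) {l : ℝ≥0}
    (hl : ∫⁻ y, ‖f y‖ₑ ≤ l) : ∀ᵐ x, ‖goodPart f l x‖ₑ ≤ 2 * l := by
  filter_upwards [ae_enorm_le_of_arcMean_le hf l] with x hx
  by_cases h : x ∈ ⋃ p, maximalArc f l p
  · obtain ⟨p, hp⟩ := Set.mem_iUnion.1 h
    rw [goodPart_of_mem hp]
    refine le_trans ?_ (lintegral_maximalArc_le hl hp)
    rw [setAverage_eq, enorm_smul, measureReal_def, volume_maximalArc hp]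
    gcongr
    · simp [enorm_pow, Real.enorm_of_nonneg]
    · exact enorm_integral_le_lintegral_enorm _
  · rw [goodPart_of_not_mem h]
    refine (hx (arcMean_le_of_not_mem_maximalArc h)).trans ?_
    rw [two_mul]; exact le_self_add

lemma setLIntegral_enorm_goodPart_le (f : UnitAddCircle → E)  (l : ℝ≥0)
    (p : ℕ × ℤ) : ∫⁻ x in maximalArc f l p, ‖goodPart f l x‖ₑ ≤
      ∫⁻ x in maximalArc f l p, ‖f x‖ₑ := by
  rcases (maximalArc f l p).eq_empty_or_nonempty with h | ⟨x, hx⟩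
  · simp [h]
  rw [setLIntegral_congr_fun (measurableSet_maximalArc f l p)
    (fun y hy => by rw [goodPart_of_mem hy]), setLIntegral_const, setAverage_eq, enorm_smul,
    measureReal_def, volume_maximalArc hx, mul_right_comm]
  have : ‖((2⁻¹ ^ p.1 : ℝ≥0∞).toReal)⁻¹‖ₑ * 2⁻¹ ^ p.1 = 1 := by
    simp only [ENNReal.toReal_pow, ENNReal.toReal_inv, ENNReal.toReal_ofNat, inv_pow, inv_inv,
      enorm_pow, Real.enorm_of_nonneg zero_le_two, ENNReal.ofReal_ofNat]
    rw [← mul_pow, ENNReal.mul_inv_cancel (by simp) (by simp), one_pow]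
  rw [this, one_mul]
  exact enorm_integral_le_lintegral_enorm _

lemma lintegral_enorm_goodPart_le (f : UnitAddCircle → E) (l : ℝ≥0) :
    ∫⁻ x, ‖goodPart f l x‖ₑ ≤ ∫⁻ x, ‖f x‖ₑ := by
  rw [lintegral_eq_tsum_maximalArc f l, lintegral_eq_tsum_maximalArc f l (fun x => ‖f x‖ₑ)]
  gcongr ?_ + ?_
  · exact ENNReal.tsum_le_tsum fun p => setLIntegral_enorm_goodPart_le f l p
  · refine (setLIntegral_congr_fun (MeasurableSet.iUnion
      (measurableSet_maximalArc f l)).compl fun x hx => ?_).le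
    rw [goodPart_of_not_mem hx]

lemma integrable_goodPart {f : UnitAddCircle → E} (hf : Integrable f) (l : ℝ≥0) :
    Integrable (goodPart f l) :=
  ⟨aestronglyMeasurable_goodPart hf l, (lintegral_enorm_goodPart_le f l).trans_lt hf.2⟩

/-- The cancellation of the bad part on each arc, which is what makes Hörmander's condition
applicable. -/
lemma setIntegral_sub_goodPart [CompleteSpace E] {f : UnitAddCircle → E} (hf : Integrable f) (l : ℝ≥0)
    (p : ℕ × ℤ) : ∫ x in maximalArc f l p, (f x - goodPart f l x) = 0 := by
  rcases (maximalArc f l p).eq_empty_or_nonempty with h | ⟨x, hx⟩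
  · simp [h]
  rw [integral_sub hf.integrableOn (integrable_goodPart hf l).integrableOn,
    setIntegral_congr_fun (measurableSet_maximalArc f l p)
    (fun y hy => goodPart_of_mem hy), setIntegral_const, setAverage_eq, smul_smul,
    mul_inv_cancel₀, one_smul, sub_self]
  rw [measureReal_def, volume_maximalArc hx]
  simp

end Decomposition

instance : IsProbabilityMeasure (volume : Measure UnitAddCircle) :=
  ⟨UnitAddCircle.measure_univ⟩

/-! ### Operator-valued convolution, Hörmander's condition and weak type `(1, 1)`. -/

section Convolution

variable {H₁ H₂ : Type*} [NormedAddCommGroup H₁] [InnerProductSpace ℂ H₁]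
  [NormedAddCommGroup H₂] [InnerProductSpace ℂ H₂]

/-- Convolution on the circle with an operator-valued kernel. -/
noncomputable def conv (K : UnitAddCircle → H₁ →L[ℂ] H₂) (f : UnitAddCircle → H₁)
    (x : UnitAddCircle) : H₂ := ∫ y, K (x - y) (f y)

variable {K : UnitAddCircle → H₁ →L[ℂ] H₂} {f g : UnitAddCircle → H₁}

lemma exists_norm_le_of_continuous {E : Type*} [NormedAddCommGroup E] {k : UnitAddCircle → E}
    (hk : Continuous k) : ∃ C : ℝ, ∀ x, ‖k x‖ ≤ C := by
  obtain ⟨C, hC⟩ := isCompact_univ.exists_bound_of_continuousOn hk.continuousOn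
  exact ⟨C, fun x => hC x (Set.mem_univ x)⟩

lemma integrable_clm_apply {k : UnitAddCircle → H₁ →L[ℂ] H₂} (hk : Continuous k)
    (hf : Integrable f) : Integrable (fun y => k y (f y)) := by
  obtain ⟨C, hC⟩ := exists_norm_le_of_continuous hk
  refine (hf.norm.const_mul C).mono' ?_ (Eventually.of_forall fun y => ?_)
  · exact (ContinuousLinearMap.id ℂ (H₁ →L[ℂ] H₂)).aestronglyMeasurable_comp₂
      hk.aestronglyMeasurable hf.aestronglyMeasurable
  · exact ((k y).le_opNorm _).trans (by gcongr; exact hC y)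

lemma integrable_conv_kernel (hK : Continuous K) (hf : Integrable f) (x : UnitAddCircle) :
    Integrable (fun y => K (x - y) (f y)) :=
  integrable_clm_apply (hK.comp (continuous_const.sub continuous_id)) hf

lemma continuous_conv (hK : Continuous K) (hf : Integrable f) : Continuous (conv K f) := by
  obtain ⟨C, hC⟩ := exists_norm_le_of_continuous hK
  refine continuous_of_dominated (bound := fun y => C * ‖f y‖)
    (fun x => (integrable_conv_kernel hK hf x).aestronglyMeasurable)
    (fun x => Eventually.of_forall fun y => ?_) (hf.norm.const_mul C)
    (Eventually.of_forall fun y => ?_)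
  · exact ((K _).le_opNorm _).trans (by gcongr; exact hC _)
  · exact (hK.comp (continuous_id.sub continuous_const)).clm_apply continuous_const

lemma conv_add (hK : Continuous K) (hf : Integrable f) (hg : Integrable g) :
    conv K (fun x => f x + g x) = fun x => conv K f x + conv K g x := by
  funext x
  simp only [conv, map_add]
  exact integral_add (integrable_conv_kernel hK hf x) (integrable_conv_kernel hK hg x)

lemma conv_const_smul (K : UnitAddCircle → H₁ →L[ℂ] H₂) (f : UnitAddCircle → H₁) (c : ℂ) :
    conv K (fun x => c • f x) = fun x => c • conv K f x := by
  funext x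
  simp only [conv, map_smul]
  exact integral_smul _ _

/-- A continuous operator-valued kernel satisfying Hörmander's condition with constant `A`. -/
structure IsHormander (K : UnitAddCircle → H₁ →L[ℂ] H₂) (A : ℝ≥0) : Prop where
  continuous : Continuous K
  hormander : ∀ (ρ : ℝ) (y : UnitAddCircle), 0 < ρ → ‖y‖ ≤ ρ →
    ∫⁻ x in {x | 2 * ρ < ‖x‖}, ‖K (x - y) - K x‖ₑ ≤ A

/-- The `L^r` bound for convolution with `K`, with constant `A`, in integrated form. -/
def BoundedOn (K : UnitAddCircle → H₁ →L[ℂ] H₂) (r : ℝ) (A : ℝ≥0) : Prop :=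
  ∀ f : UnitAddCircle → H₁, Integrable f →
    ∫⁻ x, ‖conv K f x‖ₑ ^ r ≤ A * ∫⁻ x, ‖f x‖ₑ ^ r

/-- Since `b` has integral zero on `Q`, the kernel `K (x - y)` may be replaced by `K (x - y) - K (x
- c)`. After Tonelli, Hörmander's condition translated by `c` bounds the `x`-integral for each `y ∈
Q`. -/
lemma lintegral_conv_off_ball_le [CompleteSpace H₁] [CompleteSpace H₂] {A : ℝ≥0}
    (hK : IsHormander K A)
    {Q : Set UnitAddCircle} {c : UnitAddCircle} {ρ : ℝ} (hρ : 0 < ρ)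
    (hQc : Q ⊆ Metric.closedBall c ρ) {b : UnitAddCircle → H₁} (hb : Integrable b)
    (hb0 : ∫ y in Q, b y = 0) :
    ∫⁻ x in (Metric.closedBall c (2 * ρ))ᶜ, ‖∫ y in Q, K (x - y) (b y)‖ₑ ≤
      A * ∫⁻ y in Q, ‖b y‖ₑ := by
  have hcont := hK.continuous
  have h1 : ∀ x, ∫ y in Q, K (x - y) (b y) = ∫ y in Q, (K (x - y) - K (x - c)) (b y) := by
    intro x
    simp only [sub_apply]
    rw [integral_sub (integrable_conv_kernel hcont hb x).integrableOn
      (integrable_clm_apply continuous_const hb).integrableOn,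
      ContinuousLinearMap.integral_comp_comm _ hb.integrableOn, hb0, map_zero, sub_zero]
  have hmeas : AEMeasurable (fun p : UnitAddCircle × UnitAddCircle =>
      ‖K (p.1 - p.2) - K (p.1 - c)‖ₑ * ‖b p.2‖ₑ)
      ((volume.restrict (Metric.closedBall c (2 * ρ))ᶜ).prod (volume.restrict Q)) := by
    have h2 : AEMeasurable (fun p : UnitAddCircle × UnitAddCircle => ‖K (p.1 - p.2) - K (p.1 - c)‖ₑ)
      ((volume.restrict (Metric.closedBall c (2 * ρ))ᶜ).prod (volume.restrict Q)) := by
      have : Continuous fun p : UnitAddCircle × UnitAddCircle => K (p.1 - p.2) - K (p.1 - c) := by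
        fun_prop
      exact this.enorm.aemeasurable
    exact h2.mul hb.aestronglyMeasurable.restrict.enorm.comp_snd
  calc ∫⁻ x in (Metric.closedBall c (2 * ρ))ᶜ, ‖∫ y in Q, K (x - y) (b y)‖ₑ
      ≤ ∫⁻ x in (Metric.closedBall c (2 * ρ))ᶜ, ∫⁻ y in Q,
          ‖K (x - y) - K (x - c)‖ₑ * ‖b y‖ₑ := by
        refine lintegral_mono fun x => ?_
        rw [h1]
        refine (enorm_integral_le_lintegral_enorm _).trans (lintegral_mono fun y => ?_)
        exact ContinuousLinearMap.le_opENorm _ _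
    _ = ∫⁻ y in Q, ∫⁻ x in (Metric.closedBall c (2 * ρ))ᶜ,
          ‖K (x - y) - K (x - c)‖ₑ * ‖b y‖ₑ := lintegral_lintegral_swap hmeas
    _ ≤ ∫⁻ y in Q, A * ‖b y‖ₑ := by
        refine setLIntegral_mono_ae (hb.aestronglyMeasurable.restrict.enorm.const_mul _)
          (Eventually.of_forall fun y hy => ?_)
        have hc1 : Continuous fun x : UnitAddCircle => K (x - y) - K (x - c) := by fun_prop
        rw [lintegral_mul_const _ hc1.enorm.measurable]
        gcongr
        have hyc : ‖y - c‖ ≤ ρ := by simpa [dist_eq_norm] using hQc hy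
        refine le_trans ?_ (hK.hormander ρ (y - c) hρ hyc)
        have hmp : MeasurePreserving (fun x : UnitAddCircle => x - c) volume volume :=
          measurePreserving_sub_right volume c
        have hpre : (fun x : UnitAddCircle => x - c) ⁻¹' {x | 2 * ρ < ‖x‖} =
            (Metric.closedBall c (2 * ρ))ᶜ := by
          ext x; simp [dist_eq_norm]
        have hm : MeasurableSet {x : UnitAddCircle | 2 * ρ < ‖x‖} :=
          (isOpen_lt continuous_const continuous_norm).measurableSet
        have hc2 : Continuous fun x : UnitAddCircle => K (x - (y - c)) - K x := by fun_prop
        rw [← hmp.setLIntegral_comp_preimage hm hc2.enorm.measurable, hpre]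
        refine (lintegral_congr fun x => ?_).le
        rw [sub_sub_sub_cancel_right]
    _ = A * ∫⁻ y in Q, ‖b y‖ₑ :=
        lintegral_const_mul'' _ hb.aestronglyMeasurable.restrict.enorm

/-- The weak type `(1, 1)` constant obtained from the Calderón–Zygmund decomposition. -/
theorem weakType_one_one [CompleteSpace H₁] [CompleteSpace H₂] {A : ℝ≥0}
    (hK : IsHormander K A) (h2 : BoundedOn K 2 A) (hf : Integrable f) {l : ℝ≥0} (hl : 0 < l) :
    l * volume {x | 2 * (l : ℝ≥0∞) < ‖conv K f x‖ₑ} ≤ (4 * A + 4) * ∫⁻ x, ‖f x‖ₑ := by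
  have hl0 : (l : ℝ≥0∞) ≠ 0 := by simpa using hl.ne'
  -- For `l` below the mean of `‖f‖` the claim is trivial, the circle having measure `1`. Otherwise
  -- the decomposition at height `l` is available.
  rcases le_total (∫⁻ y, ‖f y‖ₑ) l with hfl | hfl
  swap
  · calc _ ≤ (l : ℝ≥0∞) * 1 := by gcongr; exact prob_le_one
      _ ≤ ∫⁻ x, ‖f x‖ₑ := by simpa using hfl
      _ ≤ _ := by
        nth_rewrite 1 [← one_mul (∫⁻ x, ‖f x‖ₑ)]
        gcongr
        exact le_add_left (by norm_num)
  set g := goodPart f l with hg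
  set b : UnitAddCircle → H₁ := fun x => f x - g x with hbdef
  have hgi : Integrable g := integrable_goodPart hf l
  have hbi : Integrable b := hf.sub hgi
  have hgn : ∫⁻ x, ‖g x‖ₑ ≤ ∫⁻ x, ‖f x‖ₑ := lintegral_enorm_goodPart_le f l
  have hbn : ∫⁻ x, ‖b x‖ₑ ≤ 2 * ∫⁻ x, ‖f x‖ₑ := by
    calc _ ≤ ∫⁻ x, (‖f x‖ₑ + ‖g x‖ₑ) := lintegral_mono fun x => enorm_sub_le
      _ = (∫⁻ x, ‖f x‖ₑ) + ∫⁻ x, ‖g x‖ₑ := lintegral_add_left' hf.aestronglyMeasurable.enorm _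
      _ ≤ _ := by rw [two_mul]; gcongr
  have hsplit : conv K f = fun x => conv K g x + conv K b x := by
    rw [← conv_add hK.continuous hgi hbi]
    simp [hbdef]
  set c : ℕ × ℤ → UnitAddCircle := fun p => arcCenter p.1 p.2
  set ρ : ℕ × ℤ → ℝ := fun p => (2 : ℝ)⁻¹ ^ (p.1 + 1)
  have hρ : ∀ p, 0 < ρ p := fun p => by positivity
  have hQc : ∀ p, maximalArc f l p ⊆ Metric.closedBall (c p) (ρ p) := fun p x hx =>
    mem_closedBall_arcCenter hx.1
  -- The exceptional set consists of the doubled arcs. Its measure is small because each maximal arc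
  -- `Q` satisfies `l |Q| < ∫_Q ‖f‖`; indices with empty arcs must be left out.
  set W : Set UnitAddCircle := ⋃ p, ⋃ (_ : (maximalArc f l p).Nonempty),
    Metric.closedBall (c p) (2 * ρ p) with hW
  have hWm : MeasurableSet W := MeasurableSet.iUnion fun p => MeasurableSet.iUnion fun _ =>
    measurableSet_closedBall
  have hWv : l * volume W ≤ 2 * ∫⁻ x, ‖f x‖ₑ := by
    have h1 : ∀ p, l * volume (⋃ (_ : (maximalArc f l p).Nonempty),
        Metric.closedBall (c p) (2 * ρ p)) ≤ 2 * ∫⁻ x in maximalArc f l p, ‖f x‖ₑ := by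
      intro p
      rcases (maximalArc f l p).eq_empty_or_nonempty with h | ⟨x, hx⟩
      · simp [h]
      · have hne : (maximalArc f l p).Nonempty := ⟨x, hx⟩
        simp only [hne, Set.iUnion_true]
        have h3 := (lt_lintegral_maximalArc hx).le
        have hv : volume (Metric.closedBall (c p) (2 * ρ p)) ≤ 2 * 2⁻¹ ^ p.1 := by
          rw [AddCircle.volume_closedBall]
          refine (ENNReal.ofReal_le_ofReal (min_le_right _ _)).trans ?_
          have : 2 * (2 * ρ p) = 2 * 2⁻¹ ^ p.1 := by simp only [ρ, pow_succ]; ring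
          rw [this, ENNReal.ofReal_mul (by norm_num), ENNReal.ofReal_pow (by norm_num),
            ENNReal.ofReal_inv_of_pos (by norm_num)]
          simp
        calc _ ≤ (2 ^ p.1 * ∫⁻ y in maximalArc f l p, ‖f y‖ₑ) * (2 * 2⁻¹ ^ p.1) := by gcongr
          _ = (2 ^ p.1 * 2⁻¹ ^ p.1) * (2 * ∫⁻ y in maximalArc f l p, ‖f y‖ₑ) := by ring
          _ = _ := by
            rw [← mul_pow, ENNReal.mul_inv_cancel (by simp) (by simp), one_pow, one_mul]
    calc l * volume W ≤ l * ∑' p, volume (⋃ (_ : (maximalArc f l p).Nonempty),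
        Metric.closedBall (c p) (2 * ρ p)) := by gcongr; exact measure_iUnion_le _
      _ = ∑' p, l * volume (⋃ (_ : (maximalArc f l p).Nonempty),
        Metric.closedBall (c p) (2 * ρ p)) := ENNReal.tsum_mul_left.symm
      _ ≤ ∑' p, 2 * ∫⁻ x in maximalArc f l p, ‖f x‖ₑ := ENNReal.tsum_le_tsum h1
      _ = 2 * ∑' p, ∫⁻ x in maximalArc f l p, ‖f x‖ₑ := ENNReal.tsum_mul_left
      _ ≤ _ := by
        rw [lintegral_eq_tsum_maximalArc f l (fun x => ‖f x‖ₑ)]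
        gcongr
        exact le_self_add
  -- Chebyshev and the `L²` bound, with `‖g‖² ≤ 2 l ‖g‖` almost everywhere; one factor `l` cancels.
  have hgood : l * volume {x | (l : ℝ≥0∞) < ‖conv K g x‖ₑ} ≤ 2 * A * ∫⁻ x, ‖f x‖ₑ := by
    have hch := mul_meas_ge_le_lintegral₀ (μ := volume)
      ((continuous_conv hK.continuous hgi).enorm.aemeasurable.pow_const (2 : ℝ))
      ((l : ℝ≥0∞) ^ (2 : ℝ))
    have hInt : ∫⁻ x, ‖g x‖ₑ ^ (2 : ℝ) ≤ 2 * l * ∫⁻ x, ‖f x‖ₑ := by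
      calc _ ≤ ∫⁻ x, 2 * l * ‖g x‖ₑ := by
            refine lintegral_mono_ae ?_
            filter_upwards [enorm_goodPart_le hf hfl] with x hx
            rw [ENNReal.rpow_two, sq]
            gcongr
        _ = 2 * l * ∫⁻ x, ‖g x‖ₑ := lintegral_const_mul'' _ hgi.aestronglyMeasurable.enorm
        _ ≤ _ := by gcongr
    have h3 : (l : ℝ≥0∞) * (l * volume {x | (l : ℝ≥0∞) < ‖conv K g x‖ₑ}) ≤
        l * (2 * A * ∫⁻ x, ‖f x‖ₑ) := by
      calc _ = (l : ℝ≥0∞) ^ (2 : ℝ) * volume {x | (l : ℝ≥0∞) < ‖conv K g x‖ₑ} := by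
            rw [ENNReal.rpow_two, sq, mul_assoc]
        _ ≤ (l : ℝ≥0∞) ^ (2 : ℝ) *
            volume {x | (l : ℝ≥0∞) ^ (2 : ℝ) ≤ ‖conv K g x‖ₑ ^ (2 : ℝ)} := by
            gcongr with x
            intro hx
            exact ENNReal.rpow_le_rpow (le_of_lt hx) (by norm_num)
        _ ≤ A * ∫⁻ x, ‖g x‖ₑ ^ (2 : ℝ) := hch.trans (h2 g hgi)
        _ ≤ A * (2 * l * ∫⁻ x, ‖f x‖ₑ) := by gcongr
        _ = _ := by ring
    exact (ENNReal.mul_le_mul_iff_right hl0 ENNReal.coe_ne_top).1 h3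
  have hbp : ∀ x, conv K b x = ∑' p, ∫ y in maximalArc f l p, K (x - y) (b y) := by
    intro x
    rw [← integral_iUnion (measurableSet_maximalArc f l) (pairwise_disjoint_maximalArc f l)
      (integrable_conv_kernel hK.continuous hbi x).integrableOn, conv]
    refine (setIntegral_eq_integral_of_forall_compl_eq_zero fun y hy => ?_).symm
    simp [hbdef, hg, goodPart_of_not_mem hy]
  -- Off the doubled arcs each piece of `b` contributes at most `A` times its `L¹` norm, and the
  -- pieces are disjoint.
  have hbad1 : ∫⁻ x in Wᶜ, ‖conv K b x‖ₑ ≤ 2 * A * ∫⁻ x, ‖f x‖ₑ := by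
    calc ∫⁻ x in Wᶜ, ‖conv K b x‖ₑ
        ≤ ∫⁻ x in Wᶜ, ∑' p, ‖∫ y in maximalArc f l p, K (x - y) (b y)‖ₑ := by
          refine lintegral_mono fun x => ?_
          rw [hbp]
          exact enorm_tsum_le_tsum_enorm
      _ = ∑' p, ∫⁻ x in Wᶜ, ‖∫ y in maximalArc f l p, K (x - y) (b y)‖ₑ := by
          refine lintegral_tsum fun p => ?_
          have : (fun x => ∫ y in maximalArc f l p, K (x - y) (b y)) =
              conv K ((maximalArc f l p).indicator b) := by
            funext x
            rw [conv, ← integral_indicator (measurableSet_maximalArc f l p)]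
            congr 1
            funext y
            by_cases hy : y ∈ maximalArc f l p <;> simp [hy]
          exact (continuous_enorm.comp (this ▸ continuous_conv hK.continuous
            (hbi.indicator (measurableSet_maximalArc f l p)))).aemeasurable
      _ ≤ ∑' p, A * ∫⁻ y in maximalArc f l p, ‖b y‖ₑ := by
          refine ENNReal.tsum_le_tsum fun p => ?_
          rcases (maximalArc f l p).eq_empty_or_nonempty with h | hne
          · simp [h]
          · refine (lintegral_mono_set (Set.compl_subset_compl.2 ?_)).trans
              (lintegral_conv_off_ball_le hK (hρ p) (hQc p) hbi
              (setIntegral_sub_goodPart hf l p))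
            exact Set.subset_iUnion₂_of_subset p hne le_rfl
      _ = A * ∑' p, ∫⁻ y in maximalArc f l p, ‖b y‖ₑ := ENNReal.tsum_mul_left
      _ ≤ A * ∫⁻ y, ‖b y‖ₑ := by
          gcongr
          rw [lintegral_eq_tsum_maximalArc f l (fun x => ‖b x‖ₑ)]
          exact le_self_add
      _ ≤ A * (2 * ∫⁻ x, ‖f x‖ₑ) := by gcongr
      _ = _ := by ring
  have hbad : l * volume (Wᶜ ∩ {x | (l : ℝ≥0∞) < ‖conv K b x‖ₑ}) ≤ 2 * A * ∫⁻ x, ‖f x‖ₑ := by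
    have hch := mul_meas_ge_le_lintegral₀ (μ := volume.restrict Wᶜ)
      ((continuous_conv hK.continuous hbi).enorm.aemeasurable) (l : ℝ≥0∞)
    refine le_trans ?_ (hch.trans hbad1)
    rw [Measure.restrict_apply' hWm.compl, Set.inter_comm]
    gcongr with x
    exact fun h => le_of_lt h
  have hsub : {x | 2 * (l : ℝ≥0∞) < ‖conv K f x‖ₑ} ⊆
      {x | (l : ℝ≥0∞) < ‖conv K g x‖ₑ} ∪ W ∪ (Wᶜ ∩ {x | (l : ℝ≥0∞) < ‖conv K b x‖ₑ}) := by
    intro x hx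
    by_contra hcon
    simp only [Set.mem_union, Set.mem_inter_iff, Set.mem_compl_iff, Set.mem_ofPred_eq, not_or,
      not_and, not_lt] at hcon
    obtain ⟨⟨h3, h4⟩, h5⟩ := hcon
    refine absurd (show 2 * (l : ℝ≥0∞) < ‖conv K f x‖ₑ from hx) (not_lt.2 ?_)
    rw [hsplit, two_mul]
    exact (enorm_add_le _ _).trans (add_le_add h3 (h5 h4))
  calc _ ≤ l * (volume {x | (l : ℝ≥0∞) < ‖conv K g x‖ₑ} + volume W +
        volume (Wᶜ ∩ {x | (l : ℝ≥0∞) < ‖conv K b x‖ₑ})) := by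
        gcongr
        exact (measure_mono hsub).trans ((measure_union_le _ _).trans
          (by gcongr; exact measure_union_le _ _))
    _ ≤ 2 * A * (∫⁻ x, ‖f x‖ₑ) + 2 * (∫⁻ x, ‖f x‖ₑ) + 2 * A * ∫⁻ x, ‖f x‖ₑ := by
        rw [mul_add, mul_add]; gcongr
    _ = (4 * A + 2) * ∫⁻ x, ‖f x‖ₑ := by ring
    _ ≤ _ := by gcongr; norm_num

end Convolution

/-! ### Growth of `Φ` along dyadic levels. -/

/-- Growth conditions from `u₀` on: doubling with constant `K₁`, and growth by a factor at least
`K₂ > 2` under doubling of the argument. -/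
structure Growth (Φ : ℝ≥0 → ℝ≥0∞) (u₀ K₁ K₂ : ℝ≥0) : Prop where
  mono : Monotone Φ
  star : ∀ u v, u ≤ v → Φ u * v ≤ Φ v * u
  pos : 0 < u₀
  delta : ∀ u, u₀ ≤ u → Φ (2 * u) ≤ K₁ * Φ u
  two_lt : 2 < K₂
  nabla : ∀ u, u₀ ≤ u → K₂ * Φ u ≤ Φ (2 * u)

/-- The dyadic levels above `u₀`. -/
noncomputable def level (u₀ : ℝ≥0) (k : ℕ) : ℝ≥0 := 2 ^ k * u₀

lemma level_zero (u₀ : ℝ≥0) : level u₀ 0 = u₀ := by simp [level]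

lemma level_succ (u₀ : ℝ≥0) (k : ℕ) : level u₀ (k + 1) = 2 * level u₀ k := by
  simp [level, pow_succ']; ring

lemma level_pos {u₀ : ℝ≥0} (h : 0 < u₀) (k : ℕ) : 0 < level u₀ k := by
  unfold level; positivity

lemma level_mono (u₀ : ℝ≥0) : Monotone (level u₀) := fun i j h => by
  unfold level; gcongr; norm_num

lemma le_level (u₀ : ℝ≥0) (k : ℕ) : u₀ ≤ level u₀ k := by
  simpa [level_zero] using level_mono u₀ (Nat.zero_le k)

lemma exists_le_level {u₀ : ℝ≥0} (h : 0 < u₀) (v : ℝ≥0) : ∃ k, v ≤ level u₀ k := by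
  obtain ⟨n, hn⟩ := pow_unbounded_of_one_lt (v / u₀) (one_lt_two (α := ℝ≥0))
  exact ⟨n, by unfold level; exact ((div_lt_iff₀ h).1 hn).le⟩

/-- A discrete layer-cake bound: if `v > u₀` lies between consecutive levels `n` and `n + 1`, the
single term of index `n` already dominates `Φ v`. -/
lemma le_tsum_level {Φ : ℝ≥0 → ℝ≥0∞} (hΦ : Monotone Φ) {u₀ : ℝ≥0} (h0 : 0 < u₀) (v : ℝ≥0) :
    Φ v ≤ Φ u₀ + ∑' k, (if level u₀ k < v then Φ (level u₀ (k + 1)) else 0) := by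
  classical
  have hex := exists_le_level h0 v
  rcases h : Nat.find hex with _ | n
  · have := Nat.find_spec hex
    rw [h, level_zero] at this
    exact (hΦ this).trans le_self_add
  · have h1 := Nat.find_spec hex
    rw [h] at h1
    have h2 : level u₀ n < v := not_le.1 (Nat.find_min hex (by omega))
    refine ((hΦ h1).trans ?_).trans le_add_self
    refine le_trans ?_ (ENNReal.le_tsum n)
    rw [if_pos h2]

namespace Growth

variable {Φ : ℝ≥0 → ℝ≥0∞} {u₀ K₁ K₂ : ℝ≥0}

lemma level_succ_le (h : Growth Φ u₀ K₁ K₂) (k : ℕ) :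
    Φ (level u₀ (k + 1)) ≤ K₁ * Φ (level u₀ k) := by
  rw [level_succ]; exact h.delta _ (le_level _ _)

/-- By `∇₂` the quotient `Φ u / u` grows at least by the factor `K₂ / 2 > 1` per level, so the sum
is controlled by its last term. The constant `C = K₂ / (K₂ - 2)` solves `C · 2 / K₂ + 1 = C`, which
closes the induction. -/
lemma sum_div_level_le (h : Growth Φ u₀ K₁ K₂) (n : ℕ) :
    ∑ k ∈ Finset.range (n + 1), Φ (level u₀ k) / level u₀ k ≤
      ((K₂ / (K₂ - 2) : ℝ≥0) : ℝ≥0∞) * (Φ (level u₀ n) / level u₀ n) := by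
  have hK : 0 < K₂ - 2 := tsub_pos_of_lt h.two_lt
  have hK0 : 0 < K₂ := lt_trans two_pos h.two_lt
  have hC : (2 : ℝ≥0) / (K₂ - 2) + 1 = K₂ / (K₂ - 2) := by
    have : (2 : ℝ≥0) + (K₂ - 2) = K₂ := add_tsub_cancel_of_le h.two_lt.le
    rw [div_add_one hK.ne', this]
  induction n with
  | zero =>
    rw [Finset.sum_range_one]
    nth_rewrite 1 [← one_mul (Φ (level u₀ 0) / _)]
    gcongr
    rw [← hC]
    exact_mod_cast le_add_self
  | succ n ih =>
    have hs : (level u₀ n : ℝ≥0∞) ≠ 0 := by simpa using (level_pos h.pos n).ne'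
    have hstep : K₂ * (Φ (level u₀ n) / level u₀ n) ≤
        2 * (Φ (level u₀ (n + 1)) / level u₀ (n + 1)) := by
      have h1 := h.nabla _ (le_level u₀ n)
      rw [level_succ, ENNReal.coe_mul, ← mul_div_assoc, ← mul_div_assoc, ENNReal.coe_ofNat,
        ENNReal.mul_div_mul_left _ _ (by simp) (by simp)]
      gcongr
    rw [Finset.sum_range_succ]
    calc _ ≤ ((K₂ / (K₂ - 2) : ℝ≥0) : ℝ≥0∞) * (Φ (level u₀ n) / level u₀ n) +
          Φ (level u₀ (n + 1)) / level u₀ (n + 1) := by gcongr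
      _ = ((1 / (K₂ - 2) : ℝ≥0) : ℝ≥0∞) * (K₂ * (Φ (level u₀ n) / level u₀ n)) +
          Φ (level u₀ (n + 1)) / level u₀ (n + 1) := by
          rw [← mul_assoc, ← ENNReal.coe_mul]
          congr 3
          ring
      _ ≤ ((1 / (K₂ - 2) : ℝ≥0) : ℝ≥0∞) * (2 * (Φ (level u₀ (n + 1)) / level u₀ (n + 1))) +
          Φ (level u₀ (n + 1)) / level u₀ (n + 1) := by gcongr
      _ = ((2 / (K₂ - 2) + 1 : ℝ≥0) : ℝ≥0∞) * (Φ (level u₀ (n + 1)) / level u₀ (n + 1)) := by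
          rw [← mul_assoc, ENNReal.coe_add, add_mul, ENNReal.coe_one, one_mul]
          congr 2
          rw [← ENNReal.coe_ofNat, ← ENNReal.coe_mul]
          congr 1
          ring
      _ = _ := by rw [hC]

/-- The geometric sum is dominated by its last level below `v`, and there `Φ u / u ≤ Φ v / v`; this
monotonicity is the field `star`. -/
lemma sum_below_le (h : Growth Φ u₀ K₁ K₂) (v : ℝ≥0) (n : ℕ) :
    ∑ k ∈ Finset.range n, (if level u₀ k < v then Φ (level u₀ k) / level u₀ k * v else 0) ≤
      ((K₂ / (K₂ - 2) : ℝ≥0) : ℝ≥0∞) * Φ v := by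
  induction n with
  | zero => simp
  | succ n ih =>
    by_cases hn : level u₀ n < v
    · have hs : (level u₀ n : ℝ≥0∞) ≠ 0 := by simpa using (level_pos h.pos n).ne'
      calc _ ≤ ∑ k ∈ Finset.range (n + 1), Φ (level u₀ k) / level u₀ k * v := by
            refine Finset.sum_le_sum fun k _ => ?_
            split_ifs <;> simp
        _ = (∑ k ∈ Finset.range (n + 1), Φ (level u₀ k) / level u₀ k) * v := by
            rw [Finset.sum_mul]
        _ ≤ ((K₂ / (K₂ - 2) : ℝ≥0) : ℝ≥0∞) * (Φ (level u₀ n) / level u₀ n) * v := by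
            gcongr; exact h.sum_div_level_le n
        _ ≤ _ := by
            rw [mul_assoc]
            gcongr
            rw [ENNReal.div_eq_inv_mul, mul_assoc, ← ENNReal.div_eq_inv_mul]
            exact ENNReal.div_le_of_le_mul (h.star _ _ hn.le)
    · rw [Finset.sum_range_succ, if_neg hn, add_zero]
      exact ih

lemma tsum_below_le (h : Growth Φ u₀ K₁ K₂) (v : ℝ≥0) :
    ∑' k, Φ (level u₀ (k + 1)) * ((level u₀ k : ℝ≥0∞)⁻¹ * (if level u₀ k < v then (v : ℝ≥0∞) else 0))
      ≤ ((K₁ * (K₂ / (K₂ - 2)) : ℝ≥0) : ℝ≥0∞) * Φ v := by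
  calc _ ≤ ∑' k, K₁ * (if level u₀ k < v then Φ (level u₀ k) / level u₀ k * v else 0) := by
        refine ENNReal.tsum_le_tsum fun k => ?_
        split_ifs
        · rw [div_eq_mul_inv, mul_assoc (Φ _), ← mul_assoc _ (Φ _)]
          gcongr
          exact h.level_succ_le k
        · simp
    _ = K₁ * ∑' k, (if level u₀ k < v then Φ (level u₀ k) / level u₀ k * v else 0) :=
        ENNReal.tsum_mul_left
    _ ≤ K₁ * (((K₂ / (K₂ - 2) : ℝ≥0) : ℝ≥0∞) * Φ v) := by
        gcongr
        exact ENNReal.tsum_le_of_sum_range_le fun n => h.sum_below_le v n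
    _ = _ := by rw [ENNReal.coe_mul, mul_assoc]

lemma level_add_le (h : Growth Φ u₀ K₁ K₂) (n j : ℕ) :
    Φ (level u₀ (n + j)) ≤ K₁ ^ j * Φ (level u₀ n) := by
  induction j with
  | zero => simp
  | succ j ih =>
    rw [← add_assoc, pow_succ', mul_assoc]
    exact (h.level_succ_le _).trans (by gcongr)

lemma level_add_rpow (u₀ : ℝ≥0) {r : ℝ} (hr : 0 < r) (j n : ℕ) :
    (level u₀ (j + n) : ℝ≥0∞) ^ r = (2 ^ r) ^ j * (level u₀ n : ℝ≥0∞) ^ r := by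
  have : (level u₀ (j + n) : ℝ≥0∞) = 2 ^ j * level u₀ n := by
    simp [level, pow_add, mul_assoc]
  rw [this, ENNReal.mul_rpow_of_nonneg _ _ hr.le, ← ENNReal.rpow_natCast, ← ENNReal.rpow_natCast,
    ← ENNReal.rpow_mul, ← ENNReal.rpow_mul, mul_comm r]

/-- Each further level costs a factor `K₁` by `Δ₂` and gains `2^r` from the power weight. -/
lemma term_above_le (h : Growth Φ u₀ K₁ K₂) {r : ℝ} (hr : 0 < r) {v : ℝ≥0} {n : ℕ}
    (hvn : v ≤ level u₀ n) (j : ℕ) :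
    Φ (level u₀ (j + n + 1)) * (((level u₀ (j + n) : ℝ≥0∞) ^ r)⁻¹ * (v : ℝ≥0∞) ^ r) ≤
      K₁ * Φ (level u₀ n) * (K₁ / 2 ^ r) ^ j := by
  have hs0 : (level u₀ n : ℝ≥0∞) ^ r ≠ 0 := by
    have := (level_pos h.pos n).ne'
    simp [ENNReal.rpow_eq_zero_iff, this]
  have hst : (level u₀ n : ℝ≥0∞) ^ r ≠ ⊤ := ENNReal.rpow_ne_top_of_nonneg hr.le ENNReal.coe_ne_top
  calc _ ≤ (K₁ * (K₁ ^ j * Φ (level u₀ n))) * (((level u₀ (j + n) : ℝ≥0∞) ^ r)⁻¹ *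
        (level u₀ n : ℝ≥0∞) ^ r) := by
        gcongr
        refine (h.level_succ_le _).trans ?_
        gcongr
        rw [add_comm j]
        exact h.level_add_le n j
    _ = K₁ * Φ (level u₀ n) * (K₁ / 2 ^ r) ^ j := by
        rw [level_add_rpow u₀ hr, ENNReal.mul_inv (Or.inr hst) (Or.inr hs0),
          mul_assoc (((2 : ℝ≥0∞) ^ r) ^ j)⁻¹,
          ENNReal.inv_mul_cancel hs0 hst, mul_one, div_eq_mul_inv, mul_pow, ENNReal.inv_pow]
        ring

/-- The sum starts at the first level `n` not below `v` and is geometric from there. If `n > 0`, the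
preceding level is below `v`, so `Φ` at level `n` is at most `K₁ Φ v`; if `n = 0`, it is `Φ u₀`. The
bound is informative when `K₁ < 2^r`. -/
lemma tsum_above_le (h : Growth Φ u₀ K₁ K₂) {r : ℝ} (hr : 0 < r) (v : ℝ≥0) :
    ∑' k, Φ (level u₀ (k + 1)) *
      (((level u₀ k : ℝ≥0∞) ^ r)⁻¹ * (if v ≤ level u₀ k then (v : ℝ≥0∞) ^ r else 0))
      ≤ K₁ * (1 - (K₁ : ℝ≥0∞) / 2 ^ r)⁻¹ * (K₁ * Φ v + Φ u₀) := by
  obtain ⟨n, hvn, hlow⟩ : ∃ n, v ≤ level u₀ n ∧ ∀ k < n, ¬ v ≤ level u₀ k := by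
    classical
    exact ⟨_, Nat.find_spec (exists_le_level h.pos v), fun _ => Nat.find_min _⟩
  have hn1 : Φ (level u₀ n) ≤ K₁ * Φ v + Φ u₀ := by
    cases n with
    | zero => rw [level_zero]; exact le_add_self
    | succ m =>
      refine ((h.level_succ_le m).trans ?_).trans le_self_add
      gcongr
      exact h.mono (not_le.1 (hlow m (by omega))).le
  have hshift : ∀ F : ℕ → ℝ≥0∞, (∀ k < n, F k = 0) → ∑' k, F k = ∑' j, F (j + n) := by
    intro F hF
    rw [← (ENNReal.summable (f := fun j => F (j + n))).sum_add_tsum_nat_add',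
      Finset.sum_eq_zero fun k hk => hF k (Finset.mem_range.1 hk), zero_add]
  rw [hshift _ fun k hk => by rw [if_neg (hlow k hk), mul_zero, mul_zero]]
  calc _ ≤ ∑' j, K₁ * Φ (level u₀ n) * (K₁ / 2 ^ r) ^ j := by
        refine ENNReal.tsum_le_tsum fun j => ?_
        rw [if_pos (hvn.trans (level_mono u₀ (Nat.le_add_left n j)))]
        exact h.term_above_le hr hvn j
    _ = K₁ * Φ (level u₀ n) * (1 - (K₁ : ℝ≥0∞) / 2 ^ r)⁻¹ := by
        rw [ENNReal.tsum_mul_left, ENNReal.tsum_geometric]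
    _ ≤ K₁ * (K₁ * Φ v + Φ u₀) * (1 - (K₁ : ℝ≥0∞) / 2 ^ r)⁻¹ := by gcongr
    _ = _ := by ring

end Growth

/-! ### Marcinkiewicz interpolation for modulars. -/

/-- The weak type `(1, 1)` inequality with constant `A`. -/
def WeakOneOne {H₁ H₂ : Type*} [NormedAddCommGroup H₁] [InnerProductSpace ℂ H₁]
    [NormedAddCommGroup H₂] [InnerProductSpace ℂ H₂] (K : UnitAddCircle → H₁ →L[ℂ] H₂)
    (A : ℝ≥0) : Prop :=
  ∀ f : UnitAddCircle → H₁, Integrable f → ∀ l : ℝ≥0, 0 < l →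
    l * volume {x | 2 * (l : ℝ≥0∞) < ‖conv K f x‖ₑ} ≤ A * ∫⁻ x, ‖f x‖ₑ

section Marcinkiewicz

variable {H₁ H₂ : Type*} [NormedAddCommGroup H₁] [InnerProductSpace ℂ H₁]
  [NormedAddCommGroup H₂] [InnerProductSpace ℂ H₂]
  {K : UnitAddCircle → H₁ →L[ℂ] H₂} {f : UnitAddCircle → H₁}

/-- Split `f` at the height `s` itself. The large part is treated by the weak type inequality and
the small part by Chebyshev in `L^r`, each with threshold `s / 2`; since `WeakOneOne` measures `{2 l
< ‖·‖}`, it is used with `l = s / 4`. -/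
lemma volume_superlevel_le {A B : ℝ≥0} {r : ℝ} (hr : 0 < r) (hK : Continuous K)
    (hw : WeakOneOne K A) (hb : BoundedOn K r B) (hf : Integrable f) (hfm : StronglyMeasurable f)
    {s : ℝ≥0} (hs : 0 < s) :
    volume {x | s < ‖conv K f x‖₊} ≤
      4 * A * ((s : ℝ≥0∞)⁻¹ * ∫⁻ x, (if s < ‖f x‖₊ then (‖f x‖₊ : ℝ≥0∞) else 0)) +
      2 ^ r * B * (((s : ℝ≥0∞) ^ r)⁻¹ * ∫⁻ x, (if ‖f x‖₊ ≤ s then (‖f x‖₊ : ℝ≥0∞) ^ r else 0)) := by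
  classical
  have hs0 : (s : ℝ≥0∞) ≠ 0 := by simpa using hs.ne'
  have hm : MeasurableSet {x | s < ‖f x‖₊} :=
    measurableSet_lt measurable_const hfm.nnnorm.measurable
  set g := {x | s < ‖f x‖₊}.indicator f with hg
  set b := {x | s < ‖f x‖₊}ᶜ.indicator f with hbd
  have hgi : Integrable g := hf.indicator hm
  have hbi : Integrable b := hf.indicator hm.compl
  have hsum : conv K f = fun x => conv K g x + conv K b x := by
    rw [← conv_add hK hgi hbi]
    congr 1
    funext x
    exact (congrFun (Set.indicator_self_add_compl _ f) x).symm
  have hg1 : ∫⁻ x, ‖g x‖ₑ = ∫⁻ x, (if s < ‖f x‖₊ then (‖f x‖₊ : ℝ≥0∞) else 0) := by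
    refine lintegral_congr fun x => ?_
    by_cases hx : s < ‖f x‖₊ <;> simp [hg, hx, enorm_eq_nnnorm]
  have hb1 : ∫⁻ x, ‖b x‖ₑ ^ r = ∫⁻ x, (if ‖f x‖₊ ≤ s then (‖f x‖₊ : ℝ≥0∞) ^ r else 0) := by
    refine lintegral_congr fun x => ?_
    by_cases hx : s < ‖f x‖₊
    · simp [hbd, hx, hx.not_ge, hr]
    · simp [hbd, hx, not_lt.1 hx, enorm_eq_nnnorm]
  have h1 : volume {x | 2 * ((s / 4 : ℝ≥0) : ℝ≥0∞) < ‖conv K g x‖ₑ} ≤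
      4 * A * ((s : ℝ≥0∞)⁻¹ * ∫⁻ x, ‖g x‖ₑ) := by
    have h := hw g hgi (s / 4) (by positivity)
    calc _ = (4 * (s : ℝ≥0∞)⁻¹) * (((s / 4 : ℝ≥0) : ℝ≥0∞) *
          volume {x | 2 * ((s / 4 : ℝ≥0) : ℝ≥0∞) < ‖conv K g x‖ₑ}) := by
          rw [← mul_assoc]
          have : (4 * (s : ℝ≥0∞)⁻¹) * ((s / 4 : ℝ≥0) : ℝ≥0∞) = 1 := by
            rw [← ENNReal.coe_inv hs.ne', ← ENNReal.coe_ofNat, ← ENNReal.coe_mul,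
              ← ENNReal.coe_mul, ← ENNReal.coe_one]
            congr 1
            field_simp
          rw [this, one_mul]
      _ ≤ (4 * (s : ℝ≥0∞)⁻¹) * (A * ∫⁻ x, ‖g x‖ₑ) := by gcongr
      _ = _ := by ring
  have h2 : volume {x | (s / 2 : ℝ≥0∞) < ‖conv K b x‖ₑ} ≤
      2 ^ r * B * (((s : ℝ≥0∞) ^ r)⁻¹ * ∫⁻ x, ‖b x‖ₑ ^ r) := by
    have hch := meas_ge_le_lintegral_div (μ := volume)
      ((continuous_conv hK hbi).enorm.aemeasurable.pow_const r)
      (ε := (s / 2 : ℝ≥0∞) ^ r)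
      (by simp [ENNReal.rpow_eq_zero_iff, hs.ne', ENNReal.div_eq_top])
      (ENNReal.rpow_ne_top_of_nonneg hr.le (ENNReal.div_ne_top ENNReal.coe_ne_top (by simp)))
    calc _ ≤ volume {x | (s / 2 : ℝ≥0∞) ^ r ≤ ‖conv K b x‖ₑ ^ r} := by
          gcongr with x
          intro hx
          exact ENNReal.rpow_le_rpow (le_of_lt hx) hr.le
      _ ≤ (∫⁻ x, ‖conv K b x‖ₑ ^ r) / (s / 2 : ℝ≥0∞) ^ r := hch
      _ ≤ (B * ∫⁻ x, ‖b x‖ₑ ^ r) / (s / 2 : ℝ≥0∞) ^ r := by gcongr; exact hb b hbi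
      _ = _ := by
          rw [ENNReal.div_rpow_of_nonneg _ _ hr.le, div_eq_mul_inv, ENNReal.inv_div
            (Or.inr (ENNReal.rpow_ne_top_of_nonneg hr.le ENNReal.coe_ne_top))
            (Or.inr (by simp [ENNReal.rpow_eq_zero_iff, hs.ne'])), div_eq_mul_inv]
          ring
  rw [← hg1, ← hb1]
  refine le_trans (measure_mono ?_) ((measure_union_le _ _).trans (add_le_add h1 h2))
  intro x hx
  by_contra hcon
  simp only [Set.mem_union, Set.mem_ofPred_eq, not_or, not_lt] at hcon
  have hx' : (s : ℝ≥0∞) < ‖conv K f x‖ₑ := by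
    rw [enorm_eq_nnnorm]; exact_mod_cast hx
  refine absurd hx' (not_lt.2 ?_)
  rw [hsum]
  calc _ ≤ ‖conv K g x‖ₑ + ‖conv K b x‖ₑ := enorm_add_le _ _
    _ ≤ 2 * ((s / 4 : ℝ≥0) : ℝ≥0∞) + s / 2 := add_le_add hcon.1 hcon.2
    _ = s := by
      have : 2 * ((s / 4 : ℝ≥0) : ℝ≥0∞) = s / 2 := by
        rw [← ENNReal.coe_ofNat, ← ENNReal.coe_mul, ← ENNReal.coe_div two_ne_zero]
        congr 1
        rw [← mul_div_assoc, mul_comm, show (4 : ℝ≥0) = 2 * 2 by norm_num,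
          mul_div_mul_right _ _ two_ne_zero]
      rw [this, ENNReal.add_halves]

/-- Marcinkiewicz interpolation between weak type `(1, 1)` and an `L^r` bound, for modulars. -/
theorem lintegral_conv_le {Φ : ℝ≥0 → ℝ≥0∞} {u₀ K₁ K₂ A B : ℝ≥0} (h : Growth Φ u₀ K₁ K₂)
    {r : ℝ} (hr : 0 < r) (hK : Continuous K)
    (hw : WeakOneOne K A) (hb : BoundedOn K r B) (hf : Integrable f) :
    ∫⁻ x, Φ ‖conv K f x‖₊ ≤ Φ u₀ +
      (4 * A * (((K₁ * (K₂ / (K₂ - 2)) : ℝ≥0) : ℝ≥0∞) * ∫⁻ x, Φ ‖f x‖₊) +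
      2 ^ r * B * (K₁ * (1 - (K₁ : ℝ≥0∞) / 2 ^ r)⁻¹ * (K₁ * (∫⁻ x, Φ ‖f x‖₊) + Φ u₀))) := by
  -- A measurable representative makes the truncation sets `{s < ‖f‖}` measurable, and changes
  -- neither the convolution nor the modular.
  wlog hfm : StronglyMeasurable f generalizing f
  · have hfg := hf.aestronglyMeasurable.ae_eq_mk
    have h1 := this (hf.congr hfg) hf.aestronglyMeasurable.stronglyMeasurable_mk
    have h2 : conv K (hf.aestronglyMeasurable.mk f) = conv K f := by
      funext x
      refine integral_congr_ae ?_
      filter_upwards [hfg] with y hy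
      rw [hy]
    have h3 : ∫⁻ x, Φ ‖hf.aestronglyMeasurable.mk f x‖₊ = ∫⁻ x, Φ ‖f x‖₊ := by
      refine lintegral_congr_ae ?_
      filter_upwards [hfg] with y hy
      rw [hy]
    rwa [h2, h3] at h1
  have hcm : Measurable fun x => ‖conv K f x‖₊ := (continuous_conv hK hf).nnnorm.measurable
  have hfn : Measurable fun x => ‖f x‖₊ := hfm.nnnorm.measurable
  have hΦm : Measurable Φ := h.mono.measurable
  have hm1 : ∀ k, Measurable fun x => (if level u₀ k < ‖f x‖₊ then (‖f x‖₊ : ℝ≥0∞) else 0) :=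
    fun k => Measurable.ite (measurableSet_lt measurable_const hfn) hfn.coe_nnreal_ennreal
      measurable_const
  have hm2 : ∀ k, Measurable fun x => (if ‖f x‖₊ ≤ level u₀ k then (‖f x‖₊ : ℝ≥0∞) ^ r else 0) :=
    fun k => Measurable.ite (measurableSet_le hfn measurable_const)
      (hfn.coe_nnreal_ennreal.pow_const r) measurable_const
  calc ∫⁻ x, Φ ‖conv K f x‖₊
      ≤ ∫⁻ x, (Φ u₀ + ∑' k, (if level u₀ k < ‖conv K f x‖₊ then Φ (level u₀ (k + 1)) else 0)) :=
        lintegral_mono fun x => le_tsum_level h.mono h.pos _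
    _ = Φ u₀ + ∑' k, Φ (level u₀ (k + 1)) * volume {x | level u₀ k < ‖conv K f x‖₊} := by
        have hs : ∀ k, MeasurableSet {x | level u₀ k < ‖conv K f x‖₊} := fun k =>
          measurableSet_lt measurable_const hcm
        rw [lintegral_add_left measurable_const, lintegral_const, measure_univ, mul_one,
          lintegral_tsum fun k => (Measurable.ite (hs k) measurable_const
            measurable_const).aemeasurable]
        congr 1
        refine tsum_congr fun k => ?_
        rw [← lintegral_indicator_const (hs k)]
        rfl
    _ ≤ Φ u₀ + ∑' k, Φ (level u₀ (k + 1)) *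
        (4 * A * (((level u₀ k : ℝ≥0) : ℝ≥0∞)⁻¹ *
          ∫⁻ x, (if level u₀ k < ‖f x‖₊ then (‖f x‖₊ : ℝ≥0∞) else 0)) +
        2 ^ r * B * (((level u₀ k : ℝ≥0∞) ^ r)⁻¹ *
          ∫⁻ x, (if ‖f x‖₊ ≤ level u₀ k then (‖f x‖₊ : ℝ≥0∞) ^ r else 0))) := by
        gcongr with k
        exact volume_superlevel_le hr hK hw hb hf hfm (level_pos h.pos k)
    -- With the sum over levels moved inside the integral, the two sums can be estimated pointwise
    -- with `v = ‖f x‖₊`.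
    _ = Φ u₀ + (4 * A * (∫⁻ x, ∑' k, Φ (level u₀ (k + 1)) * ((level u₀ k : ℝ≥0∞)⁻¹ *
          (if level u₀ k < ‖f x‖₊ then (‖f x‖₊ : ℝ≥0∞) else 0))) +
        2 ^ r * B * (∫⁻ x, ∑' k, Φ (level u₀ (k + 1)) * (((level u₀ k : ℝ≥0∞) ^ r)⁻¹ *
          (if ‖f x‖₊ ≤ level u₀ k then (‖f x‖₊ : ℝ≥0∞) ^ r else 0)))) := by
        rw [lintegral_tsum fun k => (((hm1 k).const_mul _).const_mul _).aemeasurable,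
          lintegral_tsum fun k => (((hm2 k).const_mul _).const_mul _).aemeasurable,
          ← ENNReal.tsum_mul_left, ← ENNReal.tsum_mul_left, ← ENNReal.tsum_add]
        congr 2
        funext k
        rw [lintegral_const_mul _ ((hm1 k).const_mul _), lintegral_const_mul _ (hm1 k),
          lintegral_const_mul _ ((hm2 k).const_mul _), lintegral_const_mul _ (hm2 k)]
        ring
    _ ≤ Φ u₀ + (4 * A * (∫⁻ x, ((K₁ * (K₂ / (K₂ - 2)) : ℝ≥0) : ℝ≥0∞) * Φ ‖f x‖₊) +
        2 ^ r * B * (∫⁻ x, K₁ * (1 - (K₁ : ℝ≥0∞) / 2 ^ r)⁻¹ * (K₁ * Φ ‖f x‖₊ + Φ u₀))) := by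
        gcongr with x x
        · exact h.tsum_below_le _
        · exact h.tsum_above_le hr _
    _ = _ := by
        have hΦf : Measurable fun x => Φ ‖f x‖₊ := hΦm.comp hfn
        rw [lintegral_const_mul _ hΦf, lintegral_const_mul _ ((hΦf.const_mul _).add_const _),
          lintegral_add_right _ measurable_const, lintegral_const_mul _ hΦf, lintegral_const,
          measure_univ, mul_one]

end Marcinkiewicz

open scoped InnerProductSpace

/-! ### Adjoint kernels and duality of `L^p` bounds. -/

section Duality

variable {H₁ H₂ : Type*} [NormedAddCommGroup H₁] [InnerProductSpace ℂ H₁] [CompleteSpace H₁]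
  [NormedAddCommGroup H₂] [InnerProductSpace ℂ H₂] [CompleteSpace H₂]
  {K : UnitAddCircle → H₁ →L[ℂ] H₂} {f : UnitAddCircle → H₁} {g : UnitAddCircle → H₂}

/-- The kernel of the adjoint convolution operator. -/
noncomputable def adjKernel (K : UnitAddCircle → H₁ →L[ℂ] H₂) (x : UnitAddCircle) : H₂ →L[ℂ] H₁ :=
  ContinuousLinearMap.adjoint (K (-x))

lemma adjKernel_adjKernel (K : UnitAddCircle → H₁ →L[ℂ] H₂) : adjKernel (adjKernel K) = K := by
  funext x
  simp [adjKernel]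

lemma continuous_adjKernel (hK : Continuous K) : Continuous (adjKernel K) :=
  (ContinuousLinearMap.adjoint (𝕜 := ℂ) (E := H₁) (F := H₂)).continuous.comp
    (hK.comp continuous_neg)

/-- Taking adjoints is isometric, and the reflection `x ↦ -x` preserves the measure and the exterior
of balls about `0`. -/
lemma IsHormander.adjKernel {A : ℝ≥0} (hK : IsHormander K A) : IsHormander (adjKernel K) A := by
  refine ⟨continuous_adjKernel hK.continuous, fun ρ y hρ hy => ?_⟩
  refine le_trans ?_ (hK.hormander ρ (-y) hρ (by rwa [norm_neg]))
  have hmp : MeasurePreserving (fun x : UnitAddCircle => -x) volume volume :=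
    Measure.measurePreserving_neg volume
  have hm : MeasurableSet {x : UnitAddCircle | 2 * ρ < ‖x‖} :=
    (isOpen_lt continuous_const continuous_norm).measurableSet
  have hcont := hK.continuous
  have hc : Continuous fun x : UnitAddCircle => K (x - -y) - K x := by fun_prop
  have hpre : (fun x : UnitAddCircle => -x) ⁻¹' {x | 2 * ρ < ‖x‖} = {x | 2 * ρ < ‖x‖} := by
    ext x; simp
  rw [← hmp.setLIntegral_comp_preimage hm hc.enorm.measurable, hpre]
  refine (lintegral_congr fun x => ?_).le
  rw [OrliczLP.adjKernel, OrliczLP.adjKernel, ← map_sub, neg_sub, sub_neg_eq_add, neg_add_eq_sub]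
  simp only [← ofReal_norm, LinearIsometryEquiv.norm_map]

lemma integral_inner_conv (hK : Continuous K) (hf : Integrable f) (hg : Integrable g) :
    ∫ x, ⟪g x, conv K f x⟫_ℂ = ∫ y, ⟪conv (adjKernel K) g y, f y⟫_ℂ := by
  obtain ⟨C, hC⟩ := exists_norm_le_of_continuous hK
  have hInt : Integrable (fun p : UnitAddCircle × UnitAddCircle =>
      ⟪g p.1, K (p.1 - p.2) (f p.2)⟫_ℂ) (volume.prod volume) := by
    have hgf : Integrable (fun p : UnitAddCircle × UnitAddCircle => ‖g p.1‖ * ‖f p.2‖)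
        (volume.prod volume) := hg.norm.mul_prod hf.norm
    have hKc : Continuous fun p : UnitAddCircle × UnitAddCircle => K (p.1 - p.2) := by fun_prop
    refine (hgf.const_mul C).mono' ?_ (Eventually.of_forall fun p => ?_)
    · refine AEStronglyMeasurable.inner (𝕜 := ℂ) hg.aestronglyMeasurable.comp_fst ?_
      exact (ContinuousLinearMap.id ℂ (H₁ →L[ℂ] H₂)).aestronglyMeasurable_comp₂
        hKc.aestronglyMeasurable hf.aestronglyMeasurable.comp_snd
    · calc _ ≤ ‖g p.1‖ * ‖K (p.1 - p.2) (f p.2)‖ := norm_inner_le_norm _ _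
        _ ≤ ‖g p.1‖ * (C * ‖f p.2‖) := by
          gcongr
          exact ((K _).le_opNorm _).trans (by gcongr; exact hC _)
        _ = _ := by ring
  calc ∫ x, ⟪g x, conv K f x⟫_ℂ = ∫ x, ∫ y, ⟪g x, K (x - y) (f y)⟫_ℂ := by
        congr 1
        funext x
        exact (integral_inner (integrable_conv_kernel hK hf x) (g x)).symm
    _ = ∫ y, ∫ x, ⟪g x, K (x - y) (f y)⟫_ℂ := integral_integral_swap hInt
    _ = ∫ y, ⟪conv (adjKernel K) g y, f y⟫_ℂ := by
        congr 1
        funext y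
        rw [conv, ← inner_conj_symm, ← integral_inner
          (integrable_conv_kernel (continuous_adjKernel hK) hg y), ← integral_conj]
        congr 1
        funext x
        rw [inner_conj_symm, adjKernel, neg_sub, ContinuousLinearMap.adjoint_inner_left]

lemma lintegral_enorm_rpow_ne_top {E : Type*} [NormedAddCommGroup E] {h : UnitAddCircle → E} (hh : Continuous h) {p : ℝ}
    (hp : 0 ≤ p) : ∫⁻ x, ‖h x‖ₑ ^ p ≠ ⊤ := by
  obtain ⟨C, hC⟩ := exists_norm_le_of_continuous hh
  refine ne_top_of_le_ne_top (b := ENNReal.ofReal C ^ p)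
    (ENNReal.rpow_ne_top_of_nonneg hp ENNReal.ofReal_ne_top) ?_
  calc _ ≤ ∫⁻ _ : UnitAddCircle, ENNReal.ofReal C ^ p := by
        refine lintegral_mono fun x => ENNReal.rpow_le_rpow ?_ hp
        rw [← ofReal_norm]; exact ENNReal.ofReal_le_ofReal (hC x)
    _ = _ := by simp

/-- An `L^q` bound for the adjoint operator gives an `L^p` bound, `p ≥ 2`. -/
theorem BoundedOn.of_adjKernel (hK : Continuous K) {p q : ℝ} (hpq : p.HolderConjugate q)
    (hp : 2 ≤ p) {B : ℝ≥0} (hB : BoundedOn (OrliczLP.adjKernel K) q B) :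
    BoundedOn K p (B ^ (p - 1)) := by
  intro f hf
  set F := conv K f with hF
  have hFc : Continuous F := continuous_conv hK hf
  set X := ∫⁻ x, ‖F x‖ₑ ^ p with hX
  have hp0 : 0 < p := by linarith
  have hq0 : 0 < q := hpq.symm.pos
  have hXt : X ≠ ⊤ := lintegral_enorm_rpow_ne_top hFc hp0.le
  rcases eq_or_ne X 0 with hX0 | hX0
  · rw [hX0]; exact zero_le
  -- The function extremal in Hölder's inequality for `F`: `‖g‖^q = ‖F‖^p = ⟪g, F⟫`. Continuity uses
  -- `p ≥ 2`.
  set g : UnitAddCircle → H₂ := fun x => ((‖F x‖ ^ (p - 2) : ℝ) : ℂ) • F x with hg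
  have hgc : Continuous g :=
    (Complex.continuous_ofReal.comp (hFc.norm.rpow_const fun _ => Or.inr (by linarith))).smul hFc
  have hgi : Integrable g := hgc.integrable_of_hasCompactSupport
    (HasCompactSupport.of_compactSpace g)
  have hgq : ∀ x, ‖g x‖ₑ ^ q = ‖F x‖ₑ ^ p := by
    intro x
    have h1 : ‖g x‖ = ‖F x‖ ^ (p - 1) := by
      rw [hg, norm_smul, Complex.norm_real, Real.norm_of_nonneg (by positivity)]
      rcases eq_or_ne (‖F x‖) 0 with h0 | h0
      · rw [h0, Real.zero_rpow (by linarith : p - 1 ≠ 0)]; simp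
      · rw [← Real.rpow_add_one h0]; congr 1; ring
    rw [← ofReal_norm, h1, ← ofReal_norm, ENNReal.ofReal_rpow_of_nonneg (by positivity) hq0.le,
      ENNReal.ofReal_rpow_of_nonneg (by positivity) hp0.le, ← Real.rpow_mul (norm_nonneg _),
      hpq.sub_one_mul_conj]
  have hgF : ∀ x, ⟪g x, F x⟫_ℂ = ((‖F x‖ ^ p : ℝ) : ℂ) := by
    intro x
    rw [hg, inner_smul_left, inner_self_eq_norm_sq_to_K, Complex.conj_ofReal]
    change ((‖F x‖ ^ (p - 2) : ℝ) : ℂ) * ((‖F x‖ : ℝ) : ℂ) ^ 2 = _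
    rw [← Complex.ofReal_pow, ← Complex.ofReal_mul]
    congr 1
    rcases eq_or_ne (‖F x‖) 0 with h0 | h0
    · rw [h0, Real.zero_rpow hp0.ne']; simp
    · rw [← Real.rpow_natCast, ← Real.rpow_add (lt_of_le_of_ne (norm_nonneg _) h0.symm)]
      congr 1; push_cast; ring
  have hpair : X ≤ ∫⁻ x, ‖f x‖ₑ * ‖conv (adjKernel K) g x‖ₑ := by
    have h1 : X = ‖∫ x, ⟪g x, F x⟫_ℂ‖ₑ := by
      simp only [hgF]
      rw [integral_complex_ofReal, ← ofReal_norm, Complex.norm_real, ofReal_norm,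
        Real.enorm_of_nonneg (integral_nonneg fun x => by positivity),
        ofReal_integral_eq_lintegral_ofReal]
      · refine lintegral_congr fun x => ?_
        rw [← ofReal_norm, ENNReal.ofReal_rpow_of_nonneg (norm_nonneg _) hp0.le]
      · have hc : Continuous fun x => ‖F x‖ ^ p := hFc.norm.rpow_const fun _ => Or.inr hp0.le
        exact hc.integrable_of_hasCompactSupport (HasCompactSupport.of_compactSpace _)
      · exact Eventually.of_forall fun x => by positivity
    rw [h1, hF, integral_inner_conv hK hf hgi]
    refine (enorm_integral_le_lintegral_enorm _).trans (lintegral_mono fun x => ?_)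
    rw [mul_comm]
    simp only [← ofReal_norm]
    rw [← ENNReal.ofReal_mul (norm_nonneg _)]
    exact ENNReal.ofReal_le_ofReal (norm_inner_le_norm _ _)
  have hmain : X ≤ (∫⁻ x, ‖f x‖ₑ ^ p) ^ (1 / p) * (B * X) ^ (1 / q) := by
    refine hpair.trans ((ENNReal.lintegral_mul_le_Lp_mul_Lq volume hpq
      hf.aestronglyMeasurable.enorm
      (continuous_conv (continuous_adjKernel hK) hgi).enorm.aemeasurable).trans ?_)
    gcongr
    refine (hB g hgi).trans ?_
    rw [lintegral_congr hgq]
  have hinv : 1 / p + 1 / q = 1 := by simpa using hpq.inv_add_inv_eq_one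
  have h2 : X ^ (1 / p) ≤ (∫⁻ x, ‖f x‖ₑ ^ p) ^ (1 / p) * (B : ℝ≥0∞) ^ (1 / q) := by
    -- Cancelling `X ^ (1 / q)` is legitimate because `X` is nonzero and finite, `F` being
    -- continuous on a compact space.
    rw [ENNReal.mul_rpow_of_nonneg _ _ (by positivity), ← mul_assoc] at hmain
    have h3 : X ^ (1 / p) * X ^ (1 / q) = X := by
      rw [← ENNReal.rpow_add _ _ hX0 hXt, hinv, ENNReal.rpow_one]
    nth_rewrite 1 [← h3] at hmain
    refine (ENNReal.mul_le_mul_iff_left ?_ ?_).1 hmain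
    · simp [ENNReal.rpow_eq_zero_iff, hX0, hXt]
    · exact ENNReal.rpow_ne_top_of_nonneg (by positivity) hXt
  have h4 := ENNReal.rpow_le_rpow h2 hp0.le
  rw [ENNReal.mul_rpow_of_nonneg _ _ hp0.le, ← ENNReal.rpow_mul, ← ENNReal.rpow_mul,
    ← ENNReal.rpow_mul, one_div_mul_cancel hp0.ne', ENNReal.rpow_one, ENNReal.rpow_one] at h4
  refine h4.trans_eq ?_
  rw [mul_comm, ENNReal.coe_rpow_of_nonneg _ (by linarith)]
  congr 2
  have : 1 / q = 1 - 1 / p := by linarith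
  rw [this, sub_mul, one_div_mul_cancel hp0.ne', one_mul]

/-- Duality with `p = q = 2`, applied to the adjoint kernel, whose own adjoint is `K`. The exponent
`p - 1 = 1` preserves the constant. -/
lemma BoundedOn.adjKernel_two (hK : Continuous K) {A : ℝ≥0} (h : BoundedOn K 2 A) :
    BoundedOn (OrliczLP.adjKernel K) 2 A := by
  have := BoundedOn.of_adjKernel (K := OrliczLP.adjKernel K) (p := 2) (q := 2) (B := A)
    (continuous_adjKernel hK) Real.HolderConjugate.two_two le_rfl
    (by rwa [adjKernel_adjKernel])
  norm_num at this
  exact this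

end Duality

/-! ### From weak type and `L²` to uniform modular bounds. -/

section Interpolation

/-- Powers are admissible growth functions, so the modular interpolation theorem also yields `L^p`
bounds; `p > 1` is what makes `2^p > 2`. -/
lemma growth_rpow {p : ℝ} (hp : 1 < p) :
    Growth (fun u : ℝ≥0 => (u : ℝ≥0∞) ^ p) 1 (2 ^ p) (2 ^ p) where
  mono u v h := by
    have : 0 ≤ p := by linarith
    simp only
    gcongr
  star u v h := by
    have h1 : ∀ w : ℝ≥0, (w : ℝ≥0∞) ^ p = (w : ℝ≥0∞) ^ (p - 1) * w := by
      intro w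
      nth_rewrite 3 [← ENNReal.rpow_one (w : ℝ≥0∞)]
      rw [← ENNReal.rpow_add_of_nonneg _ _ (by linarith) zero_le_one]
      congr 1; ring
    simp only [h1]
    rw [mul_assoc, mul_assoc, mul_comm (u : ℝ≥0∞) v]
    have : 0 ≤ p - 1 := by linarith
    gcongr
  pos := one_pos
  delta u _ := by
    rw [ENNReal.coe_mul, ENNReal.mul_rpow_of_nonneg _ _ (by linarith),
      ENNReal.coe_rpow_of_nonneg _ (by linarith)]
  two_lt := by
    nth_rewrite 1 [← NNReal.rpow_one 2]
    exact NNReal.rpow_lt_rpow_of_exponent_lt one_lt_two hp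
  nabla u _ := by
    rw [ENNReal.coe_mul, ENNReal.mul_rpow_of_nonneg _ _ (by linarith),
      ENNReal.coe_rpow_of_nonneg _ (by linarith)]

variable {H₁ H₂ : Type*} [NormedAddCommGroup H₁] [InnerProductSpace ℂ H₁]
  [NormedAddCommGroup H₂] [InnerProductSpace ℂ H₂]

lemma lintegral_enorm_ofReal_smul_rpow (F : UnitAddCircle → H₁) {p : ℝ} (hp : 0 ≤ p) {c : ℝ}
    (hc : 0 ≤ c) : ∫⁻ x, ‖(c : ℂ) • F x‖ₑ ^ p = ENNReal.ofReal c ^ p * ∫⁻ x, ‖F x‖ₑ ^ p := by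
  rw [← lintegral_const_mul' _ _ (ENNReal.rpow_ne_top_of_nonneg hp ENNReal.ofReal_ne_top)]
  refine lintegral_congr fun x => ?_
  rw [enorm_smul, ENNReal.mul_rpow_of_nonneg _ _ hp, ← ofReal_norm (c : ℂ), Complex.norm_real,
    Real.norm_of_nonneg hc]

/-- Homogeneity removes the additive constant from the interpolation theorem: scale `f` to have
`p`-th moment `1`. Adding `1` to `C` keeps the constant nonzero when the moment of `f` is infinite.
-/
lemma boundedOn_of_modular {K : UnitAddCircle → H₁ →L[ℂ] H₂} {p : ℝ} (hp : 0 < p) {C : ℝ≥0}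
    (h : ∀ f : UnitAddCircle → H₁, Integrable f → ∫⁻ x, ‖f x‖ₑ ^ p ≤ 1 →
      ∫⁻ x, ‖conv K f x‖ₑ ^ p ≤ C) : BoundedOn K p (C + 1) := by
  intro f hf
  set I := ∫⁻ x, ‖f x‖ₑ ^ p with hI
  rcases eq_or_ne I ⊤ with hIt | hIt
  · rw [hIt, ENNReal.mul_top (by simp)]; exact le_top
  rcases eq_or_ne I 0 with hI0 | hI0
  · rw [hI0, mul_zero]
    have h1 : ∀ᵐ y, f y = 0 := by
      rw [hI, lintegral_eq_zero_iff' (hf.aestronglyMeasurable.enorm.pow_const p)] at hI0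
      filter_upwards [hI0] with y hy
      simpa [ENNReal.rpow_eq_zero_iff, hp, hp.le, hp.not_gt] using hy
    have h2 : ∀ x, conv K f x = 0 := by
      intro x
      rw [conv, integral_eq_zero_of_ae]
      filter_upwards [h1] with y hy
      simp [hy]
    simp [h2, hp]
  set c : ℝ := (I.toReal ^ (1 / p))⁻¹ with hc
  have hIr : 0 < I.toReal := ENNReal.toReal_pos hI0 hIt
  have hcp : ENNReal.ofReal c ^ p = I⁻¹ := by
    rw [hc, ENNReal.ofReal_inv_of_pos (by positivity), ENNReal.inv_rpow,
      ← ENNReal.ofReal_rpow_of_pos hIr, ENNReal.ofReal_toReal hIt, ← ENNReal.rpow_mul,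
      one_div_mul_cancel hp.ne', ENNReal.rpow_one]
  have hcn : 0 ≤ c := by positivity
  have h1 := h (fun x => (c : ℂ) • f x) (hf.smul (c : ℂ))
    (by rw [lintegral_enorm_ofReal_smul_rpow _ hp.le hcn, hcp, ENNReal.inv_mul_cancel hI0 hIt])
  rw [conv_const_smul, lintegral_enorm_ofReal_smul_rpow _ hp.le hcn, hcp, ← ENNReal.div_eq_inv_mul,
    ENNReal.div_le_iff_le_mul (Or.inl hI0) (Or.inl hIt)] at h1
  refine h1.trans ?_
  gcongr
  exact le_self_add

lemma IsHormander.weakOneOne [CompleteSpace H₁] [CompleteSpace H₂]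
    {K : UnitAddCircle → H₁ →L[ℂ] H₂} {A : ℝ≥0}
    (hK : IsHormander K A) (h2 : BoundedOn K 2 A) : WeakOneOne K (4 * A + 4) := by
  intro f hf l hl
  have := weakType_one_one hK h2 hf hl
  push_cast
  exact this

lemma inv_one_sub_ne_top {K : ℝ≥0} {r : ℝ} (h : (K : ℝ≥0∞) < 2 ^ r) :
    (1 - (K : ℝ≥0∞) / 2 ^ r)⁻¹ ≠ ⊤ := by
  rw [ENNReal.inv_ne_top, ne_eq, tsub_eq_zero_iff_le, not_le]
  exact ENNReal.div_lt_of_lt_mul (by simpa using h)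

/-- Modular bound for `Φ` from the weak type `(1, 1)` and an `L^r` bound. -/
lemma exists_modular_bound_of_boundedOn {Φ : ℝ≥0 → ℝ≥0∞} {u₀ K₁ K₂ : ℝ≥0}
    (h : Growth Φ u₀ K₁ K₂) (hfin : Φ u₀ ≠ ⊤) {r : ℝ} (hr : 0 < r)
    (hKr : (K₁ : ℝ≥0∞) < 2 ^ r) (A B : ℝ≥0) :
    ∃ M : ℝ≥0, ∀ (H₁ H₂ : Type) [NormedAddCommGroup H₁] [InnerProductSpace ℂ H₁]
      [NormedAddCommGroup H₂] [InnerProductSpace ℂ H₂]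
      (K : UnitAddCircle → H₁ →L[ℂ] H₂), Continuous K → WeakOneOne K A → BoundedOn K r B →
      ∀ f : UnitAddCircle → H₁, Integrable f → ∫⁻ x, Φ ‖f x‖₊ ≤ 1 →
        ∫⁻ x, Φ ‖conv K f x‖₊ ≤ M := by
  set X : ℝ≥0∞ := Φ u₀ + (4 * A * (((K₁ * (K₂ / (K₂ - 2)) : ℝ≥0) : ℝ≥0∞) * 1) +
      2 ^ r * B * (K₁ * (1 - (K₁ : ℝ≥0∞) / 2 ^ r)⁻¹ * (K₁ * 1 + Φ u₀))) with hX
  have hXt : X ≠ ⊤ := by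
    have h1 := inv_one_sub_ne_top hKr
    have h2 : (2 : ℝ≥0∞) ^ r ≠ ⊤ := ENNReal.rpow_ne_top_of_nonneg hr.le (by simp)
    finiteness
  refine ⟨X.toNNReal, fun H₁ H₂ _ _ _ _ K hK hw hb f hf hf1 => ?_⟩
  rw [ENNReal.coe_toNNReal hXt, hX]
  refine (lintegral_conv_le h hr hK hw hb hf).trans ?_
  gcongr

/-- Interpolation with upper exponent `2`: the doubling constant of `u^q` is `2^q < 2^2`, so the
upper geometric series converges. -/
lemma exists_boundedOn_rpow {q : ℝ} (hq : 1 < q) (hq2 : q < 2) (A : ℝ≥0) :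
    ∃ B : ℝ≥0, ∀ (H₁ H₂ : Type) [NormedAddCommGroup H₁] [InnerProductSpace ℂ H₁]
      [CompleteSpace H₁] [NormedAddCommGroup H₂] [InnerProductSpace ℂ H₂] [CompleteSpace H₂]
      (K : UnitAddCircle → H₁ →L[ℂ] H₂), IsHormander K A → BoundedOn K 2 A → BoundedOn K q B := by
  obtain ⟨M, hM⟩ := exists_modular_bound_of_boundedOn (growth_rpow hq) (by simp) two_pos
    (by
      rw [ENNReal.coe_rpow_of_nonneg _ (by linarith)]
      exact ENNReal.rpow_lt_rpow_of_exponent_lt (by simp) (by simp) hq2) (4 * A + 4) A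
  refine ⟨M + 1, fun H₁ H₂ _ _ _ _ _ _ K hK h2 => ?_⟩
  exact boundedOn_of_modular (by linarith) fun f hf hf1 =>
    hM H₁ H₂ K hK.continuous (hK.weakOneOne h2) h2 f hf hf1

/-- Calderón–Zygmund operators satisfy modular bounds, uniformly in the kernel. -/
theorem exists_modular_bound {Φ : ℝ≥0 → ℝ≥0∞} {u₀ K₁ K₂ : ℝ≥0}
    (h : Growth Φ u₀ K₁ K₂) (hfin : Φ u₀ ≠ ⊤) (A : ℝ≥0) :
    ∃ M : ℝ≥0, ∀ (H₁ H₂ : Type) [NormedAddCommGroup H₁] [InnerProductSpace ℂ H₁]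
      [CompleteSpace H₁] [NormedAddCommGroup H₂] [InnerProductSpace ℂ H₂] [CompleteSpace H₂]
      (K : UnitAddCircle → H₁ →L[ℂ] H₂), IsHormander K A → BoundedOn K 2 A →
      ∀ f : UnitAddCircle → H₁, Integrable f → ∫⁻ x, Φ ‖f x‖₊ ≤ 1 →
        ∫⁻ x, Φ ‖conv K f x‖₊ ≤ M := by
  obtain ⟨n, hn⟩ := pow_unbounded_of_one_lt K₁ (one_lt_two (α := ℝ≥0))
  -- The `n` ensures `K₁ < 2^r`; the `3` ensures `r > 2`, so that the conjugate exponent lies in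
  -- `(1, 2)`.
  set r : ℝ := ((n + 3 : ℕ) : ℝ) with hr
  have hr3 : 3 ≤ r := by rw [hr]; push_cast; linarith [Nat.cast_nonneg (α := ℝ) n]
  have hKr : (K₁ : ℝ≥0∞) < 2 ^ r := by
    rw [hr, ENNReal.rpow_natCast]
    have : K₁ < 2 ^ (n + 3) := hn.trans_le (pow_le_pow_right₀ one_le_two (by omega))
    exact_mod_cast this
  have hpq : r.HolderConjugate r.conjExponent := Real.HolderConjugate.conjExponent (by linarith)
  obtain ⟨B, hB⟩ := exists_boundedOn_rpow (q := r.conjExponent) hpq.symm.lt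
    (by rw [Real.conjExponent, div_lt_iff₀] <;> linarith) A
  obtain ⟨M, hM⟩ := exists_modular_bound_of_boundedOn h hfin (by linarith : 0 < r) hKr (4 * A + 4)
    (B ^ (r - 1))
  refine ⟨M, fun H₁ H₂ _ _ _ _ _ _ K hK h2 f hf hf1 => ?_⟩
  have h2' : BoundedOn (adjKernel K) 2 A := h2.adjKernel_two hK.continuous
  have hrb := BoundedOn.of_adjKernel hK.continuous hpq (by linarith)
    (hB H₂ H₁ (adjKernel K) hK.adjKernel h2')
  exact hM H₁ H₂ K hK.continuous (hK.weakOneOne h2) hrb f hf hf1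

end Interpolation

/-! ### Trigonometric polynomials and `L¹` estimates for bump kernels. -/

section Trig

lemma volume_eq_haarAddCircle :
    (volume : Measure UnitAddCircle) = AddCircle.haarAddCircle := by
  rw [AddCircle.volume_eq_smul_haarAddCircle]
  simp

/-- Parseval's identity. -/
lemma tsum_enorm_fourierCoeff_sq {f : UnitAddCircle → ℂ} (hf : MemLp f 2 volume) :
    ∑' n, ‖fourierCoeff f n‖ₑ ^ 2 = ∫⁻ x, ‖f x‖ₑ ^ 2 := by
  rw [volume_eq_haarAddCircle] at hf ⊢
  set F := hf.toLp f with hF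
  have hae := hf.coeFn_toLp
  have h := hasSum_sq_fourierCoeff F
  have h1 : ∀ n, fourierCoeff F n = fourierCoeff f n := fun n => congrFun (fourierCoeff_congr_ae hae) n
  simp only [h1] at h
  have h2 : ∫ t, ‖F t‖ ^ 2 ∂AddCircle.haarAddCircle = ∫ t, ‖f t‖ ^ 2 ∂AddCircle.haarAddCircle := by
    refine integral_congr_ae ?_
    filter_upwards [hae] with x hx
    rw [hx]
  have hpow : ∀ z : ℂ, ‖z‖ₑ ^ 2 = ENNReal.ofReal (‖z‖ ^ 2) := fun z => by
    rw [← ofReal_norm, ENNReal.ofReal_pow (norm_nonneg _)]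
  simp only [hpow]
  rw [← ENNReal.ofReal_tsum_of_nonneg (fun n => by positivity) h.summable, h.tsum_eq, h2,
    ofReal_integral_eq_lintegral_ofReal hf.integrable_norm_pow'
      (Eventually.of_forall fun x => by positivity)]

/-- The trigonometric polynomial with frequencies in `s` and coefficients `c`. -/
noncomputable def trigPoly (s : Finset ℤ) (c : ℤ → ℂ) (x : UnitAddCircle) : ℂ :=
  ∑ n ∈ s, c n * fourier n x

lemma continuous_trigPoly (s : Finset ℤ) (c : ℤ → ℂ) : Continuous (trigPoly s c) := by
  unfold trigPoly; fun_prop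

lemma memLp_two_of_continuous {f : UnitAddCircle → ℂ} (hf : Continuous f) : MemLp f 2 volume :=
  hf.memLp_of_hasCompactSupport (HasCompactSupport.of_compactSpace f)

lemma integrable_of_continuous {E : Type*} [NormedAddCommGroup E] {f : UnitAddCircle → E}
    (hf : Continuous f) : Integrable f :=
  hf.integrable_of_hasCompactSupport (HasCompactSupport.of_compactSpace f)

lemma fourierCoeff_trigPoly (s : Finset ℤ) (c : ℤ → ℂ) (n : ℤ) :
    fourierCoeff (trigPoly s c) n = if n ∈ s then c n else 0 := by
  have h0 : trigPoly s c = ∑ m ∈ s, fun x => c m * fourier m x := by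
    funext x; simp [trigPoly]
  rw [h0, fourierCoeff.sum]
  · have h1 : ∀ m, fourierCoeff (fun x : UnitAddCircle => c m * fourier m x) n =
        if m = n then c m else 0 := by
      intro m
      rw [fourierCoeff.const_mul]
      have h2 := congrFun (fourierCoeff_fourier (T := (1 : ℝ)) m) n
      rw [h2, Pi.single_apply]
      rcases eq_or_ne n m with rfl | hne
      · rw [if_pos rfl, if_pos rfl, mul_one]
      · rw [if_neg hne, if_neg hne.symm, mul_zero]
    rw [Finset.sum_apply, Finset.sum_congr rfl fun m _ => h1 m, Finset.sum_ite_eq']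
  · intro m _
    rw [← volume_eq_haarAddCircle]
    exact integrable_of_continuous (by fun_prop)

lemma lintegral_enorm_trigPoly_sq (s : Finset ℤ) (c : ℤ → ℂ) :
    ∫⁻ x, ‖trigPoly s c x‖ₑ ^ 2 = ∑ n ∈ s, ‖c n‖ₑ ^ 2 := by
  rw [← tsum_enorm_fourierCoeff_sq (memLp_two_of_continuous (continuous_trigPoly s c)),
    tsum_eq_sum (s := s)]
  · refine Finset.sum_congr rfl fun n hn => ?_
    rw [fourierCoeff_trigPoly, if_pos hn]
  · intro n hn
    rw [fourierCoeff_trigPoly, if_neg hn]; simp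

lemma exists_real_rep (x : UnitAddCircle) : ∃ t : ℝ, (t : UnitAddCircle) = x ∧ |t| = ‖x‖ := by
  obtain ⟨t, rfl⟩ := QuotientAddGroup.mk_surjective x
  refine ⟨t - round t, ?_, (UnitAddCircle.norm_eq).symm⟩
  have h : ((round t : ℝ) : UnitAddCircle) = 0 := by
    have := (AddCircle.coe_eq_zero_iff (p := (1 : ℝ)) (x := (round t : ℝ))).2 ⟨round t, by simp⟩
    exact this
  change ((t - round t : ℝ) : UnitAddCircle) = (t : UnitAddCircle)
  rw [AddCircle.coe_sub, h, sub_zero]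

lemma fourier_coe_eq (n : ℤ) (t : ℝ) :
    fourier n (t : UnitAddCircle) = Complex.exp (Complex.I * ((2 * Real.pi * n * t : ℝ) : ℂ)) := by
  rw [fourier_coe_apply]
  congr 1
  push_cast
  ring

lemma norm_fourier_sub_one_le (n : ℤ) (x : UnitAddCircle) :
    ‖(fourier n x : ℂ) - 1‖ ≤ 2 * Real.pi * |(n : ℝ)| * ‖x‖ := by
  obtain ⟨t, rfl, ht⟩ := exists_real_rep x
  rw [fourier_coe_eq, ← ht]
  refine Real.norm_exp_I_mul_ofReal_sub_one_le.trans_eq ?_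
  rw [Real.norm_eq_abs, abs_mul, abs_mul, abs_of_pos (by positivity : 0 < 2 * Real.pi)]

/-- For `|t| ≤ 1 / 2`, `|e^{2πit} - 1| = 2 |sin πt| ≥ 4 |t|` by Jordan's inequality. -/
lemma four_mul_norm_le (x : UnitAddCircle) : 4 * ‖x‖ ≤ ‖(fourier 1 x : ℂ) - 1‖ := by
  have hx : ‖x‖ ≤ 1 / 2 := by simpa using AddCircle.norm_le_half_period (1 : ℝ) (x := x) one_ne_zero
  obtain ⟨t, rfl, ht⟩ := exists_real_rep x
  rw [← ht] at hx ⊢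
  rw [fourier_coe_eq, Complex.norm_exp_I_mul_ofReal_sub_one, norm_mul, Real.norm_eq_abs,
    Real.norm_eq_abs, abs_two]
  have h1 : 2 * Real.pi * ((1 : ℤ) : ℝ) * t / 2 = Real.pi * t := by push_cast; ring
  rw [h1]
  have hpi := Real.pi_pos
  have h2 := Real.mul_abs_le_abs_sin (x := Real.pi * t)
    (by rw [abs_mul, abs_of_pos hpi]; nlinarith)
  rw [abs_mul, abs_of_pos hpi] at h2
  have h3 : 2 / Real.pi * (Real.pi * |t|) = 2 * |t| := by field_simp
  linarith

/-- Summation by parts. It trades a factor comparable to `‖x‖` for a difference of coefficients; the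
frequency window grows by one on each side to keep the boundary terms. -/
lemma fourier_one_sub_one_mul_trigPoly (L : ℤ) {c : ℤ → ℂ} (hc : ∀ n, L < |n| → c n = 0)
    (x : UnitAddCircle) : ((fourier 1 x : ℂ) - 1) * trigPoly (Finset.Icc (-L) L) c x =
      trigPoly (Finset.Icc (-L - 1) (L + 1)) (fun n => c (n - 1) - c n) x := by
  have h1 : trigPoly (Finset.Icc (-L) L) c x = ∑ n ∈ Finset.Icc (-L - 1) (L + 1), c n * fourier n x := by
    refine Finset.sum_subset (Finset.Icc_subset_Icc (by omega) (by omega)) fun n _ hn => ?_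
    rw [hc n, zero_mul]
    rw [Finset.mem_Icc, ← abs_le] at hn
    exact not_le.1 hn
  have h2 : (fourier 1 x : ℂ) * trigPoly (Finset.Icc (-L) L) c x =
      ∑ n ∈ Finset.Icc (-L - 1) (L + 1), c (n - 1) * fourier n x := by
    rw [trigPoly, Finset.mul_sum]
    have h3 : ∑ n ∈ Finset.Icc (-L) L, (fourier 1 x : ℂ) * (c n * fourier n x) =
        ∑ n ∈ Finset.Icc (-L + 1) (L + 1), c (n - 1) * fourier n x := by
      rw [← Finset.image_add_right_Icc, Finset.sum_image (by simp)]
      refine Finset.sum_congr rfl fun n _ => ?_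
      rw [fourier_add, add_sub_cancel_right]; ring
    rw [h3]
    refine Finset.sum_subset (Finset.Icc_subset_Icc (by omega) (by omega)) fun n hn hn' => ?_
    rw [hc (n - 1), zero_mul]
    rw [Finset.mem_Icc] at hn hn'
    rw [lt_abs]; omega
  rw [sub_mul, one_mul, h2, h1, trigPoly, ← Finset.sum_sub_distrib]
  exact Finset.sum_congr rfl fun n _ => by ring

/-- The shell `2^i δ ≤ ‖x‖ < 2^{i+1} δ` contributes at most `(2^i δ)⁻² · 2 · 2^{i+1} δ = (4 / δ)
2⁻ⁱ`. -/
lemma lintegral_rpow_neg_two_le {δ : ℝ} (hδ : 0 < δ) :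
    ∫⁻ x in {x : UnitAddCircle | δ < ‖x‖}, ENNReal.ofReal ((‖x‖ ^ 2)⁻¹) ≤ ENNReal.ofReal (8 / δ) := by
  have hpt : ∀ x : UnitAddCircle, δ < ‖x‖ → ENNReal.ofReal ((‖x‖ ^ 2)⁻¹) ≤
      ∑' i : ℕ, (Metric.closedBall (0 : UnitAddCircle) (2 ^ (i + 1) * δ)).indicator
        (fun _ => ENNReal.ofReal (((2 ^ i * δ) ^ 2)⁻¹)) x := by
    intro x hx
    obtain ⟨i, hi1, hi2⟩ := exists_nat_pow_near (x := ‖x‖ / δ) (y := 2)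
      ((one_le_div hδ).2 hx.le) one_lt_two
    rw [le_div_iff₀ hδ] at hi1
    rw [div_lt_iff₀ hδ] at hi2
    refine le_trans ?_ (ENNReal.le_tsum i)
    rw [Set.indicator_of_mem (by simpa using hi2.le)]
    refine ENNReal.ofReal_le_ofReal ?_
    gcongr
  calc _ ≤ ∫⁻ x in {x : UnitAddCircle | δ < ‖x‖},
        ∑' i : ℕ, (Metric.closedBall (0 : UnitAddCircle) (2 ^ (i + 1) * δ)).indicator
        (fun _ => ENNReal.ofReal (((2 ^ i * δ) ^ 2)⁻¹)) x := by
        refine setLIntegral_mono' (isOpen_lt continuous_const continuous_norm).measurableSet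
          fun x hx => hpt x hx
    _ ≤ ∫⁻ x, ∑' i : ℕ, (Metric.closedBall (0 : UnitAddCircle) (2 ^ (i + 1) * δ)).indicator
        (fun _ => ENNReal.ofReal (((2 ^ i * δ) ^ 2)⁻¹)) x := setLIntegral_le_lintegral _ _
    _ = ∑' i : ℕ, ENNReal.ofReal (((2 ^ i * δ) ^ 2)⁻¹) *
          volume (Metric.closedBall (0 : UnitAddCircle) (2 ^ (i + 1) * δ)) := by
        rw [lintegral_tsum fun i => (measurable_const.indicator measurableSet_closedBall).aemeasurable]
        exact tsum_congr fun i => lintegral_indicator_const measurableSet_closedBall _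
    _ ≤ ∑' i : ℕ, ENNReal.ofReal (4 / δ) * 2⁻¹ ^ i := by
        refine ENNReal.tsum_le_tsum fun i => ?_
        rw [AddCircle.volume_closedBall]
        have h2 : (2⁻¹ : ℝ≥0∞) ^ i = ENNReal.ofReal (2⁻¹ ^ i) := by
          rw [ENNReal.ofReal_pow (by norm_num), ENNReal.ofReal_inv_of_pos (by norm_num)]; simp
        rw [h2, ← ENNReal.ofReal_mul (by positivity), ← ENNReal.ofReal_mul (by positivity)]
        refine ENNReal.ofReal_le_ofReal ?_
        calc _ ≤ ((2 ^ i * δ) ^ 2)⁻¹ * (2 * (2 ^ (i + 1) * δ)) := by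
              gcongr; exact min_le_right _ _
          _ = _ := by rw [inv_pow]; field_simp; ring
    _ = ENNReal.ofReal (8 / δ) := by
        rw [ENNReal.tsum_mul_left, ENNReal.tsum_geometric, ENNReal.one_sub_inv_two, inv_inv,
          ← ENNReal.ofReal_ofNat, ← ENNReal.ofReal_mul (by positivity)]
        congr 1; ring

/-- Size and smoothness conditions at scale `D` on the coefficients of a trigonometric
polynomial. -/
structure IsBump (c : ℤ → ℂ) (A B D : ℝ) (L : ℕ) : Prop where
  A_pos : 0 < A
  one_le_B : 1 ≤ B
  one_le_D : 1 ≤ D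
  L_le : L ≤ B * D
  bound : ∀ n, ‖c n‖ ≤ A
  diff : ∀ n, ‖c (n + 1) - c n‖ ≤ A / D
  supp : ∀ n : ℤ, (L : ℤ) < |n| → c n = 0

namespace IsBump

variable {c : ℤ → ℂ} {A B D : ℝ} {L : ℕ}

lemma sum_enorm_sq_le {a : ℤ → ℂ} {s : Finset ℤ} {M N : ℝ}
    (ha : ∀ n, ‖a n‖ ≤ M) (hs : (s.card : ℝ) ≤ N) :
    ∑ n ∈ s, ‖a n‖ₑ ^ 2 ≤ ENNReal.ofReal (N * M ^ 2) := by
  calc _ ≤ ∑ _n ∈ s, ENNReal.ofReal (M ^ 2) := by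
        refine Finset.sum_le_sum fun n _ => ?_
        rw [← ofReal_norm, ← ENNReal.ofReal_pow (norm_nonneg _)]
        exact ENNReal.ofReal_le_ofReal (by gcongr; exact ha n)
    _ = ENNReal.ofReal (s.card * M ^ 2) := by
        rw [Finset.sum_const, nsmul_eq_mul, ENNReal.ofReal_mul (by positivity), ENNReal.ofReal_natCast]
    _ ≤ _ := ENNReal.ofReal_le_ofReal (by gcongr)

lemma lintegral_sq_le (h : IsBump c A B D L) :
    ∫⁻ x, ‖trigPoly (Finset.Icc (-(L : ℤ)) L) c x‖ₑ ^ 2 ≤ ENNReal.ofReal (3 * B * D * A ^ 2) := by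
  rw [lintegral_enorm_trigPoly_sq]
  refine sum_enorm_sq_le h.bound ?_
  have hcard : ((Finset.Icc (-(L : ℤ)) L).card : ℝ) = 2 * L + 1 := by
    rw [Int.card_Icc, show ((L : ℤ) + 1 - -L).toNat = 2 * L + 1 by omega]; push_cast; ring
  have hBD : 1 ≤ B * D := one_le_mul_of_one_le_of_one_le h.one_le_B h.one_le_D
  rw [hcard]; linarith [h.L_le]

/-- The weight is absorbed by summation by parts, and Parseval sees only coefficient differences, of
size `A / D` on `O(B D)` frequencies. -/
lemma lintegral_norm_sq_mul_le (h : IsBump c A B D L) :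
    ∫⁻ x, ENNReal.ofReal (‖x‖ ^ 2) * ‖trigPoly (Finset.Icc (-(L : ℤ)) L) c x‖ₑ ^ 2 ≤
      ENNReal.ofReal (B * A ^ 2 / D) := by
  have hD : 0 < D := by linarith [h.one_le_D]
  have hA := h.A_pos
  have h1 : ∀ x : UnitAddCircle,
      ENNReal.ofReal (‖x‖ ^ 2) * ‖trigPoly (Finset.Icc (-(L : ℤ)) L) c x‖ₑ ^ 2 ≤
      ENNReal.ofReal (1 / 16) *
        ‖trigPoly (Finset.Icc (-(L : ℤ) - 1) (L + 1)) (fun n => c (n - 1) - c n) x‖ₑ ^ 2 := by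
    intro x
    rw [← fourier_one_sub_one_mul_trigPoly (L : ℤ) h.supp x, enorm_mul, mul_pow, ← mul_assoc]
    gcongr
    rw [← ofReal_norm, ← ENNReal.ofReal_pow (norm_nonneg _), ← ENNReal.ofReal_mul (by norm_num)]
    refine ENNReal.ofReal_le_ofReal ?_
    have := pow_le_pow_left₀ (by positivity) (four_mul_norm_le x) 2
    linarith
  have hcard : ((Finset.Icc (-(L : ℤ) - 1) (L + 1)).card : ℝ) = 2 * L + 3 := by
    rw [Int.card_Icc, show ((L : ℤ) + 1 + 1 - (-L - 1)).toNat = 2 * L + 3 by omega]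
    push_cast; ring
  have hBD : 1 ≤ B * D := one_le_mul_of_one_le_of_one_le h.one_le_B h.one_le_D
  calc _ ≤ ∫⁻ x, ENNReal.ofReal (1 / 16) *
        ‖trigPoly (Finset.Icc (-(L : ℤ) - 1) (L + 1)) (fun n => c (n - 1) - c n) x‖ₑ ^ 2 :=
        lintegral_mono h1
    _ = ENNReal.ofReal (1 / 16) * ∑ n ∈ Finset.Icc (-(L : ℤ) - 1) (L + 1),
          ‖c (n - 1) - c n‖ₑ ^ 2 := by
        rw [lintegral_const_mul' _ _ ENNReal.ofReal_ne_top, lintegral_enorm_trigPoly_sq]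
    _ ≤ ENNReal.ofReal (1 / 16) * ENNReal.ofReal (5 * (B * D) * (A / D) ^ 2) := by
        gcongr
        refine sum_enorm_sq_le (fun n => ?_) (by rw [hcard]; linarith [h.L_le])
        have := h.diff (n - 1)
        rwa [sub_add_cancel, norm_sub_rev] at this
    _ ≤ _ := by
        rw [← ENNReal.ofReal_mul (by norm_num)]
        refine ENNReal.ofReal_le_ofReal ?_
        have : 1 / 16 * (5 * (B * D) * (A / D) ^ 2) = 5 / 16 * (B * A ^ 2 / D) := by
          field_simp
        rw [this]
        have : 0 ≤ B * A ^ 2 / D := by have := h.one_le_B; positivity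
        linarith

/-- Cauchy–Schwarz against `‖x‖⁻²`, in the pointwise form `|k| ≤ τ ‖x‖⁻² + τ⁻¹ ‖x‖² |k|²`. The
kernel is thus concentrated at scale `1 / D`. -/
lemma setLIntegral_off_ball_le (h : IsBump c A B D L) {δ : ℝ} (hδ : 0 < δ) :
    ∫⁻ x in {x | δ < ‖x‖}, ‖trigPoly (Finset.Icc (-(L : ℤ)) L) c x‖ₑ ≤
      ENNReal.ofReal ((8 + B) * A / √(δ * D)) := by
  have hD : 0 < D := by linarith [h.one_le_D]
  have hA := h.A_pos
  have hB := h.one_le_B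
  -- This choice makes both integrals of order `A / √(δ D)`.
  set τ : ℝ := A * √(δ * D) / D with hτ
  have hs : 0 < √(δ * D) := by positivity
  have hτ0 : 0 < τ := by positivity
  have hpt : ∀ x : UnitAddCircle, δ < ‖x‖ → ‖trigPoly (Finset.Icc (-(L : ℤ)) L) c x‖ₑ ≤
      ENNReal.ofReal τ * ENNReal.ofReal ((‖x‖ ^ 2)⁻¹) + ENNReal.ofReal τ⁻¹ *
      (ENNReal.ofReal (‖x‖ ^ 2) * ‖trigPoly (Finset.Icc (-(L : ℤ)) L) c x‖ₑ ^ 2) := by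
    intro x hx
    have hx0 : 0 < ‖x‖ := hδ.trans hx
    set k := trigPoly (Finset.Icc (-(L : ℤ)) L) c x
    rw [← ofReal_norm, ← ENNReal.ofReal_pow (norm_nonneg _), ← ENNReal.ofReal_mul (by positivity),
      ← ENNReal.ofReal_mul (by positivity), ← ENNReal.ofReal_mul (by positivity),
      ← ENNReal.ofReal_add (by positivity) (by positivity)]
    refine ENNReal.ofReal_le_ofReal ?_
    have e : τ * (‖x‖ ^ 2)⁻¹ + τ⁻¹ * (‖x‖ ^ 2 * ‖k‖ ^ 2) - ‖k‖ =
        τ * (‖x‖ ^ 2)⁻¹ * ((τ⁻¹ * ‖x‖ ^ 2 * ‖k‖ - 1 / 2) ^ 2 + 3 / 4) := by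
      field_simp; ring
    have : 0 ≤ τ * (‖x‖ ^ 2)⁻¹ * ((τ⁻¹ * ‖x‖ ^ 2 * ‖k‖ - 1 / 2) ^ 2 + 3 / 4) := by positivity
    linarith
  have hms : MeasurableSet {x : UnitAddCircle | δ < ‖x‖} :=
    (isOpen_lt continuous_const continuous_norm).measurableSet
  have hcm : Measurable fun x : UnitAddCircle => ENNReal.ofReal ((‖x‖ ^ 2)⁻¹) :=
    ((measurable_norm.pow_const 2).inv).ennreal_ofReal
  calc _ ≤ ∫⁻ x in {x | δ < ‖x‖}, (ENNReal.ofReal τ * ENNReal.ofReal ((‖x‖ ^ 2)⁻¹) +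
        ENNReal.ofReal τ⁻¹ * (ENNReal.ofReal (‖x‖ ^ 2) *
          ‖trigPoly (Finset.Icc (-(L : ℤ)) L) c x‖ₑ ^ 2)) :=
        setLIntegral_mono' hms fun x hx => hpt x hx
    _ = ENNReal.ofReal τ * (∫⁻ x in {x : UnitAddCircle | δ < ‖x‖}, ENNReal.ofReal ((‖x‖ ^ 2)⁻¹)) +
        ENNReal.ofReal τ⁻¹ * ∫⁻ x in {x | δ < ‖x‖}, (ENNReal.ofReal (‖x‖ ^ 2) *
          ‖trigPoly (Finset.Icc (-(L : ℤ)) L) c x‖ₑ ^ 2) := by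
        rw [lintegral_add_left (hcm.const_mul _), lintegral_const_mul' _ _ ENNReal.ofReal_ne_top,
          lintegral_const_mul' _ _ ENNReal.ofReal_ne_top]
    _ ≤ ENNReal.ofReal τ * ENNReal.ofReal (8 / δ) +
        ENNReal.ofReal τ⁻¹ * ENNReal.ofReal (B * A ^ 2 / D) := by
        gcongr
        · exact lintegral_rpow_neg_two_le hδ
        · exact (setLIntegral_le_lintegral _ _).trans h.lintegral_norm_sq_mul_le
    _ = _ := by
        rw [← ENNReal.ofReal_mul (by positivity), ← ENNReal.ofReal_mul (by positivity),
          ← ENNReal.ofReal_add (by positivity) (by positivity)]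
        congr 1
        have hsq : √(δ * D) ^ 2 = δ * D := Real.sq_sqrt (by positivity)
        rw [hτ]
        have e1 : A * √(δ * D) / D * (8 / δ) = 8 * A / √(δ * D) := by
          rw [div_mul_div_comm, div_eq_div_iff (by positivity) (by positivity)]
          linear_combination (8 * A) * hsq
        have e2 : (A * √(δ * D) / D)⁻¹ * (B * A ^ 2 / D) = B * A / √(δ * D) := by
          field_simp
        rw [e1, e2]; ring

/-- Outside the ball of radius `1 / D` the decay estimate applies; inside, `|k| ≤ A D + (A D)⁻¹
|k|²` and Parseval suffice. The bound does not depend on `D`. -/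
lemma lintegral_le (h : IsBump c A B D L) :
    ∫⁻ x, ‖trigPoly (Finset.Icc (-(L : ℤ)) L) c x‖ₑ ≤ ENNReal.ofReal ((10 + 4 * B) * A) := by
  have hD : 0 < D := by linarith [h.one_le_D]
  have hA := h.A_pos
  have hB := h.one_le_B
  have hms : MeasurableSet {x : UnitAddCircle | 1 / D < ‖x‖} :=
    (isOpen_lt continuous_const continuous_norm).measurableSet
  have hpt : ∀ x : UnitAddCircle, ‖trigPoly (Finset.Icc (-(L : ℤ)) L) c x‖ₑ ≤
      ENNReal.ofReal (A * D) + ENNReal.ofReal (A * D)⁻¹ *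
      ‖trigPoly (Finset.Icc (-(L : ℤ)) L) c x‖ₑ ^ 2 := by
    intro x
    set k := trigPoly (Finset.Icc (-(L : ℤ)) L) c x
    rw [← ofReal_norm, ← ENNReal.ofReal_pow (norm_nonneg _), ← ENNReal.ofReal_mul (by positivity),
      ← ENNReal.ofReal_add (by positivity) (by positivity)]
    refine ENNReal.ofReal_le_ofReal ?_
    have e : A * D + (A * D)⁻¹ * ‖k‖ ^ 2 - ‖k‖ =
        (A * D) * (((A * D)⁻¹ * ‖k‖ - 1 / 2) ^ 2 + 3 / 4) := by
      field_simp; ring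
    have : 0 ≤ (A * D) * (((A * D)⁻¹ * ‖k‖ - 1 / 2) ^ 2 + 3 / 4) := by positivity
    linarith
  have hball : {x : UnitAddCircle | 1 / D < ‖x‖}ᶜ = Metric.closedBall 0 (1 / D) := by
    ext x; simp
  rw [← lintegral_add_compl _ hms]
  calc _ ≤ ENNReal.ofReal ((8 + B) * A / √(1 / D * D)) +
        ∫⁻ x in {x : UnitAddCircle | 1 / D < ‖x‖}ᶜ, (ENNReal.ofReal (A * D) +
          ENNReal.ofReal (A * D)⁻¹ * ‖trigPoly (Finset.Icc (-(L : ℤ)) L) c x‖ₑ ^ 2) := by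
        gcongr
        · exact h.setLIntegral_off_ball_le (by positivity)
        · exact hpt _
    _ ≤ ENNReal.ofReal ((8 + B) * A / √(1 / D * D)) + (ENNReal.ofReal (A * D) *
          ENNReal.ofReal (2 * (1 / D)) +
          ENNReal.ofReal (A * D)⁻¹ * ENNReal.ofReal (3 * B * D * A ^ 2)) := by
        rw [lintegral_add_left measurable_const, lintegral_const_mul' _ _ ENNReal.ofReal_ne_top,
          lintegral_const, Measure.restrict_apply_univ, hball, AddCircle.volume_closedBall]
        gcongr
        · exact min_le_right _ _
        · exact (setLIntegral_le_lintegral _ _).trans h.lintegral_sq_le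
    _ = _ := by
        rw [← ENNReal.ofReal_mul (by positivity), ← ENNReal.ofReal_mul (by positivity),
          ← ENNReal.ofReal_add (by positivity) (by positivity),
          ← ENNReal.ofReal_add (by positivity) (by positivity)]
        congr 1
        rw [one_div_mul_cancel hD.ne', Real.sqrt_one]
        field_simp
        ring

end IsBump

end Trig

/-! ### Summation over dyadic scales. -/

section DyadicSum

lemma sum_inv_sqrt_le (N : ℕ) {t : ℝ} (ht : 0 < t) :
    ∑ j ∈ Finset.range N, 1 / √(t * 2 ^ j) ≤ 4 / √t := by
  induction N generalizing t with
  | zero => rw [Finset.sum_range_zero]; positivity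
  | succ N ih =>
    rw [Finset.sum_range_succ']
    have h1 : ∀ j, 1 / √(t * 2 ^ (j + 1)) = 1 / √(2 * t * 2 ^ j) := fun j => by
      rw [pow_succ']; congr 2; ring
    simp only [h1, pow_zero, mul_one]
    have h2 := ih (t := 2 * t) (by positivity)
    have hs : 0 < √t := Real.sqrt_pos.2 ht
    have h3 : 4 / √(2 * t) ≤ 3 / √t := by
      rw [Real.sqrt_mul two_pos.le, div_le_div_iff₀ (by positivity) hs]
      have : (4 : ℝ) / 3 ≤ √2 := Real.le_sqrt_of_sq_le (by norm_num)
      nlinarith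
    have h4 : 4 / √t = 3 / √t + 1 / √t := by ring
    linarith

/-- The terms double until `t 2^j` reaches `1` and decay geometrically afterwards, so the sum is
bounded uniformly in `t` and `N`. -/
lemma sum_min_le (N : ℕ) {t : ℝ} (ht : 0 < t) :
    ∑ j ∈ Finset.range N, min (t * 2 ^ j) (1 / √(t * 2 ^ j)) ≤ 6 := by
  have big : ∀ s : ℝ, 1 ≤ s → ∀ M, ∑ j ∈ Finset.range M, min (s * 2 ^ j) (1 / √(s * 2 ^ j)) ≤ 4 := by
    intro s hs M
    refine (Finset.sum_le_sum fun j _ => min_le_right _ _).trans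
      ((sum_inv_sqrt_le M (by linarith)).trans ?_)
    have : 1 ≤ √s := Real.one_le_sqrt.2 hs
    exact div_le_self (by norm_num) this
  -- The bound `6 - s` is self-reproducing: removing the term `j = 0`, of size at most `s`, replaces
  -- `s` by `2 s`, and `s + (6 - 2 s) = 6 - s`. Once `2 s ≥ 1`, `s + 4 ≤ 6 - s` suffices.
  have small : ∀ M, ∀ s : ℝ, 0 < s → s ≤ 1 →
      ∑ j ∈ Finset.range M, min (s * 2 ^ j) (1 / √(s * 2 ^ j)) ≤ 6 - s := by
    intro M
    induction M with
    | zero => intro s _ hs; simp; linarith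
    | succ M ih =>
      intro s hs0 hs1
      rw [Finset.sum_range_succ']
      have h1 : ∀ j, s * 2 ^ (j + 1) = 2 * s * 2 ^ j := fun j => by ring
      simp only [h1, pow_zero, mul_one]
      have h2 := min_le_left s (1 / √s)
      rcases le_total (2 * s) 1 with h | h
      · have := ih (2 * s) (by positivity) h
        linarith
      · have := big (2 * s) h M
        linarith
  rcases le_total t 1 with h | h
  · linarith [small N t ht h]
  · linarith [big t h N]

end DyadicSum

/-! ### Littlewood–Paley families and their vector-valued kernels. -/

section Multiplier

lemma fourier_sub_apply (n : ℤ) (x y : UnitAddCircle) :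
    (fourier n (x - y) : ℂ) = fourier n x * fourier (-n) y := by
  have h : n • (x - y) = n • x + (-n) • y := by rw [zsmul_sub, neg_zsmul, sub_eq_add_neg]
  rw [fourier_apply, fourier_apply, fourier_apply, h, AddCircle.toCircle_add, Circle.coe_mul]

lemma integral_trigPoly_sub_mul (s : Finset ℤ) (c : ℤ → ℂ) {f : UnitAddCircle → ℂ}
    (hf : Integrable f) (x : UnitAddCircle) :
    ∫ y, trigPoly s c (x - y) * f y = trigPoly s (fun n => c n * fourierCoeff f n) x := by
  have h1 : ∀ y, trigPoly s c (x - y) * f y =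
      ∑ n ∈ s, (c n * fourier n x) * (fourier (-n) y • f y) := by
    intro y
    rw [trigPoly, Finset.sum_mul]
    refine Finset.sum_congr rfl fun n _ => ?_
    rw [fourier_sub_apply, smul_eq_mul]; ring
  simp only [h1]
  rw [volume_eq_haarAddCircle] at hf ⊢
  rw [integral_finsetSum]
  · refine Finset.sum_congr rfl fun n _ => ?_
    rw [integral_const_mul]
    change _ = (c n * ∫ t, fourier (-n) t • f t ∂AddCircle.haarAddCircle) * fourier n x
    ring
  · exact fun n _ => (hf.fourier_smul (-n)).const_mul _

lemma star_trigPoly (s : Finset ℤ) (c : ℤ → ℂ) (x : UnitAddCircle) :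
    starRingEnd ℂ (trigPoly s c x) = trigPoly s (fun n => starRingEnd ℂ (c n)) (-x) := by
  rw [trigPoly, trigPoly, map_sum]
  refine Finset.sum_congr rfl fun n _ => ?_
  have h := fourier_sub_apply n 0 x
  rw [zero_sub, fourier_eval_zero, one_mul] at h
  rw [map_mul, ← fourier_neg, h]

/-- A family of multipliers, the `j`-th one adapted to the frequencies `|n| ≈ 2^j`. -/
structure IsLPFamily (m : ℕ → ℤ → ℂ) (A : ℝ) : Prop where
  one_le : 1 ≤ A
  bound : ∀ j n, ‖m j n‖ ≤ A
  decay : ∀ j n, ‖m j n‖ * 2 ^ j ≤ A * (1 + |(n : ℝ)|)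
  supp : ∀ j (n : ℤ), A * 2 ^ j < |(n : ℝ)| → m j n = 0
  lip : ∀ j n, ‖m j (n + 1) - m j n‖ * 2 ^ j ≤ A

/-- The largest frequency on the support of the `j`-th multiplier. -/
noncomputable def cutoff (A : ℝ) (j : ℕ) : ℕ := ⌊A * 2 ^ j⌋₊

/-- The convolution kernel of the `j`-th multiplier. -/
noncomputable def lpKernel (m : ℕ → ℤ → ℂ) (A : ℝ) (j : ℕ) : UnitAddCircle → ℂ :=
  trigPoly (Finset.Icc (-(cutoff A j : ℤ)) (cutoff A j)) (m j)

namespace IsLPFamily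

variable {m : ℕ → ℤ → ℂ} {A : ℝ}

lemma A_pos (h : IsLPFamily m A) : 0 < A := by linarith [h.one_le]

lemma cutoff_le (h : IsLPFamily m A) (j : ℕ) : (cutoff A j : ℝ) ≤ A * 2 ^ j :=
  Nat.floor_le (by have := h.A_pos; positivity)

lemma supp_cutoff (h : IsLPFamily m A) (j : ℕ) (n : ℤ) (hn : (cutoff A j : ℤ) < |n|) :
    m j n = 0 := by
  refine h.supp j n ?_
  have h1 : cutoff A j < n.natAbs := by rw [Int.abs_eq_natAbs] at hn; exact_mod_cast hn
  have h2 := (Nat.floor_lt (by have := h.A_pos; positivity)).1 h1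
  rwa [Nat.cast_natAbs, Int.cast_abs] at h2

lemma isBump (h : IsLPFamily m A) (j : ℕ) : IsBump (m j) A A (2 ^ j) (cutoff A j) where
  A_pos := h.A_pos
  one_le_B := h.one_le
  one_le_D := one_le_pow₀ one_le_two
  L_le := h.cutoff_le j
  bound := h.bound j
  diff n := by rw [le_div_iff₀ (by positivity)]; exact h.lip j n
  supp n hn := h.supp_cutoff j n hn

/-- These are the coefficients of `k (x - y) - k x`. On the support `|n| ≤ A 2^j` one has
`|e^{-2πiny} - 1| ≲ A ρ 2^j`, which is the gain for small `ρ 2^j`; differences are handled by the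
discrete product rule. The numbers `6.3` and `20` are round bounds for `2π` and `6.3 + 12.6`. -/
lemma isBump_translate (h : IsLPFamily m A) (j : ℕ) {y : UnitAddCircle} {ρ : ℝ} (hρ : 0 < ρ)
    (hy : ‖y‖ ≤ ρ) : IsBump (fun n => m j n * ((fourier (-n) y : ℂ) - 1))
      (20 * A ^ 2 * (ρ * 2 ^ j)) A (2 ^ j) (cutoff A j) := by
  have hA := h.A_pos
  have hA1 := h.one_le
  have hpi : 2 * Real.pi ≤ 6.3 := by linarith [Real.pi_lt_d2]
  have hpi0 := Real.pi_pos
  have h2j : (1 : ℝ) ≤ 2 ^ j := one_le_pow₀ one_le_two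
  have hF : ∀ n : ℤ, ‖(fourier (-n) y : ℂ) - 1‖ ≤ 6.3 * |(n : ℝ)| * ρ := by
    intro n
    refine (norm_fourier_sub_one_le (-n) y).trans ?_
    rw [Int.cast_neg, abs_neg]
    gcongr
  refine ⟨by positivity, hA1, h2j, h.cutoff_le j, fun n => ?_, fun n => ?_, fun n hn => ?_⟩
  · rw [norm_mul]
    rcases lt_or_ge (A * 2 ^ j) |(n : ℝ)| with hn | hn
    · rw [h.supp j n hn, norm_zero, zero_mul]; positivity
    · calc _ ≤ A * (6.3 * (A * 2 ^ j) * ρ) := by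
            gcongr
            · exact h.bound j n
            · exact (hF n).trans (by gcongr)
        _ ≤ _ := by
            have : 0 ≤ A ^ 2 * (ρ * 2 ^ j) := by positivity
            linarith
  · have e : m j (n + 1) * ((fourier (-(n + 1)) y : ℂ) - 1) - m j n * ((fourier (-n) y : ℂ) - 1) =
        (m j (n + 1) - m j n) * ((fourier (-(n + 1)) y : ℂ) - 1) +
        m j n * ((fourier (-n) y : ℂ) * ((fourier (-1) y : ℂ) - 1)) := by
      rw [neg_add, fourier_add]; ring
    have hgoal : 20 * A ^ 2 * (ρ * 2 ^ j) / 2 ^ j = 20 * A ^ 2 * ρ := by field_simp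
    simp only [e, hgoal]
    have h1 : ‖m j n * ((fourier (-n) y : ℂ) * ((fourier (-1) y : ℂ) - 1))‖ ≤ A * (6.3 * ρ) := by
      rw [norm_mul, norm_mul]
      have hn1 : ‖(fourier (-n) y : ℂ)‖ = 1 := by rw [fourier_apply]; exact Circle.norm_coe _
      have hn2 := hF 1
      rw [Int.cast_one, abs_one, mul_one] at hn2
      rw [hn1, one_mul]
      gcongr
      exact h.bound j n
    have h2 : ‖(m j (n + 1) - m j n) * ((fourier (-(n + 1)) y : ℂ) - 1)‖ ≤ 12.6 * A ^ 2 * ρ := by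
      rw [norm_mul]
      by_cases hz : m j (n + 1) - m j n = 0
      · rw [hz, norm_zero, zero_mul]; positivity
      -- Otherwise both `n` and `n + 1` lie outside the support, as `A 2^j ≥ 1`, and the difference
      -- vanishes.
      · have hn : |((n + 1 : ℤ) : ℝ)| ≤ 2 * A * 2 ^ j := by
          by_contra! hcon
          have hA2 : 1 ≤ A * 2 ^ j := one_le_mul_of_one_le_of_one_le hA1 h2j
          have a1 : A * 2 ^ j < |((n + 1 : ℤ) : ℝ)| := by linarith
          have a2 : A * 2 ^ j < |(n : ℝ)| := by
            have := abs_add_le (n : ℝ) 1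
            rw [abs_one] at this
            push_cast at hcon
            linarith
          rw [h.supp j _ a1, h.supp j _ a2, sub_zero] at hz
          exact hz rfl
        have hl : ‖m j (n + 1) - m j n‖ ≤ A / 2 ^ j := by
          rw [le_div_iff₀ (by positivity)]; exact h.lip j n
        calc _ ≤ A / 2 ^ j * (6.3 * (2 * A * 2 ^ j) * ρ) := by
              gcongr
              exact (hF (n + 1)).trans (by gcongr)
          _ = _ := by field_simp; norm_num
    refine (norm_add_le _ _).trans ((add_le_add h2 h1).trans ?_)
    have : A * ρ ≤ A ^ 2 * ρ := by gcongr; nlinarith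
    have : 0 ≤ A ^ 2 * ρ := by positivity
    linarith
  · simp only [h.supp_cutoff j n hn, zero_mul]

/-- At low frequency (`ρ 2^j` small) the translated difference is a bump of size `ρ 2^j`. At high
frequency both terms are estimated separately by decay; removing the ball of radius `2ρ` still
leaves distance `ρ` after translation by `y`. -/
lemma lintegral_translate_le (h : IsLPFamily m A) (j : ℕ) {y : UnitAddCircle} {ρ : ℝ} (hρ : 0 < ρ)
    (hy : ‖y‖ ≤ ρ) : ∫⁻ x in {x | 2 * ρ < ‖x‖}, ‖lpKernel m A j (x - y) - lpKernel m A j x‖ₑ ≤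
      ENNReal.ofReal (20 * A ^ 2 * (10 + 4 * A) * min (ρ * 2 ^ j) (1 / √(ρ * 2 ^ j))) := by
  have hA := h.A_pos
  have hA1 := h.one_le
  rw [mul_min_of_nonneg _ _ (by positivity), ENNReal.ofReal_min, le_min_iff]
  constructor
  · have h1 : ∀ x, lpKernel m A j (x - y) - lpKernel m A j x =
        trigPoly (Finset.Icc (-(cutoff A j : ℤ)) (cutoff A j))
          (fun n => m j n * ((fourier (-n) y : ℂ) - 1)) x := by
      intro x
      rw [lpKernel, trigPoly, trigPoly, trigPoly, ← Finset.sum_sub_distrib]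
      refine Finset.sum_congr rfl fun n _ => ?_
      rw [fourier_sub_apply]; ring
    simp only [h1]
    refine (setLIntegral_le_lintegral _ _).trans
      ((h.isBump_translate j hρ hy).lintegral_le.trans_eq ?_)
    congr 1; ring
  · have hc : Continuous (lpKernel m A j) := continuous_trigPoly _ _
    have hms : MeasurableSet {x : UnitAddCircle | ρ < ‖x‖} :=
      (isOpen_lt continuous_const continuous_norm).measurableSet
    have hb := (h.isBump j).setLIntegral_off_ball_le hρ
    have hmp : MeasurePreserving (fun x : UnitAddCircle => x - y) volume volume :=
      measurePreserving_sub_right volume y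
    have h1 : ∫⁻ x in {x | 2 * ρ < ‖x‖}, ‖lpKernel m A j (x - y)‖ₑ ≤
        ∫⁻ x in {x | ρ < ‖x‖}, ‖lpKernel m A j x‖ₑ := by
      rw [← hmp.setLIntegral_comp_preimage hms hc.enorm.measurable]
      refine lintegral_mono_set fun x hx => ?_
      simp only [Set.mem_ofPred_eq, Set.mem_preimage] at hx ⊢
      linarith [norm_sub_norm_le x y]
    have h2 : ∫⁻ x in {x | 2 * ρ < ‖x‖}, ‖lpKernel m A j x‖ₑ ≤
        ∫⁻ x in {x | ρ < ‖x‖}, ‖lpKernel m A j x‖ₑ := by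
      refine lintegral_mono_set fun x hx => ?_
      simp only [Set.mem_ofPred_eq] at hx ⊢
      linarith
    calc _ ≤ ∫⁻ x in {x | 2 * ρ < ‖x‖}, (‖lpKernel m A j (x - y)‖ₑ + ‖lpKernel m A j x‖ₑ) :=
          lintegral_mono fun x => enorm_sub_le
      _ = (∫⁻ x in {x | 2 * ρ < ‖x‖}, ‖lpKernel m A j (x - y)‖ₑ) +
          ∫⁻ x in {x | 2 * ρ < ‖x‖}, ‖lpKernel m A j x‖ₑ :=
          lintegral_add_right _ hc.enorm.measurable
      _ ≤ ENNReal.ofReal ((8 + A) * A / √(ρ * 2 ^ j)) + ENNReal.ofReal ((8 + A) * A / √(ρ * 2 ^ j)) :=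
          add_le_add (h1.trans hb) (h2.trans hb)
      _ ≤ _ := by
          rw [← ENNReal.ofReal_add (by positivity) (by positivity)]
          refine ENNReal.ofReal_le_ofReal ?_
          have hs : 0 ≤ 1 / √(ρ * 2 ^ j) := by positivity
          have e : (8 + A) * A / √(ρ * 2 ^ j) + (8 + A) * A / √(ρ * 2 ^ j) =
              (2 * (8 + A) * A) * (1 / √(ρ * 2 ^ j)) := by ring
          rw [e]
          refine mul_le_mul_of_nonneg_right ?_ hs
          nlinarith [mul_pos hA hA, mul_pos (mul_pos hA hA) hA]

/-- With `u = 2^j / (1 + |n|)`, the support condition forces `u ≥ 1 / (2A)` and the decay condition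
gives `‖m_j(n)‖ u ≤ A`. The right side has the shape already used for Hörmander's condition, so
`sum_min_le` serves for both. -/
lemma norm_sq_le (h : IsLPFamily m A) (j : ℕ) (n : ℤ) :
    ‖m j n‖ ^ 2 ≤ 2 * A ^ 3 *
      min ((1 + |(n : ℝ)|)⁻¹ * 2 ^ j) (1 / √((1 + |(n : ℝ)|)⁻¹ * 2 ^ j)) := by
  have hA := h.A_pos
  have hA1 := h.one_le
  have h2j : (1 : ℝ) ≤ 2 ^ j := one_le_pow₀ one_le_two
  set w : ℝ := 1 + |(n : ℝ)| with hw
  have hw0 : 0 < w := by positivity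
  set u : ℝ := w⁻¹ * 2 ^ j with hu
  have hu0 : 0 < u := by positivity
  have hdec : ‖m j n‖ * u ≤ A := by
    have := h.decay j n
    rw [hu, ← mul_assoc, mul_comm _ w⁻¹, mul_assoc, inv_mul_le_iff₀ hw0, mul_comm w]
    exact this
  have hb := h.bound j n
  have hm0 := norm_nonneg (m j n)
  by_cases hz : m j n = 0
  · rw [hz, norm_zero, zero_pow two_ne_zero]; positivity
  have hn : |(n : ℝ)| ≤ A * 2 ^ j := by
    by_contra! hcon; exact hz (h.supp j n hcon)
  have hu1 : 1 ≤ 2 * A * u := by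
    have : w ≤ 2 * A * 2 ^ j := by nlinarith
    rw [hu, mul_comm w⁻¹, ← mul_assoc, ← div_eq_mul_inv, one_le_div hw0]
    exact this
  have hAA : ‖m j n‖ ^ 2 ≤ A ^ 2 := by gcongr
  rw [mul_min_of_nonneg _ _ (by positivity), le_min_iff]
  constructor
  · refine hAA.trans ?_
    nlinarith [mul_le_mul_of_nonneg_left hu1 (sq_nonneg A)]
  · have hs : 0 < √u := Real.sqrt_pos.2 hu0
    have hA23 : A ^ 2 ≤ A ^ 3 := pow_le_pow_right₀ hA1 (by norm_num)
    rw [mul_one_div, le_div_iff₀ hs]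
    rcases le_total u 1 with hle | hge
    · have : √u ≤ 1 := Real.sqrt_le_one.2 hle
      nlinarith [mul_le_mul hAA this hs.le (sq_nonneg A)]
    · have h1 : √u ≤ u ^ 2 := by
        rw [Real.sqrt_le_left (by positivity)]
        nlinarith [mul_self_nonneg (u - 1), mul_pos hu0 hu0, pow_le_pow_right₀ hge (show 1 ≤ 4 by norm_num)]
      calc ‖m j n‖ ^ 2 * √u ≤ ‖m j n‖ ^ 2 * u ^ 2 := by gcongr
        _ = (‖m j n‖ * u) ^ 2 := by ring
        _ ≤ A ^ 2 := by gcongr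
        _ ≤ 2 * A ^ 3 := by nlinarith

/-- The operator-valued kernel of `f ↦ (m_j(D) f)_{j < N}`. -/
noncomputable def vecKernel (m : ℕ → ℤ → ℂ) (A : ℝ) (N : ℕ) (x : UnitAddCircle) :
    ℂ →L[ℂ] EuclideanSpace ℂ (Fin N) :=
  ∑ j : Fin N, lpKernel m A j x •
    ContinuousLinearMap.toSpanSingleton ℂ (EuclideanSpace.single j (1 : ℂ))

lemma vecKernel_apply (m : ℕ → ℤ → ℂ) (A : ℝ) (N : ℕ) (x : UnitAddCircle) (z : ℂ) (j : Fin N) :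
    vecKernel m A N x z j = lpKernel m A j x * z := by
  simp [vecKernel, Finset.sum_apply, Pi.single_apply]

lemma continuous_vecKernel (m : ℕ → ℤ → ℂ) (A : ℝ) (N : ℕ) : Continuous (vecKernel m A N) := by
  unfold vecKernel
  exact continuous_finsetSum _ fun j _ => (continuous_trigPoly _ _).smul continuous_const

lemma conv_vecKernel_apply (m : ℕ → ℤ → ℂ) (A : ℝ) (N : ℕ) {f : UnitAddCircle → ℂ}
    (hf : Integrable f) (x : UnitAddCircle) (j : Fin N) :
    conv (vecKernel m A N) f x j = trigPoly (Finset.Icc (-(cutoff A j : ℤ)) (cutoff A j))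
      (fun n => m j n * fourierCoeff f n) x := by
  rw [← integral_trigPoly_sub_mul _ _ hf, conv]
  have h := ContinuousLinearMap.integral_comp_comm (EuclideanSpace.proj (𝕜 := ℂ) j)
    (integrable_conv_kernel (continuous_vecKernel m A N) hf x)
  simp only [EuclideanSpace.coe_proj] at h
  rw [← h]
  simp only [vecKernel_apply, lpKernel]

lemma enorm_sum_smul_sub_le {ι E : Type*} [Fintype ι] [NormedAddCommGroup E] [NormedSpace ℂ E]
    (a b : ι → ℂ) (v : ι → E) (hv : ∀ j, ‖v j‖ₑ = 1) :
    ‖∑ j, a j • v j - ∑ j, b j • v j‖ₑ ≤ ∑ j, ‖a j - b j‖ₑ := by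
  rw [← Finset.sum_sub_distrib]
  refine (enorm_sum_le (ε := E) Finset.univ _).trans_eq (Finset.sum_congr rfl fun j _ => ?_)
  rw [← sub_smul, enorm_smul, hv, mul_one]

/-- The cruder `ℓ¹` sum over `j` is already bounded independently of `N`; `120 = 20 · 6` with the
`6` of `sum_min_le`. -/
lemma isHormander_vecKernel (h : IsLPFamily m A) (N : ℕ) :
    IsHormander (vecKernel m A N) (120 * A ^ 2 * (10 + 4 * A)).toNNReal := by
  have hA := h.A_pos
  refine ⟨continuous_vecKernel m A N, fun ρ y hρ hy => ?_⟩
  have hc : ∀ j, Continuous (lpKernel m A j) := fun j => continuous_trigPoly _ _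
  calc _ ≤ ∫⁻ x in {x | 2 * ρ < ‖x‖}, ∑ j : Fin N, ‖lpKernel m A j (x - y) - lpKernel m A j x‖ₑ := by
        refine lintegral_mono fun x => ?_
        exact enorm_sum_smul_sub_le _ _ _ fun j => by
          rw [← ofReal_norm, ContinuousLinearMap.norm_toSpanSingleton]; simp
    _ = ∑ j : Fin N, ∫⁻ x in {x | 2 * ρ < ‖x‖}, ‖lpKernel m A j (x - y) - lpKernel m A j x‖ₑ := by
        refine lintegral_finsetSum _ fun j _ => ?_
        exact (((hc j).comp (continuous_id.sub continuous_const)).sub (hc j)).enorm.measurable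
    _ ≤ ∑ j : Fin N, ENNReal.ofReal
          (20 * A ^ 2 * (10 + 4 * A) * min (ρ * 2 ^ (j : ℕ)) (1 / √(ρ * 2 ^ (j : ℕ)))) :=
        Finset.sum_le_sum fun j _ => h.lintegral_translate_le j hρ hy
    _ = ENNReal.ofReal (20 * A ^ 2 * (10 + 4 * A) *
          ∑ j ∈ Finset.range N, min (ρ * 2 ^ j) (1 / √(ρ * 2 ^ j))) := by
        rw [Fin.sum_univ_eq_sum_range (fun j => ENNReal.ofReal
          (20 * A ^ 2 * (10 + 4 * A) * min (ρ * 2 ^ j) (1 / √(ρ * 2 ^ j)))) N,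
          ← ENNReal.ofReal_sum_of_nonneg fun j _ => by positivity, Finset.mul_sum]
    _ ≤ _ := by
        refine ENNReal.ofReal_le_ofReal ?_
        have := sum_min_le N hρ
        have h2 : 20 * A ^ 2 * (10 + 4 * A) * ∑ j ∈ Finset.range N, min (ρ * 2 ^ j) (1 / √(ρ * 2 ^ j))
            ≤ 20 * A ^ 2 * (10 + 4 * A) * 6 := by gcongr
        linarith

/-- By Parseval this reduces to `∑_j |m_j(n)|² ≤ 2 A³ · 6` for each `n`. -/
lemma boundedOn_vecKernel (h : IsLPFamily m A) (N : ℕ) :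
    BoundedOn (vecKernel m A N) 2 (12 * A ^ 3).toNNReal := by
  have hA := h.A_pos
  intro f hf
  simp only [ENNReal.rpow_two]
  rcases eq_or_ne (∫⁻ x, ‖f x‖ₑ ^ 2) ⊤ with htop | htop
  · rw [htop, ENNReal.mul_top]
    · exact le_top
    · simp; positivity
  have hfL : MemLp f 2 volume := by
    refine ⟨hf.aestronglyMeasurable, ?_⟩
    rw [eLpNorm_lt_top_iff_lintegral_rpow_enorm_lt_top (by simp) (by simp)]
    simpa using htop.lt_top
  have hnorm : ∀ x, ‖conv (vecKernel m A N) f x‖ₑ ^ 2 = ∑ j : Fin N,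
      ‖trigPoly (Finset.Icc (-(cutoff A j : ℤ)) (cutoff A j))
        (fun n => m j n * fourierCoeff f n) x‖ₑ ^ 2 := by
    intro x
    have hpow : ∀ {E : Type} [NormedAddCommGroup E] (z : E), ‖z‖ₑ ^ 2 = ENNReal.ofReal (‖z‖ ^ 2) :=
      fun z => by rw [← ofReal_norm, ENNReal.ofReal_pow (norm_nonneg _)]
    rw [hpow, EuclideanSpace.norm_sq_eq, ENNReal.ofReal_sum_of_nonneg fun j _ => by positivity]
    refine Finset.sum_congr rfl fun j _ => ?_
    rw [conv_vecKernel_apply m A N hf, hpow]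
  simp only [hnorm]
  rw [lintegral_finsetSum _ fun j _ => ((continuous_trigPoly _ _).enorm.measurable.pow_const 2),
    ← tsum_enorm_fourierCoeff_sq hfL, ← ENNReal.tsum_mul_left]
  calc _ ≤ ∑ j : Fin N, ∑' n, ‖m j n‖ₑ ^ 2 * ‖fourierCoeff f n‖ₑ ^ 2 := by
        refine Finset.sum_le_sum fun j _ => ?_
        rw [lintegral_enorm_trigPoly_sq]
        refine le_trans (Finset.sum_le_sum fun n _ => ?_) (ENNReal.sum_le_tsum _)
        rw [enorm_mul, mul_pow]
    _ = ∑' n, ∑ j : Fin N, ‖m j n‖ₑ ^ 2 * ‖fourierCoeff f n‖ₑ ^ 2 :=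
        (Summable.tsum_finsetSum fun _ _ => ENNReal.summable).symm
    _ ≤ _ := by
        refine ENNReal.tsum_le_tsum fun n => ?_
        rw [← Finset.sum_mul]
        gcongr
        calc ∑ j : Fin N, ‖m j n‖ₑ ^ 2 = ENNReal.ofReal (∑ j ∈ Finset.range N, ‖m j n‖ ^ 2) := by
              rw [Fin.sum_univ_eq_sum_range (fun j => ‖m j n‖ₑ ^ 2) N,
                ENNReal.ofReal_sum_of_nonneg fun j _ => by positivity]
              refine Finset.sum_congr rfl fun j _ => ?_
              rw [← ofReal_norm, ENNReal.ofReal_pow (norm_nonneg _)]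
          _ ≤ _ := by
              refine ENNReal.ofReal_le_ofReal ?_
              refine (Finset.sum_le_sum fun j _ => h.norm_sq_le j n).trans ?_
              rw [← Finset.mul_sum]
              have := sum_min_le N (t := (1 + |(n : ℝ)|)⁻¹) (by positivity)
              have h2 : 2 * A ^ 3 * ∑ j ∈ Finset.range N, min ((1 + |(n : ℝ)|)⁻¹ * 2 ^ j)
                  (1 / √((1 + |(n : ℝ)|)⁻¹ * 2 ^ j)) ≤ 2 * A ^ 3 * 6 := by gcongr
              linarith

end IsLPFamily

end Multiplier

/-! ### Dyadic symbols and the reproducing family. -/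

section Symbols

/-- The dyadic symbols generated by `φ` with dilation ratio `M`. -/
noncomputable def dyadicSymbol (φ : ℝ → ℂ) (M : ℝ) : ℕ → ℤ → ℂ
  | 0, n => φ n
  | j + 1, n => φ (n / 2 ^ (j + 1)) - φ (M * n / 2 ^ (j + 1))

lemma symbol_eq_dyadicSymbol (ψ : ℝ → ℂ) (j : ℕ) (n : ℤ) :
    symbol ψ j (n : ℝ) = dyadicSymbol ψ 2 j n := by
  cases j with
  | zero => rfl
  | succ j =>
    have : 2 * (n : ℝ) / 2 ^ (j + 1) = n / 2 ^ j := by rw [pow_succ]; field_simp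
    rw [symbol, dyadicSymbol, this]

/-- Boundedness, a Lipschitz bound and bounded support suffice, so the piecewise linear `tent` is
admissible too. Low-frequency decay comes from comparing the two dilated values, whose arguments
differ by `(M - 1) |n| / 2^{j+1}`. -/
lemma isLPFamily_dyadicSymbol {φ : ℝ → ℂ} {M C L R : ℝ} (hM : 1 ≤ M) (hR : 0 ≤ R)
    (hC : ∀ ξ, ‖φ ξ‖ ≤ C) (hL : ∀ ξ η, ‖φ ξ - φ η‖ ≤ L * |ξ - η|)
    (hsupp : ∀ ξ, R < |ξ| → φ ξ = 0) {A : ℝ} (hA : 1 + 2 * C + R + 2 * M * L ≤ A) :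
    IsLPFamily (dyadicSymbol φ M) A := by
  have hC0 : 0 ≤ C := (norm_nonneg _).trans (hC 0)
  have hL0 : 0 ≤ L := by
    have := (norm_nonneg _).trans (hL 1 0)
    simpa using this
  have hML0 : 0 ≤ M * L := by positivity
  have hLML : L ≤ M * L := le_mul_of_one_le_left hL0 hM
  have hA1 : 1 ≤ A := by linarith
  refine ⟨hA1, ?_, ?_, ?_, ?_⟩
  · rintro (_ | j) n
    · exact (hC _).trans (by linarith)
    · exact (norm_sub_le _ _).trans ((add_le_add (hC _) (hC _)).trans (by linarith))
  · rintro (_ | j) n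
    · rw [pow_zero, mul_one]
      refine (hC _).trans ?_
      have : A * 1 ≤ A * (1 + |(n : ℝ)|) := by gcongr; linarith [abs_nonneg (n : ℝ)]
      linarith
    · have h2 : (0 : ℝ) < 2 ^ (j + 1) := by positivity
      calc _ ≤ L * |(n : ℝ) / 2 ^ (j + 1) - M * n / 2 ^ (j + 1)| * 2 ^ (j + 1) := by
            gcongr; exact hL _ _
        _ = L * ((M - 1) * |(n : ℝ)|) := by
            rw [← sub_div, abs_div, abs_of_pos h2, mul_assoc, div_mul_cancel₀ _ h2.ne',
              show (n : ℝ) - M * n = -((M - 1) * n) by ring, abs_neg, abs_mul,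
              abs_of_nonneg (by linarith : 0 ≤ M - 1)]
        _ = (M * L - L) * |(n : ℝ)| := by ring
        _ ≤ A * (1 + |(n : ℝ)|) := by
            gcongr
            · linarith
            · linarith
  · rintro (_ | j) n hn
    · rw [pow_zero, mul_one] at hn
      exact hsupp _ (by linarith)
    · have h2 : (0 : ℝ) < 2 ^ (j + 1) := by positivity
      have h1 : R < |(n : ℝ)| / 2 ^ (j + 1) := by
        rw [lt_div_iff₀ h2]
        refine lt_of_le_of_lt ?_ hn
        gcongr
        linarith
      have h3 : |(n : ℝ) / 2 ^ (j + 1)| = |(n : ℝ)| / 2 ^ (j + 1) := by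
        rw [abs_div, abs_of_pos h2]
      have h4 : |M * (n : ℝ) / 2 ^ (j + 1)| = M * (|(n : ℝ)| / 2 ^ (j + 1)) := by
        rw [mul_div_assoc, abs_mul, h3, abs_of_nonneg (by linarith)]
      rw [dyadicSymbol, hsupp _ (h3 ▸ h1), hsupp, sub_zero]
      rw [h4]
      exact h1.trans_le (le_mul_of_one_le_left (by positivity) hM)
  · rintro (_ | j) n
    · rw [pow_zero, mul_one]
      refine (hL _ _).trans ?_
      push_cast
      rw [add_sub_cancel_left, abs_one]
      linarith
    · have h2 : (0 : ℝ) < 2 ^ (j + 1) := by positivity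
      have e : dyadicSymbol φ M (j + 1) (n + 1) - dyadicSymbol φ M (j + 1) n =
          (φ ((n + 1 : ℤ) / 2 ^ (j + 1)) - φ (n / 2 ^ (j + 1))) -
          (φ (M * (n + 1 : ℤ) / 2 ^ (j + 1)) - φ (M * n / 2 ^ (j + 1))) := by
        simp only [dyadicSymbol]; ring
      have h3 : ‖φ ((n + 1 : ℤ) / 2 ^ (j + 1)) - φ (n / 2 ^ (j + 1))‖ ≤ L / 2 ^ (j + 1) := by
        refine (hL _ _).trans_eq ?_
        push_cast
        rw [← sub_div, add_sub_cancel_left, abs_of_pos (by positivity), mul_one_div]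
      have h4 : ‖φ (M * (n + 1 : ℤ) / 2 ^ (j + 1)) - φ (M * n / 2 ^ (j + 1))‖ ≤
          M * L / 2 ^ (j + 1) := by
        refine (hL _ _).trans_eq ?_
        push_cast
        rw [← sub_div, ← mul_sub, add_sub_cancel_left, mul_one, abs_of_pos (by positivity)]
        ring
      rw [e, ← le_div_iff₀ h2]
      refine (norm_sub_le _ _).trans ((add_le_add h3 h4).trans ?_)
      rw [← add_div]
      gcongr
      linarith

lemma sum_symbol (ψ : ℝ → ℂ) (N : ℕ) (ξ : ℝ) :
    ∑ j ∈ Finset.range (N + 1), symbol ψ j ξ = ψ (ξ / 2 ^ N) := by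
  induction N with
  | zero => simp [symbol]
  | succ N ih => rw [Finset.sum_range_succ, ih, symbol]; ring

/-- A piecewise linear cutoff function, equal to `1` on `[-R, R]` and to `0` off `[-2R, 2R]`. -/
noncomputable def tent (R : ℝ) (ξ : ℝ) : ℝ := max 0 (min 1 (2 - |ξ| / R))

lemma tent_eq_one {R ξ : ℝ} (hR : 0 < R) (h : |ξ| ≤ R) : tent R ξ = 1 := by
  have : |ξ| / R ≤ 1 := (div_le_one hR).2 h
  rw [tent, min_eq_left (by linarith), max_eq_right zero_le_one]

lemma tent_eq_zero {R ξ : ℝ} (hR : 0 < R) (h : 2 * R ≤ |ξ|) : tent R ξ = 0 := by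
  have : 2 ≤ |ξ| / R := (le_div_iff₀ hR).2 h
  rw [tent, max_eq_left]
  exact (min_le_right _ _).trans (by linarith)

lemma abs_tent_le (R ξ : ℝ) : |tent R ξ| ≤ 1 := by
  rw [tent, abs_of_nonneg (le_max_left _ _)]
  exact max_le zero_le_one (min_le_left _ _)

lemma abs_tent_sub_le {R : ℝ} (hR : 1 ≤ R) (ξ η : ℝ) : |tent R ξ - tent R η| ≤ 1 * |ξ - η| := by
  have h1 : |tent R ξ - tent R η| ≤ |(2 - |ξ| / R) - (2 - |η| / R)| := by
    unfold tent
    refine (abs_max_sub_max_le_max _ _ _ _).trans ?_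
    rw [sub_self, abs_zero, max_eq_right (abs_nonneg _)]
    refine (abs_min_sub_min_le_max _ _ _ _).trans ?_
    rw [sub_self, abs_zero, max_eq_right (abs_nonneg _)]
  refine h1.trans ?_
  rw [show (2 - |ξ| / R) - (2 - |η| / R) = (|η| - |ξ|) / R by ring, abs_div,
    abs_of_pos (by linarith : 0 < R), one_mul]
  refine (div_le_self (abs_nonneg _) hR).trans ?_
  rw [abs_sub_comm]
  exact abs_abs_sub_abs_le _ _

/-- Multipliers reproducing the frequency pieces cut out by a dyadic resolution. -/
lemma exists_reproducing_family {ψ : ℝ → ℂ} {R δ : ℝ} (hR : 1 ≤ R) (hδ : 0 < δ)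
    (hsupp : ∀ ξ, R < |ξ| → ψ ξ = 0) (hone : ∀ ξ, |ξ| < δ → ψ ξ = 1) :
    ∃ (θ : ℕ → ℤ → ℂ) (A : ℝ), (∀ A', A ≤ A' → IsLPFamily θ A') ∧
      (∀ j n, starRingEnd ℂ (θ j n) = θ j n) ∧
      ∀ j n, θ j n * dyadicSymbol ψ 2 j n = dyadicSymbol ψ 2 j n := by
  have hR0 : 0 < R := by linarith
  -- With `t = |n| / 2^{j+1}`, the symbol `ψ_{j+1}` vanishes for `t > R` (both values are `0`) and
  -- for `2 t < δ` (both are `1`). In the remaining range `tent` is `1` at `t`, while `M t ≥ 2R`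
  -- makes it `0` at `M t`, so the reproducing multiplier is `1`.
  set M : ℝ := 1 + 4 * R / δ with hM
  have hM1 : 1 ≤ M := by rw [hM]; linarith [show 0 < 4 * R / δ by positivity]
  set φ : ℝ → ℂ := fun ξ => (tent R ξ : ℂ) with hφ
  refine ⟨dyadicSymbol φ M, 1 + 2 * 1 + 2 * R + 2 * M * 1, fun A' hA' => ?_, ?_, ?_⟩
  · refine isLPFamily_dyadicSymbol hM1 (by positivity) (fun ξ => ?_) (fun ξ η => ?_)
      (fun ξ hξ => ?_) hA'
    · rw [hφ, Complex.norm_real]; exact abs_tent_le R ξ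
    · simp only [hφ]
      rw [← Complex.ofReal_sub, Complex.norm_real]; exact abs_tent_sub_le hR ξ η
    · simp only [hφ]
      rw [tent_eq_zero hR0 hξ.le, Complex.ofReal_zero]
  · rintro (_ | j) n <;> simp [dyadicSymbol, hφ]
  · rintro (_ | j) n
    · rcases le_or_gt |(n : ℝ)| R with h | h
      · simp only [dyadicSymbol, hφ]
        rw [tent_eq_one hR0 h, Complex.ofReal_one, one_mul]
      · simp only [dyadicSymbol]
        rw [hsupp _ h, mul_zero]
    · have h2 : (0 : ℝ) < 2 ^ (j + 1) := by positivity
      have h3 : |(n : ℝ) / 2 ^ (j + 1)| = |(n : ℝ)| / 2 ^ (j + 1) := by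
        rw [abs_div, abs_of_pos h2]
      have hmul : ∀ c : ℝ, 0 ≤ c →
          |c * (n : ℝ) / 2 ^ (j + 1)| = c * (|(n : ℝ)| / 2 ^ (j + 1)) := by
        intro c hc
        rw [mul_div_assoc, abs_mul, h3, abs_of_nonneg hc]
      set t : ℝ := |(n : ℝ)| / 2 ^ (j + 1) with ht
      have ht0 : 0 ≤ t := by positivity
      rcases le_or_gt t R with h | h
      · rcases lt_or_ge (2 * t) δ with h' | h'
        · have e : dyadicSymbol ψ 2 (j + 1) n = 0 := by
            rw [dyadicSymbol, hone _ (by rw [h3]; linarith), hone _ (by rw [hmul 2 two_pos.le]; exact h'),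
              sub_self]
          rw [e, mul_zero]
        · have e : dyadicSymbol φ M (j + 1) n = 1 := by
            simp only [dyadicSymbol, hφ]
            rw [tent_eq_one hR0 (by rw [h3]; exact h), tent_eq_zero hR0, Complex.ofReal_one,
              Complex.ofReal_zero, sub_zero]
            rw [hmul M (by linarith), hM]
            have : 4 * R / δ * t = 2 * R * (2 * t / δ) := by ring
            have h5 : 1 ≤ 2 * t / δ := (one_le_div hδ).2 h'
            nlinarith
          rw [e, one_mul]
      · have e : dyadicSymbol ψ 2 (j + 1) n = 0 := by
          rw [dyadicSymbol, hsupp _ (by rw [h3]; exact h),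
            hsupp _ (by rw [hmul 2 two_pos.le]; linarith), sub_self]
        rw [e, mul_zero]

end Symbols

/-! ### Smooth truncations of Fourier series in `L¹`. -/

section Approximation

/-- Density of the trigonometric polynomials in `L¹`. -/
lemma exists_trigPoly_lintegral_sub_le {f : UnitAddCircle → ℂ} (hf : Integrable f) {ε : ℝ≥0∞}
    (hε : ε ≠ 0) : ∃ (s : Finset ℤ) (c : ℤ → ℂ), ∫⁻ x, ‖f x - trigPoly s c x‖ₑ < ε := by
  have hf1 : MemLp f 1 (AddCircle.haarAddCircle (T := 1)) := by
    rw [← volume_eq_haarAddCircle]; exact memLp_one_iff_integrable.2 hf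
  have hmem : hf1.toLp f ∈ (Submodule.span ℂ (Set.range (@fourierLp 1 _ 1 _))).topologicalClosure := by
    rw [span_fourierLp_closure_eq_top (by simp)]; trivial
  rw [← SetLike.mem_coe, Submodule.topologicalClosure_coe, EMetric.mem_closure_iff] at hmem
  obtain ⟨p, hp, hlt⟩ := hmem ε (pos_iff_ne_zero.2 hε)
  obtain ⟨c, rfl⟩ := Finsupp.mem_span_range_iff_exists_finsupp.1 hp
  refine ⟨c.support, c, ?_⟩
  rw [Lp.edist_def, eLpNorm_one_eq_lintegral_enorm] at hlt
  refine lt_of_le_of_lt (le_of_eq ?_) hlt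
  rw [volume_eq_haarAddCircle]
  refine lintegral_congr_ae ?_
  have h1 : ∀ᵐ x ∂(AddCircle.haarAddCircle (T := 1)),
      (c.sum fun i a => a • fourierLp (T := 1) 1 i : Lp ℂ 1 AddCircle.haarAddCircle) x =
        trigPoly c.support c x := by
    have h2 := Lp.coeFn_finsetSum (p := 1) (μ := AddCircle.haarAddCircle (T := 1)) c.support
      (fun i => c i • fourierLp (T := 1) 1 i)
    have h3 : ∀ᵐ x ∂(AddCircle.haarAddCircle (T := 1)), ∀ i : ℤ,
        (c i • fourierLp (T := 1) 1 i : Lp ℂ 1 AddCircle.haarAddCircle) x = c i * fourier i x := by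
      rw [ae_all_iff]
      intro i
      filter_upwards [Lp.coeFn_smul (c i) (fourierLp (T := 1) 1 i), coeFn_fourierLp (T := 1) 1 i]
        with x hx1 hx2
      rw [hx1, Pi.smul_apply, hx2, smul_eq_mul]
    filter_upwards [h2, h3] with x hx2 hx3
    rw [Finsupp.sum, hx2, Finset.sum_apply, trigPoly]
    exact Finset.sum_congr rfl fun i _ => hx3 i
  filter_upwards [hf1.coeFn_toLp, h1] with x hx1 hx2
  rw [Pi.sub_apply, hx1, hx2]

lemma lintegral_convolution_le {k f : UnitAddCircle → ℂ} (hk : Continuous k) (hf : Integrable f) :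
    ∫⁻ x, ‖∫ y, k (x - y) * f y‖ₑ ≤ (∫⁻ x, ‖k x‖ₑ) * ∫⁻ y, ‖f y‖ₑ := by
  have hkc : Continuous fun p : UnitAddCircle × UnitAddCircle => k (p.1 - p.2) := by fun_prop
  calc _ ≤ ∫⁻ x, ∫⁻ y, ‖k (x - y)‖ₑ * ‖f y‖ₑ := by
        refine lintegral_mono fun x => (enorm_integral_le_lintegral_enorm _).trans_eq ?_
        simp only [enorm_mul]
    _ = ∫⁻ y, ∫⁻ x, ‖k (x - y)‖ₑ * ‖f y‖ₑ :=
        lintegral_lintegral_swap (hkc.enorm.aemeasurable.mul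
          hf.aestronglyMeasurable.enorm.comp_snd)
    _ = ∫⁻ y, (∫⁻ x, ‖k x‖ₑ) * ‖f y‖ₑ := by
        refine lintegral_congr fun y => ?_
        have hc : Continuous fun x => k (x - y) := by fun_prop
        rw [lintegral_mul_const _ hc.enorm.measurable,
          lintegral_sub_right_eq_self (fun x => ‖k x‖ₑ) y]
    _ = _ := lintegral_const_mul'' _ hf.aestronglyMeasurable.enorm

/-- Convergence in `L¹` of the smooth truncations of a Fourier series. -/
lemma tendsto_lintegral_truncation_sub {ψ : ℝ → ℂ} {A L : ℝ} (hA : 1 ≤ A)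
    (hC : ∀ ξ, ‖ψ ξ‖ ≤ A) (hL : ∀ ξ η, ‖ψ ξ - ψ η‖ ≤ L * |ξ - η|) (hLA : L ≤ A)
    (hsupp : ∀ ξ, A < |ξ| → ψ ξ = 0) (hone : ∀ᶠ ξ in 𝓝 (0 : ℝ), ψ ξ = 1)
    {f : UnitAddCircle → ℂ} (hf : Integrable f) :
    Tendsto (fun N => ∫⁻ x, ‖trigPoly (Finset.Icc (-(cutoff A N : ℤ)) (cutoff A N))
      (fun n => ψ (n / 2 ^ N) * fourierCoeff f n) x - f x‖ₑ) atTop (𝓝 0) := by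
  have hA0 : 0 < A := by linarith
  set s : ℕ → Finset ℤ := fun N => Finset.Icc (-(cutoff A N : ℤ)) (cutoff A N) with hs
  set T : ℕ → (UnitAddCircle → ℂ) → UnitAddCircle → ℂ := fun N g x =>
    ∫ y, trigPoly (s N) (fun n => ψ (n / 2 ^ N)) (x - y) * g y with hT
  have hTf : ∀ N x, trigPoly (s N) (fun n => ψ (n / 2 ^ N) * fourierCoeff f n) x = T N f x :=
    fun N x => (integral_trigPoly_sub_mul _ _ hf x).symm
  have hbump : ∀ N, IsBump (fun n : ℤ => ψ (n / 2 ^ N)) A A (2 ^ N) (cutoff A N) := by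
    intro N
    have h2 : (0 : ℝ) < 2 ^ N := by positivity
    have hfl : (cutoff A N : ℝ) ≤ A * 2 ^ N := Nat.floor_le (by positivity)
    refine ⟨hA0, hA, one_le_pow₀ one_le_two, hfl, fun n => hC _, fun n => ?_, fun n hn => ?_⟩
    · refine (hL _ _).trans ?_
      push_cast
      rw [← sub_div, add_sub_cancel_left, abs_of_pos (by positivity), mul_one_div]
      gcongr
    · refine hsupp _ ?_
      rw [abs_div, abs_of_pos h2, lt_div_iff₀ h2]
      have h1 : cutoff A N < n.natAbs := by rw [Int.abs_eq_natAbs] at hn; exact_mod_cast hn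
      have h3 := (Nat.floor_lt (by positivity)).1 h1
      rwa [Nat.cast_natAbs, Int.cast_abs] at h3
  -- The truncation kernels are bumps at scale `2^N`, so they act on `L¹` with a norm independent of
  -- `N`; convergence then needs checking only on a dense class.
  set B : ℝ≥0∞ := ENNReal.ofReal ((10 + 4 * A) * A) with hB
  have hTb : ∀ N g, Integrable g → ∫⁻ x, ‖T N g x‖ₑ ≤ B * ∫⁻ x, ‖g x‖ₑ := by
    intro N g hg
    refine (lintegral_convolution_le (continuous_trigPoly _ _) hg).trans ?_
    gcongr
    exact (hbump N).lintegral_le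
  rw [ENNReal.tendsto_atTop_zero]
  intro ε hε
  have hB1 : B + 1 ≠ ⊤ := by finiteness
  obtain ⟨S, c, hSc⟩ := exists_trigPoly_lintegral_sub_le hf (ε := ε / (B + 1))
    (ENNReal.div_pos hε.ne' hB1).ne'
  set P := trigPoly S c with hP
  have hPi : Integrable P := integrable_of_continuous (continuous_trigPoly S c)
  -- On a fixed trigonometric polynomial the truncation is eventually the identity, because `ψ = 1`
  -- near `0`.
  have hev : ∀ᶠ N in atTop, ∀ n ∈ S, ψ (n / 2 ^ N) = 1 := by
    rw [eventually_all_finset]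
    intro n _
    have hlim : Tendsto (fun N : ℕ => (n : ℝ) / 2 ^ N) atTop (𝓝 0) :=
      tendsto_const_nhds.div_atTop (tendsto_pow_atTop_atTop_of_one_lt one_lt_two)
    exact hlim.eventually hone
  obtain ⟨N₀, hN₀⟩ := eventually_atTop.1 hev
  refine ⟨N₀, fun N hN => ?_⟩
  have hTP : ∀ x, T N P x = P x := by
    intro x
    rw [hT]
    simp only
    rw [integral_trigPoly_sub_mul _ _ hPi, hP, trigPoly, trigPoly]
    have hSs : S ⊆ s N := by
      intro n hn
      by_contra hcon
      have h0 : ψ (n / 2 ^ N) = 0 := by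
        refine (hbump N).supp n ?_
        rw [hs, Finset.mem_Icc, ← abs_le] at hcon
        exact not_le.1 hcon
      have h1 := hN₀ N hN n hn
      rw [h0] at h1
      exact zero_ne_one h1
    symm
    rw [← Finset.sum_subset hSs]
    · refine Finset.sum_congr rfl fun n hn => ?_
      rw [fourierCoeff_trigPoly, if_pos hn, hN₀ N hN n hn, one_mul]
    · intro n _ hn
      rw [fourierCoeff_trigPoly, if_neg hn, mul_zero, zero_mul]
  have hsub : ∀ x, T N f x - P x = T N (fun y => f y - P y) x := by
    intro x
    rw [← hTP x]
    simp only [hT, mul_sub]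
    have hInt : ∀ g : UnitAddCircle → ℂ, Integrable g →
        Integrable fun y => trigPoly (s N) (fun n => ψ (n / 2 ^ N)) (x - y) * g y := by
      intro g hg
      have hc : Continuous fun y => trigPoly (s N) (fun n => ψ (n / 2 ^ N)) (x - y) :=
        (continuous_trigPoly _ _).comp (continuous_const.sub continuous_id)
      obtain ⟨D, hD⟩ := exists_norm_le_of_continuous hc
      exact hg.bdd_mul hc.aestronglyMeasurable (Eventually.of_forall hD)
    exact (integral_sub (hInt f hf) (hInt P hPi)).symm
  calc _ = ∫⁻ x, ‖(T N f x - P x) - (f x - P x)‖ₑ := by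
        refine lintegral_congr fun x => ?_
        rw [hTf, sub_sub_sub_cancel_right]
    _ ≤ ∫⁻ x, (‖T N f x - P x‖ₑ + ‖f x - P x‖ₑ) := lintegral_mono fun x => enorm_sub_le
    _ = (∫⁻ x, ‖T N f x - P x‖ₑ) + ∫⁻ x, ‖f x - P x‖ₑ :=
        lintegral_add_right' _ (hf.sub hPi).aestronglyMeasurable.enorm
    _ ≤ B * (∫⁻ x, ‖f x - P x‖ₑ) + ∫⁻ x, ‖f x - P x‖ₑ := by
        gcongr
        simp only [hsub]
        exact hTb N _ (hf.sub hPi)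
    _ = (B + 1) * ∫⁻ x, ‖f x - P x‖ₑ := by rw [add_mul, one_mul]
    _ ≤ (B + 1) * (ε / (B + 1)) := by gcongr
    _ ≤ ε := ENNReal.mul_div_le

end Approximation

/-! ### Young functions, modulars and the Luxemburg norm. -/

section Orlicz

variable {Φ : ℝ≥0 → ℝ≥0∞}

lemma IsYoung.mul_le (h : IsYoung Φ) {a : ℝ≥0} (ha : a ≤ 1) (u : ℝ≥0) :
    Φ (a * u) ≤ a * Φ u := by
  have h1 := h.convex.2 (Set.mem_univ u) (Set.mem_univ 0) (zero_le (a := a))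
    (zero_le (a := 1 - a)) (add_tsub_cancel_of_le ha)
  simpa [h.map_zero, ENNReal.smul_def] using h1

lemma IsYoung.le_div_mul (h : IsYoung Φ) {u v : ℝ≥0} (huv : u ≤ v) (hv : 0 < v) :
    Φ u ≤ (u / v : ℝ≥0) * Φ v := by
  have := h.mul_le (a := u / v) (div_le_one_of_le₀ huv zero_le) v
  rwa [div_mul_cancel₀ _ hv.ne'] at this

lemma IsYoung.mono (h : IsYoung Φ) : Monotone Φ := by
  intro u v huv
  rcases eq_or_ne v 0 with rfl | hv
  · rw [le_zero_iff.1 huv]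
  · have hle : u / v ≤ 1 := div_le_one_of_le₀ huv zero_le
    calc Φ u ≤ (u / v : ℝ≥0) * Φ v := h.le_div_mul huv (pos_iff_ne_zero.2 hv)
      _ ≤ 1 * Φ v := by gcongr; exact_mod_cast hle
      _ = Φ v := one_mul _

/-- Convexity with `Φ 0 = 0` makes `Φ u / u` nondecreasing. The `1` in the maximum keeps the common
threshold positive. -/
lemma IsYoung.exists_growth (h : IsYoung Φ) (hΔ : DeltaTwo Φ) (hN : NablaTwo Φ) :
    ∃ u₀ K₁ K₂, Growth Φ u₀ K₁ K₂ := by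
  obtain ⟨K₁, -, u₁, h₁⟩ := hΔ
  obtain ⟨K₂, hK₂, u₂, h₂⟩ := hN
  refine ⟨max 1 (max u₁ u₂), K₁, K₂, h.mono, fun u v huv => ?_, by positivity,
    fun u hu => h₁ u ?_, hK₂, fun u hu => h₂ u ?_⟩
  · rcases eq_or_ne v 0 with rfl | hv
    · simp
    · calc Φ u * v ≤ (u / v : ℝ≥0) * Φ v * v := by
            gcongr; exact h.le_div_mul huv (pos_iff_ne_zero.2 hv)
        _ = Φ v * ((u / v * v : ℝ≥0) : ℝ≥0∞) := by rw [ENNReal.coe_mul]; ring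
        _ = _ := by rw [div_mul_cancel₀ _ hv]
  · exact ((le_max_left _ _).trans (le_max_right _ _)).trans hu
  · exact ((le_max_right _ _).trans (le_max_right _ _)).trans hu

lemma extend_coe (Φ : ℝ≥0 → ℝ≥0∞) (u : ℝ≥0) : extend Φ u = Φ u := by
  simp [extend]

lemma IsYoung.extend_mono (h : IsYoung Φ) : Monotone (extend Φ) := by
  intro s t hst
  induction t with
  | top => simp [extend]
  | coe t =>
    lift s to ℝ≥0 using ne_top_of_le_ne_top ENNReal.coe_ne_top hst
    rw [extend_coe, extend_coe]
    exact h.mono (by exact_mod_cast hst)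

/-- Continuity at `∞` is the divergence of `Φ`. It is needed because the square function may be
infinite at some points. -/
lemma IsNiceYoung.continuous_extend (h : IsNiceYoung Φ) : Continuous (extend Φ) := by
  rw [continuous_iff_continuousAt]
  intro t
  induction t with
  | coe t =>
    rw [ContinuousAt, ENNReal.nhds_coe, tendsto_map'_iff, extend_coe]
    refine (h.continuous.tendsto t).congr fun u => ?_
    exact (extend_coe Φ u).symm
  | top =>
    have htop : extend Φ ⊤ = ⊤ := by simp [extend]
    rw [ContinuousAt, htop, ENNReal.tendsto_nhds_top_iff_nnreal]
    intro x
    obtain ⟨u, hu⟩ := ((ENNReal.tendsto_nhds_top_iff_nnreal.1 h.tendsto_top) x).exists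
    filter_upwards [lt_mem_nhds (ENNReal.coe_lt_top (r := u))] with s hs
    refine lt_of_lt_of_le hu ?_
    rw [← extend_coe Φ u]
    exact h.toIsYoung.extend_mono hs.le

/-- Fatou's lemma for modulars, the passage from truncations to limits in both halves of the
theorem. -/
lemma IsNiceYoung.lintegral_extend_le_of_tendsto (h : IsNiceYoung Φ) {k : ℝ≥0} (hk : 0 < k)
    {G : ℕ → UnitAddCircle → ℝ≥0∞} {F : UnitAddCircle → ℝ≥0∞} (hG : ∀ n, Measurable (G n))
    (hlim : ∀ᵐ x, Tendsto (fun n => G n x) atTop (𝓝 (F x))) {M : ℝ≥0∞}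
    (hM : ∀ n, ∫⁻ x, extend Φ (G n x / k) ≤ M) : ∫⁻ x, extend Φ (F x / k) ≤ M := by
  calc ∫⁻ x, extend Φ (F x / k) = ∫⁻ x, liminf (fun n => extend Φ (G n x / k)) atTop := by
        refine lintegral_congr_ae ?_
        filter_upwards [hlim] with x hx
        refine (Tendsto.liminf_eq ?_).symm
        exact (h.continuous_extend.tendsto _).comp
          (ENNReal.Tendsto.div_const hx (Or.inr (by simpa using hk.ne')))
    _ ≤ liminf (fun n => ∫⁻ x, extend Φ (G n x / k)) atTop :=
        lintegral_liminf_le fun n => h.continuous_extend.measurable.comp ((hG n).div_const _)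
    _ ≤ M := liminf_le_of_frequently_le' (Frequently.of_forall hM)

/-- A modular bound turns into a bound for the rescaled modular by convexity. -/
lemma IsYoung.lintegral_extend_div_le (h : IsYoung Φ) {E : Type*} [NormedAddCommGroup E]
    {F : UnitAddCircle → E} {M : ℝ≥0} (hF : ∫⁻ x, Φ ‖F x‖₊ ≤ M) :
    ∫⁻ x, extend Φ (‖F x‖ₑ / ((M + 1 : ℝ≥0) : ℝ≥0∞)) ≤ 1 := by
  have hM : (M + 1 : ℝ≥0) ≠ 0 := by positivity
  have hle : (M + 1 : ℝ≥0)⁻¹ ≤ 1 := inv_le_one_of_one_le₀ le_add_self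
  calc _ ≤ ∫⁻ x, ((M + 1 : ℝ≥0)⁻¹ : ℝ≥0) * Φ ‖F x‖₊ := by
        refine lintegral_mono fun x => ?_
        rw [enorm_eq_nnnorm, ← ENNReal.coe_div hM, extend_coe, div_eq_inv_mul]
        exact h.mul_le hle _
    _ = ((M + 1 : ℝ≥0)⁻¹ : ℝ≥0) * ∫⁻ x, Φ ‖F x‖₊ := lintegral_const_mul' _ _ ENNReal.coe_ne_top
    _ ≤ ((M + 1 : ℝ≥0)⁻¹ : ℝ≥0) * ((M + 1 : ℝ≥0) : ℝ≥0∞) := by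
        gcongr
        exact hF.trans (by exact_mod_cast le_self_add)
    _ = 1 := by rw [← ENNReal.coe_mul, inv_mul_cancel₀ hM, ENNReal.coe_one]

/-- Every `k` admissible for `F` gives `M k` admissible for `G`. If no `k` is admissible, the right
side is infinite. -/
lemma luxemburgNorm_le_of_modular {Ω : Type*} [MeasurableSpace Ω] {μ : Measure Ω}
    {F G : Ω → ℝ≥0∞} {M : ℝ≥0} (hM : 0 < M)
    (h : ∀ k : ℝ≥0, 0 < k → ∫⁻ x, extend Φ (F x / k) ∂μ ≤ 1 →
      ∫⁻ x, extend Φ (G x / ((M * k : ℝ≥0) : ℝ≥0∞)) ∂μ ≤ 1) :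
    luxemburgNorm μ Φ G ≤ M * luxemburgNorm μ Φ F := by
  have hM0 : (M : ℝ≥0∞) ≠ 0 := by simpa using hM.ne'
  rw [mul_comm, ← ENNReal.div_le_iff_le_mul (Or.inl hM0) (Or.inl ENNReal.coe_ne_top)]
  refine le_iInf₂ fun k hk => ?_
  rw [ENNReal.div_le_iff_le_mul (Or.inl hM0) (Or.inl ENNReal.coe_ne_top), mul_comm,
    ← ENNReal.coe_mul]
  exact iInf₂_le _ ⟨mul_pos hM hk.1, h k hk.1 hk.2⟩

end Orlicz

/-! ### The two halves of the Littlewood–Paley estimate. -/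

section LittlewoodPaley

lemma IsHormander.mono {H₁ H₂ : Type*} [NormedAddCommGroup H₁] [InnerProductSpace ℂ H₁]
    [NormedAddCommGroup H₂] [InnerProductSpace ℂ H₂] {K : UnitAddCircle → H₁ →L[ℂ] H₂}
    {A B : ℝ≥0} (h : IsHormander K A) (hAB : A ≤ B) : IsHormander K B :=
  ⟨h.continuous, fun ρ y hρ hy => (h.hormander ρ y hρ hy).trans (by exact_mod_cast hAB)⟩

lemma BoundedOn.mono {H₁ H₂ : Type*} [NormedAddCommGroup H₁] [InnerProductSpace ℂ H₁]
    [NormedAddCommGroup H₂] [InnerProductSpace ℂ H₂] {K : UnitAddCircle → H₁ →L[ℂ] H₂} {r : ℝ}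
    {A B : ℝ≥0} (h : BoundedOn K r A) (hAB : A ≤ B) : BoundedOn K r B :=
  fun f hf => (h f hf).trans (by gcongr)

/-- Uniform modular bounds for `f ↦ (m_j(D) f)_{j < N}`. -/
theorem exists_modular_bound_vecKernel {Φ : ℝ≥0 → ℝ≥0∞} {u₀ K₁ K₂ : ℝ≥0}
    (h : Growth Φ u₀ K₁ K₂) (hfin : Φ u₀ ≠ ⊤) {m : ℕ → ℤ → ℂ} {A : ℝ} (hm : IsLPFamily m A) :
    ∃ M : ℝ≥0, ∀ N, ∀ f : UnitAddCircle → ℂ, Integrable f → ∫⁻ x, Φ ‖f x‖₊ ≤ 1 →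
      ∫⁻ x, Φ ‖conv (IsLPFamily.vecKernel m A N) f x‖₊ ≤ M := by
  obtain ⟨M, hM⟩ := exists_modular_bound h hfin
    (max (120 * A ^ 2 * (10 + 4 * A)).toNNReal (12 * A ^ 3).toNNReal)
  exact ⟨M, fun N f hf hf1 => hM _ _ _ ((hm.isHormander_vecKernel N).mono (le_max_left _ _))
    ((hm.boundedOn_vecKernel N).mono (le_max_right _ _)) f hf hf1⟩

/-- Uniform modular bounds for `(g_j)_{j < N} ↦ ∑ j, conj m_j(D) g_j`. -/
theorem exists_modular_bound_adjKernel {Φ : ℝ≥0 → ℝ≥0∞} {u₀ K₁ K₂ : ℝ≥0}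
    (h : Growth Φ u₀ K₁ K₂) (hfin : Φ u₀ ≠ ⊤) {m : ℕ → ℤ → ℂ} {A : ℝ} (hm : IsLPFamily m A) :
    ∃ M : ℝ≥0, ∀ N, ∀ g : UnitAddCircle → EuclideanSpace ℂ (Fin N), Integrable g →
      ∫⁻ x, Φ ‖g x‖₊ ≤ 1 →
      ∫⁻ x, Φ ‖conv (adjKernel (IsLPFamily.vecKernel m A N)) g x‖₊ ≤ M := by
  obtain ⟨M, hM⟩ := exists_modular_bound h hfin
    (max (120 * A ^ 2 * (10 + 4 * A)).toNNReal (12 * A ^ 3).toNNReal)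
  refine ⟨M, fun N g hg hg1 => ?_⟩
  have hK := (hm.isHormander_vecKernel N).mono
    (le_max_left _ (12 * A ^ 3).toNNReal)
  refine hM _ _ _ hK.adjKernel ?_ g hg hg1
  exact ((hm.boundedOn_vecKernel N).mono (le_max_right _ _)).adjKernel_two hK.continuous

/-- The adjoint operator in coordinates. -/
lemma conv_adjKernel_vecKernel (m : ℕ → ℤ → ℂ) (A : ℝ) (N : ℕ)
    {g : UnitAddCircle → EuclideanSpace ℂ (Fin N)} (hg : Integrable g) (x : UnitAddCircle) :
    conv (adjKernel (IsLPFamily.vecKernel m A N)) g x =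
      ∑ j : Fin N, trigPoly (Finset.Icc (-(cutoff A j : ℤ)) (cutoff A j))
        (fun n => starRingEnd ℂ (m j n) * fourierCoeff (fun y => g y j) n) x := by
  have hpt : ∀ y, adjKernel (IsLPFamily.vecKernel m A N) (x - y) (g y) =
      ∑ j : Fin N, trigPoly (Finset.Icc (-(cutoff A j : ℤ)) (cutoff A j))
        (fun n => starRingEnd ℂ (m j n)) (x - y) * g y j := by
    intro y
    have h1 : ∀ z : ℂ, z = inner ℂ (1 : ℂ) z := fun z => by simp
    rw [h1 (adjKernel _ _ _), adjKernel, ContinuousLinearMap.adjoint_inner_right,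
      PiLp.inner_apply]
    refine Finset.sum_congr rfl fun j _ => ?_
    rw [IsLPFamily.vecKernel_apply, mul_one, RCLike.inner_apply, lpKernel, star_trigPoly, neg_neg,
      mul_comm]
  have hgj : ∀ j : Fin N, Integrable fun y => g y j := fun j =>
    (EuclideanSpace.proj (𝕜 := ℂ) j).integrable_comp hg
  simp only [conv, hpt]
  rw [integral_finsetSum]
  · exact Finset.sum_congr rfl fun j _ => integral_trigPoly_sub_mul _ _ (hgj j) x
  · intro j _
    have hc : Continuous fun y => trigPoly (Finset.Icc (-(cutoff A j : ℤ)) (cutoff A j))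
        (fun n => starRingEnd ℂ (m j n)) (x - y) :=
      (continuous_trigPoly _ _).comp (continuous_const.sub continuous_id)
    obtain ⟨D, hD⟩ := exists_norm_le_of_continuous hc
    exact (hgj j).bdd_mul hc.aestronglyMeasurable (Eventually.of_forall hD)

lemma proj_eq_trigPoly {ψ : ℝ → ℂ} {A : ℝ} (hm : IsLPFamily (dyadicSymbol ψ 2) A) (j : ℕ)
    (f : UnitAddCircle → ℂ) (x : UnitAddCircle) :
    proj ψ j f x = trigPoly (Finset.Icc (-(cutoff A j : ℤ)) (cutoff A j))
      (fun n => dyadicSymbol ψ 2 j n * fourierCoeff f n) x := by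
  rw [proj, trigPoly, tsum_eq_sum (s := Finset.Icc (-(cutoff A j : ℤ)) (cutoff A j))]
  · exact Finset.sum_congr rfl fun n _ => by rw [symbol_eq_dyadicSymbol]
  · intro n hn
    rw [symbol_eq_dyadicSymbol, hm.supp_cutoff j n, zero_mul, zero_mul]
    rw [Finset.mem_Icc, ← abs_le] at hn
    exact not_le.1 hn

lemma enorm_conv_vecKernel {ψ : ℝ → ℂ} {A : ℝ} (hm : IsLPFamily (dyadicSymbol ψ 2) A) (N : ℕ)
    {f : UnitAddCircle → ℂ} (hf : Integrable f) (x : UnitAddCircle) :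
    ‖conv (IsLPFamily.vecKernel (dyadicSymbol ψ 2) A N) f x‖ₑ =
      (∑ j ∈ Finset.range N, ‖proj ψ j f x‖ₑ ^ 2) ^ (1 / 2 : ℝ) := by
  have hpow : ∀ z : ℂ, ‖z‖ₑ ^ 2 = ENNReal.ofReal (‖z‖ ^ 2) := fun z => by
    rw [← ofReal_norm, ENNReal.ofReal_pow (norm_nonneg _)]
  rw [← ofReal_norm, EuclideanSpace.norm_eq, Real.sqrt_eq_rpow,
    ← ENNReal.ofReal_rpow_of_nonneg (Finset.sum_nonneg fun j _ => by positivity) (by norm_num),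
    ENNReal.ofReal_sum_of_nonneg fun j _ => by positivity,
    ← Fin.sum_univ_eq_sum_range (fun j => ‖proj ψ j f x‖ₑ ^ 2) N]
  congr 1
  refine Finset.sum_congr rfl fun j _ => ?_
  rw [IsLPFamily.conv_vecKernel_apply _ _ _ hf, ← proj_eq_trigPoly hm, hpow]

lemma fourierCoeff_const_smul (c : ℂ) (f : UnitAddCircle → ℂ) (n : ℤ) :
    fourierCoeff (fun x => c • f x) n = c * fourierCoeff f n :=
  fourierCoeff.const_smul f c n

lemma proj_const_smul (ψ : ℝ → ℂ) (j : ℕ) (c : ℂ) (f : UnitAddCircle → ℂ) (x : UnitAddCircle) :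
    proj ψ j (fun x => c • f x) x = c * proj ψ j f x := by
  simp only [proj, fourierCoeff_const_smul]
  rw [← tsum_mul_left]
  exact tsum_congr fun n => by ring

lemma squareFunction_const_smul (ψ : ℝ → ℂ) (c : ℂ) (f : UnitAddCircle → ℂ) (x : UnitAddCircle) :
    squareFunction ψ (fun x => c • f x) x = ‖c‖ₑ * squareFunction ψ f x := by
  simp only [squareFunction, proj_const_smul, enorm_mul, mul_pow]
  rw [ENNReal.tsum_mul_left, ENNReal.mul_rpow_of_nonneg _ _ (by norm_num), ← ENNReal.rpow_natCast,
    ← ENNReal.rpow_mul]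
  norm_num

lemma enorm_inv_coe_mul {k : ℝ≥0} (hk : 0 < k) (t : ℝ≥0∞) : ‖((k : ℂ))⁻¹‖ₑ * t = t / k := by
  have h1 : ‖((k : ℝ) : ℂ)‖ₑ = k := by
    rw [← ofReal_norm, Complex.norm_real]; simp
  rw [enorm_inv (by exact_mod_cast hk.ne'), h1, ENNReal.div_eq_inv_mul]

end LittlewoodPaley

section LittlewoodPaley

variable {Φ : ℝ≥0 → ℝ≥0∞} {ψ : ℝ → ℂ} {f : UnitAddCircle → ℂ}

lemma lintegral_rescale (Φ : ℝ≥0 → ℝ≥0∞) (f : UnitAddCircle → ℂ) {k : ℝ≥0} (hk : 0 < k) :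
    ∫⁻ x, Φ ‖(k : ℂ)⁻¹ • f x‖₊ = ∫⁻ x, extend Φ (‖f x‖ₑ / k) := by
  refine lintegral_congr fun x => ?_
  rw [← enorm_inv_coe_mul hk, ← enorm_smul, enorm_eq_nnnorm, extend_coe]

lemma tendsto_enorm_conv_vecKernel {A : ℝ} (hm : IsLPFamily (dyadicSymbol ψ 2) A)
    (hf : Integrable f) (x : UnitAddCircle) :
    Tendsto (fun N => ‖conv (IsLPFamily.vecKernel (dyadicSymbol ψ 2) A N) f x‖ₑ) atTop
      (𝓝 (squareFunction ψ f x)) := by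
  simp only [enorm_conv_vecKernel hm _ hf]
  exact (ENNReal.continuous_rpow_const.tendsto _).comp (ENNReal.tendsto_nat_tsum _)

lemma enorm_conv_vecKernel_le {A : ℝ} (hm : IsLPFamily (dyadicSymbol ψ 2) A)
    (hf : Integrable f) (N : ℕ) (x : UnitAddCircle) :
    ‖conv (IsLPFamily.vecKernel (dyadicSymbol ψ 2) A N) f x‖ₑ ≤ squareFunction ψ f x := by
  rw [enorm_conv_vecKernel hm _ hf, squareFunction]
  gcongr
  exact ENNReal.sum_le_tsum _

lemma div_coe_div_coe (t : ℝ≥0∞) {k M : ℝ≥0} (hk : 0 < k) :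
    t / k / M = t / ((M * k : ℝ≥0) : ℝ≥0∞) := by
  have hk0 : (k : ℝ≥0∞) ≠ 0 := by simpa using hk.ne'
  rw [ENNReal.coe_mul, div_eq_mul_inv, div_eq_mul_inv, div_eq_mul_inv,
    ENNReal.mul_inv (Or.inr ENNReal.coe_ne_top) (Or.inr hk0), mul_assoc, mul_comm (k : ℝ≥0∞)⁻¹]

/-- The square function is bounded on the Orlicz space. -/
theorem exists_luxemburgNorm_squareFunction_le (hΦ : IsNiceYoung Φ) (hΔ : DeltaTwo Φ)
    (hN : NablaTwo Φ) {A : ℝ} (hm : IsLPFamily (dyadicSymbol ψ 2) A) :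
    ∃ C : ℝ≥0, 0 < C ∧ ∀ f : UnitAddCircle → ℂ, Integrable f →
      luxemburgNorm volume Φ (squareFunction ψ f) ≤ C * luxemburgNorm volume Φ fun x => ‖f x‖ₑ := by
  obtain ⟨u₀, K₁, K₂, hg⟩ := hΦ.toIsYoung.exists_growth hΔ hN
  obtain ⟨M, hM⟩ := exists_modular_bound_vecKernel hg (hΦ.finite u₀) hm
  obtain ⟨C, hC0, hMC⟩ : ∃ C : ℝ≥0, 0 < C ∧ M + 1 = C := ⟨M + 1, by positivity, rfl⟩
  refine ⟨C, hC0, fun f hf => ?_⟩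
  refine luxemburgNorm_le_of_modular (Φ := Φ) (F := fun x => ‖f x‖ₑ) (G := squareFunction ψ f)
    (M := C) hC0 ?_
  intro k hk hk1
  have hfk : Integrable fun x => (k : ℂ)⁻¹ • f x := hf.const_mul _
  rw [← lintegral_rescale Φ f hk] at hk1
  have hbound : ∀ N, ∫⁻ x, extend Φ (‖conv (IsLPFamily.vecKernel (dyadicSymbol ψ 2) A N)
      (fun x => (k : ℂ)⁻¹ • f x) x‖ₑ / (C : ℝ≥0∞)) ≤ 1 := by
    intro N
    rw [← hMC]
    exact hΦ.toIsYoung.lintegral_extend_div_le (hM N _ hfk hk1)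
  -- The bound is uniform in `N`, so it survives the limit from truncated to full square function.
  have h := hΦ.lintegral_extend_le_of_tendsto hC0
    (fun N => (continuous_conv (IsLPFamily.continuous_vecKernel _ A N) hfk).enorm.measurable)
    (Eventually.of_forall fun x => tendsto_enorm_conv_vecKernel hm hfk x) hbound
  refine (lintegral_congr fun x => ?_).trans_le h
  rw [squareFunction_const_smul, enorm_inv_coe_mul hk, div_coe_div_coe _ hk]

/-- The reproducing formula at the level of truncations. -/
lemma conv_adjKernel_conv_vecKernel {θ : ℕ → ℤ → ℂ} {A : ℝ}
    (hm : IsLPFamily (dyadicSymbol ψ 2) A)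
    (hθ : ∀ j n, starRingEnd ℂ (θ j n) = θ j n)
    (hrep : ∀ j n, θ j n * dyadicSymbol ψ 2 j n = dyadicSymbol ψ 2 j n)
    (hf : Integrable f) (N : ℕ) (x : UnitAddCircle) :
    conv (adjKernel (IsLPFamily.vecKernel θ A (N + 1)))
      (conv (IsLPFamily.vecKernel (dyadicSymbol ψ 2) A (N + 1)) f) x =
      trigPoly (Finset.Icc (-(cutoff A N : ℤ)) (cutoff A N))
        (fun n => ψ (n / 2 ^ N) * fourierCoeff f n) x := by
  have hA := hm.A_pos
  rw [conv_adjKernel_vecKernel _ _ _ (integrable_of_continuous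
    (continuous_conv (IsLPFamily.continuous_vecKernel _ A _) hf))]
  have hterm : ∀ j : Fin (N + 1), trigPoly (Finset.Icc (-(cutoff A j : ℤ)) (cutoff A j))
      (fun n => starRingEnd ℂ (θ j n) * fourierCoeff
        (fun y => conv (IsLPFamily.vecKernel (dyadicSymbol ψ 2) A (N + 1)) f y j) n) x =
      ∑ n ∈ Finset.Icc (-(cutoff A N : ℤ)) (cutoff A N),
        symbol ψ j (n : ℝ) * fourierCoeff f n * fourier n x := by
    intro j
    have hsub : Finset.Icc (-(cutoff A j : ℤ)) (cutoff A j) ⊆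
        Finset.Icc (-(cutoff A N : ℤ)) (cutoff A N) := by
      have : cutoff A j ≤ cutoff A N := by
        refine Nat.floor_le_floor ?_
        gcongr
        · exact one_le_two
        · exact Nat.lt_succ_iff.1 j.2
      exact Finset.Icc_subset_Icc (by omega) (by omega)
    rw [← Finset.sum_subset hsub, trigPoly]
    · refine Finset.sum_congr rfl fun n hn => ?_
      have h1 : (fun y => conv (IsLPFamily.vecKernel (dyadicSymbol ψ 2) A (N + 1)) f y j) =
          trigPoly (Finset.Icc (-(cutoff A j : ℤ)) (cutoff A j))
            (fun n => dyadicSymbol ψ 2 j n * fourierCoeff f n) :=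
        funext fun y => IsLPFamily.conv_vecKernel_apply _ _ _ hf y j
      rw [h1, fourierCoeff_trigPoly, if_pos hn, hθ, ← mul_assoc, hrep, symbol_eq_dyadicSymbol]
    · intro n _ hn
      rw [symbol_eq_dyadicSymbol, hm.supp_cutoff j n, zero_mul, zero_mul]
      rw [Finset.mem_Icc, ← abs_le] at hn
      exact not_le.1 hn
  -- Each frequency now carries `∑_{j ≤ N} ψ_j(n)`, which telescopes. The `N + 1` components
  -- correspond to `j = 0, …, N`.
  rw [Finset.sum_congr rfl fun j _ => hterm j, Finset.sum_comm, trigPoly]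
  refine Finset.sum_congr rfl fun n _ => ?_
  rw [← Finset.sum_mul, ← Finset.sum_mul,
    Fin.sum_univ_eq_sum_range (fun j => symbol ψ j (n : ℝ)) (N + 1), sum_symbol]

/-- The square function controls the function. -/
theorem exists_luxemburgNorm_le_squareFunction (hΦ : IsNiceYoung Φ) (hΔ : DeltaTwo Φ)
    (hN : NablaTwo Φ) {θ : ℕ → ℤ → ℂ} {A L : ℝ} (hm : IsLPFamily (dyadicSymbol ψ 2) A)
    (hmθ : IsLPFamily θ A) (hθ : ∀ j n, starRingEnd ℂ (θ j n) = θ j n)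
    (hrep : ∀ j n, θ j n * dyadicSymbol ψ 2 j n = dyadicSymbol ψ 2 j n)
    (hC : ∀ ξ, ‖ψ ξ‖ ≤ A) (hL : ∀ ξ η, ‖ψ ξ - ψ η‖ ≤ L * |ξ - η|) (hLA : L ≤ A)
    (hsupp : ∀ ξ, A < |ξ| → ψ ξ = 0) (hone : ∀ᶠ ξ in 𝓝 (0 : ℝ), ψ ξ = 1) :
    ∃ C : ℝ≥0, 0 < C ∧ ∀ f : UnitAddCircle → ℂ, Integrable f →
      luxemburgNorm volume Φ (fun x => ‖f x‖ₑ) ≤ C * luxemburgNorm volume Φ (squareFunction ψ f) := by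
  obtain ⟨u₀, K₁, K₂, hg⟩ := hΦ.toIsYoung.exists_growth hΔ hN
  obtain ⟨M, hM⟩ := exists_modular_bound_adjKernel hg (hΦ.finite u₀) hmθ
  obtain ⟨C, hC0, hMC⟩ : ∃ C : ℝ≥0, 0 < C ∧ M + 1 = C := ⟨M + 1, by positivity, rfl⟩
  refine ⟨C, hC0, fun f hf => ?_⟩
  refine luxemburgNorm_le_of_modular (Φ := Φ) (F := squareFunction ψ f) (G := fun x => ‖f x‖ₑ)
    (M := C) hC0 ?_
  intro k hk hk1
  set F : UnitAddCircle → ℂ := fun x => (k : ℂ)⁻¹ • f x with hF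
  have hFi : Integrable F := hf.const_mul _
  have hSF : ∀ x, squareFunction ψ F x = squareFunction ψ f x / k := fun x => by
    rw [hF, squareFunction_const_smul, enorm_inv_coe_mul hk]
  set T : ℕ → UnitAddCircle → ℂ := fun N => trigPoly (Finset.Icc (-(cutoff A N : ℤ)) (cutoff A N))
    (fun n => ψ (n / 2 ^ N) * fourierCoeff F n) with hT
  have hTc : ∀ N, Continuous (T N) := fun N => continuous_trigPoly _ _
  -- `T N` is the adjoint operator of `θ` applied to the vector of pieces of `F`, which is
  -- continuous and has norm at most the square function. No Orlicz bound on `F` itself enters.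
  have hbound : ∀ N, ∫⁻ x, extend Φ (‖T N x‖ₑ / (C : ℝ≥0∞)) ≤ 1 := by
    intro N
    rw [← hMC]
    refine hΦ.toIsYoung.lintegral_extend_div_le ?_
    have hgc := continuous_conv (IsLPFamily.continuous_vecKernel (dyadicSymbol ψ 2) A (N + 1)) hFi
    have h := hM (N + 1) _ (integrable_of_continuous hgc) ?_
    · simpa only [conv_adjKernel_conv_vecKernel hm hθ hrep hFi] using h
    · refine le_trans (lintegral_mono fun x => ?_) hk1
      rw [← extend_coe Φ, ← enorm_eq_nnnorm, ← hSF]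
      exact hΦ.toIsYoung.extend_mono (enorm_conv_vecKernel_le hm hFi _ x)
  -- `L¹` convergence yields an a.e. convergent subsequence, along which Fatou's lemma applies.
  have hlim := tendsto_lintegral_truncation_sub hm.one_le hC hL hLA hsupp hone hFi
  have hmeas : TendstoInMeasure volume T atTop F := by
    refine tendstoInMeasure_of_tendsto_eLpNorm one_ne_zero
      (fun N => (hTc N).aestronglyMeasurable) hFi.aestronglyMeasurable ?_
    simpa only [eLpNorm_one_eq_lintegral_enorm, hT, Pi.sub_apply] using hlim
  obtain ⟨ns, -, hns⟩ := hmeas.exists_seq_tendsto_ae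
  have h := hΦ.lintegral_extend_le_of_tendsto hC0 (G := fun i x => ‖T (ns i) x‖ₑ)
    (F := fun x => ‖F x‖ₑ) (fun i => (hTc (ns i)).enorm.measurable)
    (by
      filter_upwards [hns] with x hx
      exact hx.enorm) (fun i => hbound (ns i))
  refine (lintegral_congr fun x => ?_).trans_le h
  rw [hF, enorm_smul, enorm_inv_coe_mul hk, div_coe_div_coe _ hk]

/-- Quantitative bounds for a smooth compactly supported function. -/
lemma exists_bounds_of_contDiff (hψ : ContDiff ℝ ∞ ψ) (hψc : HasCompactSupport ψ) :
    ∃ C L R : ℝ, 1 ≤ R ∧ (∀ ξ, ‖ψ ξ‖ ≤ C) ∧ (∀ ξ η, ‖ψ ξ - ψ η‖ ≤ L * |ξ - η|) ∧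
      ∀ ξ, R < |ξ| → ψ ξ = 0 := by
  obtain ⟨C, hC⟩ := hψ.continuous.bounded_above_of_compact_support hψc
  obtain ⟨L, hL⟩ := hψ.lipschitzWith_of_hasCompactSupport hψc (by simp)
  obtain ⟨R, hR⟩ := hψc.isCompact.isBounded.subset_closedBall 0
  refine ⟨C, L, max 1 R, le_max_left _ _, hC, fun ξ η => ?_, fun ξ hξ => ?_⟩
  · have := hL.dist_le_mul ξ η
    rwa [dist_eq_norm, Real.dist_eq] at this
  · refine image_eq_zero_of_notMem_tsupport fun hmem => ?_
    have h1 := hR hmem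
    rw [Metric.mem_closedBall, dist_zero_right, Real.norm_eq_abs] at h1
    exact absurd (lt_of_le_of_lt (le_max_right 1 R) hξ) (not_lt.2 h1)

end LittlewoodPaley

end OrliczLP

theorem mainTheorem4 (Φ : ℝ≥0 → ℝ≥0∞) (hΦ : OrliczLP.IsNiceYoung Φ)
    (hΔ : OrliczLP.DeltaTwo Φ) (hN : OrliczLP.NablaTwo Φ)
    (ψ : ℝ → ℂ) (hψ : ContDiff ℝ ∞ ψ) (hψc : HasCompactSupport ψ)
    (hψ1 : ∀ᶠ ξ in 𝓝 (0 : ℝ), ψ ξ = 1) :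
    ∃ c C : ℝ≥0, 0 < c ∧ 0 < C ∧
      ∀ f : UnitAddCircle → ℂ, Integrable f volume →
        (c : ℝ≥0∞) * OrliczLP.luxemburgNorm volume Φ (fun x => ‖f x‖ₑ) ≤
            OrliczLP.luxemburgNorm volume Φ (OrliczLP.squareFunction ψ f) ∧
          OrliczLP.luxemburgNorm volume Φ (OrliczLP.squareFunction ψ f) ≤
            (C : ℝ≥0∞) * OrliczLP.luxemburgNorm volume Φ (fun x => ‖f x‖ₑ) := by
  obtain ⟨B, L, R, hR, hB, hL, hsupp⟩ := OrliczLP.exists_bounds_of_contDiff hψ hψc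
  obtain ⟨δ, hδ, hone⟩ := Metric.eventually_nhds_iff.1 hψ1
  have hone' : ∀ ξ : ℝ, |ξ| < δ → ψ ξ = 1 := fun ξ hξ => hone (by simpa using hξ)
  obtain ⟨θ, A₀, hθA, hθ, hrep⟩ := OrliczLP.exists_reproducing_family hR hδ hsupp hone'
  have hB0 : 0 ≤ B := (norm_nonneg _).trans (hB 0)
  have hL0 : 0 ≤ L := by simpa using (norm_nonneg _).trans (hL 1 0)
  -- One constant must serve both `ψ` and `θ`: it also fixes the frequency cutoffs, which have to
  -- agree in the reproducing formula.
  set A : ℝ := max A₀ (1 + 2 * B + R + 2 * 2 * L) with hA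
  have hA1 : 1 + 2 * B + R + 2 * 2 * L ≤ A := le_max_right _ _
  have hm : OrliczLP.IsLPFamily (OrliczLP.dyadicSymbol ψ 2) A :=
    OrliczLP.isLPFamily_dyadicSymbol one_le_two (by linarith) hB hL hsupp hA1
  obtain ⟨C, hC0, hC⟩ := OrliczLP.exists_luxemburgNorm_squareFunction_le hΦ hΔ hN hm
  obtain ⟨D, hD0, hD⟩ := OrliczLP.exists_luxemburgNorm_le_squareFunction hΦ hΔ hN hm
    (hθA A (le_max_left _ _)) hθ hrep (fun ξ => (hB ξ).trans (by linarith)) hL (by linarith)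
    (fun ξ hξ => hsupp ξ (by linarith)) hψ1
  refine ⟨D⁻¹, C, inv_pos.2 hD0, hC0, fun f hf => ⟨?_, hC f hf⟩⟩
  rw [ENNReal.coe_inv hD0.ne', ← ENNReal.div_eq_inv_mul]
  exact ENNReal.div_le_of_le_mul' (hD f hf)
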